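/- Let $T$ be a finite set of $m$ primitive tests and $\Sigma$ a set of actions. Boolean expressions are $b,c ::= 0 \mid 1 \mid t\in T \mid b\cdot c \mid b+c \mid \bar b$, and GKAT expressions are $e,f ::= p\in\Sigma \mid b \mid e\cdot f \mid e+_b f \mid e^{(b)}$ (do $p$; assert $b$; $e;f$; if $b$ then $e$ else $f$; while $b$ do $e$). The size $|e|$ is the number of symbols in $e$, those in its tests included. The set $\mathrm{At}$ of atoms is the set of the $2^m$ truth assignments on $T$; write $\alpha\le b$ if $b$ is true under $\alpha$. A guarded string is a word $\alpha_0p_1\alpha_1\cdots p_k\alpha_k$ with $\alpha_i\in\mathrm{At}$, $p_i\in\Sigma$. For sets $L,K$ of guarded strings let $L\diamond K=\{x\alpha y : x\alpha\in L,\ \alpha y\in K\}$, $L^0=\mathrm{At}$, $L^{k+1}=L^k\diamond L$. The semantics of expressions is $$[\![p]\!]=\{\alpha p\beta:\alpha,\beta\in\mathrm{At}\},\quad [\![b]\!]=\{\alpha:\alpha\le b\},\quad [\![e\cdot f]\!]=[\![e]\!]\diamond[\![f]\!],$$ $$[\![e+_bf]\!]=([\![b]\!]\diamond[\![e]\!])\cup([\![\bar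 b]\!]\diamond[\![f]\!]),\quad [\![e^{(b)}]\!]=\bigcup_{k\ge0}([\![b]\!]\diamond[\![e]\!])^k\diamond[\![\bar b]\!].$$ A $G$-automaton has a set $X$ of states, a start state, and a transition map $\delta : X\to(\{0,1\}+\Sigma\times X)^{\mathrm{At}}$ (reject, accept, or perform an action and move on). The Thompson automaton of $e$ has one state for each occurrence of an action in $e$, and a start state whose row is $\iota_e$. Here $\iota_b(\alpha)=1$ if $\alpha\le b$, else $0$; $\iota_p(\alpha)=(p,*)$, where $*$ is the state of that occurrence of $p$ and $\delta(*)(\alpha)=1$; $\iota_{f+_bg}(\alpha)$ is $\iota_f(\alpha)$ if $\alpha\le b$, else $\iota_g(\alpha)$; $\iota_{f\cdot g}(\alpha)$ is $\iota_f(\alpha)$ unless that is $1$, in which case it is $\iota_g(\alpha)$; and $\iota_{f^{(b)}}(\alpha)$ is $1$ if $\alpha\not\le b$, is $0$ if $\alpha\le b$ and $\iota_f(\alpha)=1$, and is $\iota_f(\alpha)$ otherwise. The transition maps of subexpressions are put together by disjoint union, where in $f\cdot g$ every value $\delta(x)(\alpha)=1$ at a state $x$ of $f$ is replaced by $\iota_g(\alpha)$,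 and in $f^{(b)}$ by $\iota_{f^{(b)}}(\alpha)$. Given $e_1,e_2$, the algorithm (1) builds the Thompson automata of $e_1$ and $e_2$, with disjoint sets of states; (2) normalizes them: it finds, by a reverse breadth-first search from the states $x$ with $\delta(x)(\alpha)=1$ for some $\alpha$, the states from which such a state is reachable, and replaces every transition to any other state by $0$; (3) runs the algorithm of Hopcroft and Karp on the two start states. This keeps a queue of pairs of states, which at first holds just the pair of start states, and a union-find forest of all states (union by rank, path compression). It takes pairs $(x,y)$ from the queue. If the roots of $x$ and $y$ agree, it goes on to the next pair. Otherwise it compares, for every atom $\alpha$, the values $\delta(x)(\alpha)$ and $\delta(y)(\alpha)$: equal values in $\{0,1\}$ are passed over; if the values are $(p,x')$ and $(p,y')$ with the same $p$, then $(x',y')$ is put into the queue; in all other cases the algorithm answers "false". After that it unites the two trees. It answers "true" when the queue is empty. Theorem. Implement this algorithm as a program of a random access machine with unit costs, whose input is the sequence of the symbols of $e_1$ and $e_2$ in postfix order, with the tests numbered from $0$ to $m-1$ and the actions represented by pairwise different natural numbers. Then the program always halts, and answers "true" if $[\![e_1]\!]=[\![e_2]\!]$ and "false" otherwise. If the number of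 atoms is considered constant, its running time is $O(n\cdot\alpha(n))$, where $n=|e_1|+|e_2|$ and $\alpha(n)=\min\{k : A(k,k)\ge n\}$ is the inverse of the Ackermann function $A$: for every $m$ there is a constant $C$, which depends only on $m$, such that the number of steps is at most $C\cdot n\cdot\alpha(n)$ for all $e_1,e_2$. -/

import Mathlib

namespace GKAT

/-! ## Syntax -/

/-- Boolean expressions over the primitive tests `T`. -/
inductive BExp (T : Type*) where
  | fls : BExp T
  | tru : BExp T
  | test : T → BExp T
  | and : BExp T → BExp T → BExp T
  | or : BExp T → BExp T → BExp T
  | not : BExp T → BExp T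

/-- GKAT expressions over the primitive tests `T` and the actions `P`. -/
inductive Exp (T P : Type*) where
  | act : P → Exp T P
  | assert : BExp T → Exp T P
  | seq : Exp T P → Exp T P → Exp T P
  /-- `ite b e f` is `if b then e else f`. -/
  | ite : BExp T → Exp T P → Exp T P → Exp T P
  /-- `loop b e` is `while b do e`. -/
  | loop : BExp T → Exp T P → Exp T P

/-- The size of a Boolean expression: the number of symbols in it. -/
def BExp.size {T : Type*} : BExp T → ℕ
  | .fls => 1
  | .tru => 1
  | .test _ => 1
  | .and b c => b.size + c.size + 1
  | .or b c => b.size + c.size + 1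
  | .not b => b.size + 1

/-- The size of an expression: the number of symbols in it, those in its tests included. -/
def Exp.size {T P : Type*} : Exp T P → ℕ
  | .act _ => 1
  | .assert b => b.size
  | .seq e f => e.size + f.size + 1
  | .ite b e f => b.size + e.size + f.size + 1
  | .loop b e => b.size + e.size + 1

/-- The actions that occur in an expression. -/
def Exp.actions {T P : Type*} : Exp T P → Set P
  | .act p => {p}
  | .assert _ => ∅
  | .seq e f => e.actions ∪ f.actions
  | .ite _ e f => e.actions ∪ f.actions
  | .loop _ e => e.actions

/-! ## The language model -/

/-- Atoms, as truth assignments on the primitive tests. -/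
abbrev Atom (T : Type*) := T → Bool

/-- The truth value of a Boolean expression under an atom; `b.eval α = true` says `α ≤ b`. -/
def BExp.eval {T : Type*} (α : Atom T) : BExp T → Bool
  | .fls => false
  | .tru => true
  | .test t => α t
  | .and b c => b.eval α && c.eval α
  | .or b c => b.eval α || c.eval α
  | .not b => !(b.eval α)

/-- Guarded strings `α₀ p₁ α₁ ⋯ pₙ αₙ`: the first atom, and the list of the pairs `(pᵢ, αᵢ)`. -/
structure GStr (T P : Type*) where
  head : Atom T
  tail : List (P × Atom T)

/-- The last atom of a guarded string. -/
def GStr.last {T P : Type*} (x : GStr T P) : Atom T :=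
  (x.tail.getLast?.map Prod.snd).getD x.head

/-- The fusion product of languages: all `x ⋄ y` with `x ∈ L` and `y ∈ K` for which it is defined,
that is, for which the last atom of `x` is the first atom of `y`. -/
def fuse {T P : Type*} (L K : Set (GStr T P)) : Set (GStr T P) :=
  {z | ∃ x ∈ L, ∃ y ∈ K, x.last = y.head ∧ z = ⟨x.head, x.tail ++ y.tail⟩}

/-- A set of atoms, as a language of guarded strings without actions. -/
def atoms {T P : Type*} (B : Set (Atom T)) : Set (GStr T P) :=
  {z | ∃ α ∈ B, z = ⟨α, []⟩}

/-- Powers for the fusion product. -/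
def power {T P : Type*} (L : Set (GStr T P)) : ℕ → Set (GStr T P)
  | 0 => atoms Set.univ
  | n + 1 => fuse (power L n) L

/-- The atoms below a Boolean expression. -/
def BExp.den {T : Type*} (b : BExp T) : Set (Atom T) := {α | b.eval α = true}

/-- The language of guarded strings denoted by an expression. -/
def Exp.den {T P : Type*} : Exp T P → Set (GStr T P)
  | .act p => {z | ∃ α β : Atom T, z = ⟨α, [(p, β)]⟩}
  | .assert b => atoms b.den
  | .seq e f => fuse e.den f.den
  | .ite b e f => fuse (atoms b.den) e.den ∪ fuse (atoms b.denᶜ) f.den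
  | .loop b e => ⋃ n : ℕ, fuse (power (fuse (atoms b.den) e.den) n) (atoms b.denᶜ)

/-! ## The inverse Ackermann function -/

/-- The inverse Ackermann function: the least `k` with `n ≤ A(k, k)`. -/
def invAck (n : ℕ) : ℕ := Nat.find (p := fun k => n ≤ ack k k) ⟨n, (lt_ack_left n n).le⟩

/-! ## The machine

A random access machine with structured control flow. It has registers, named by `V`, and arrays,
named by `A`, indexed by natural numbers; all of them hold natural numbers. The only arithmetic is
adding and subtracting one. Every operation has cost one. -/

/-- Terms over registers and array cells. -/
inductive Tm (V A : Type) where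
  | lit : ℕ → Tm V A
  | reg : V → Tm V A
  | get : A → Tm V A → Tm V A
  | succ : Tm V A → Tm V A
  | pred : Tm V A → Tm V A

/-- Conditions. -/
inductive Cnd (V A : Type) where
  | eq : Tm V A → Tm V A → Cnd V A
  | lt : Tm V A → Tm V A → Cnd V A
  | and : Cnd V A → Cnd V A → Cnd V A
  | not : Cnd V A → Cnd V A

/-- Programs. -/
inductive Cmd (V A : Type) where
  | skip : Cmd V A
  /-- Assignment to a register. -/
  | set : V → Tm V A → Cmd V A
  /-- `put a i t` is `a[i] := t`. -/
  | put : A → Tm V A → Tm V A → Cmd V A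
  | seq : Cmd V A → Cmd V A → Cmd V A
  | ite : Cnd V A → Cmd V A → Cmd V A → Cmd V A
  | loop : Cnd V A → Cmd V A → Cmd V A

/-- The memory of the machine. -/
structure Mem (V A : Type) where
  reg : V → ℕ
  arr : A → ℕ → ℕ

/-- The value of a term. -/
def Tm.eval {V A : Type} (s : Mem V A) : Tm V A → ℕ
  | .lit k => k
  | .reg x => s.reg x
  | .get a i => s.arr a (i.eval s)
  | .succ t => t.eval s + 1
  | .pred t => t.eval s - 1

/-- The cost of evaluating a term: the number of operations in it. -/
def Tm.cost {V A : Type} : Tm V A → ℕ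
  | .lit _ => 1
  | .reg _ => 1
  | .get _ i => i.cost + 1
  | .succ t => t.cost + 1
  | .pred t => t.cost + 1

/-- The value of a condition. -/
def Cnd.eval {V A : Type} (s : Mem V A) : Cnd V A → Bool
  | .eq t u => decide (t.eval s = u.eval s)
  | .lt t u => decide (t.eval s < u.eval s)
  | .and c d => c.eval s && d.eval s
  | .not c => !(c.eval s)

/-- The cost of evaluating a condition: the number of operations in it. -/
def Cnd.cost {V A : Type} : Cnd V A → ℕ
  | .eq t u => t.cost + u.cost + 1
  | .lt t u => t.cost + u.cost + 1
  | .and c d => c.cost + d.cost + 1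
  | .not c => c.cost + 1

/-- Writing to a register. -/
def Mem.set {V A : Type} [DecidableEq V] (s : Mem V A) (x : V) (v : ℕ) : Mem V A :=
  { s with reg := Function.update s.reg x v }

/-- Writing to an array cell. -/
def Mem.put {V A : Type} [DecidableEq A] (s : Mem V A) (a : A) (i v : ℕ) : Mem V A :=
  { s with arr := Function.update s.arr a (Function.update (s.arr a) i v) }

/-- `Exec c s s' k`: the program `c`, started in the memory `s`, halts in the memory `s'` after `k`
steps. -/
inductive Exec {V A : Type} [DecidableEq V] [DecidableEq A] :
    Cmd V A → Mem V A → Mem V A → ℕ → Prop where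
  | skip (s) : Exec .skip s s 1
  | set (x t s) : Exec (.set x t) s (s.set x (t.eval s)) (t.cost + 1)
  | put (a i t s) : Exec (.put a i t) s (s.put a (i.eval s) (t.eval s)) (i.cost + t.cost + 1)
  | seq {c d s₁ s₂ s₃ k l} : Exec c s₁ s₂ k → Exec d s₂ s₃ l → Exec (.seq c d) s₁ s₃ (k + l)
  | ite_true {b c d s s' k} : b.eval s = true → Exec c s s' k →
      Exec (.ite b c d) s s' (b.cost + k)
  | ite_false {b c d s s' k} : b.eval s = false → Exec d s s' k →
      Exec (.ite b c d) s s' (b.cost + k)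
  | loop_true {b c s₁ s₂ s₃ k l} : b.eval s₁ = true → Exec c s₁ s₂ k →
      Exec (.loop b c) s₂ s₃ l → Exec (.loop b c) s₁ s₃ (b.cost + k + l)
  | loop_false {b c s} : b.eval s = false → Exec (.loop b c) s s b.cost

/-- The machine is deterministic: result and running time are determined by program and input. -/
theorem Exec.det {V A : Type} [DecidableEq V] [DecidableEq A] {c : Cmd V A} {s s₁ s₂ : Mem V A}
    {k₁ k₂ : ℕ} (h₁ : Exec c s s₁ k₁) (h₂ : Exec c s s₂ k₂) : s₁ = s₂ ∧ k₁ = k₂ := by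
  induction h₁ generalizing s₂ k₂ with
  | skip => cases h₂; simp
  | set => cases h₂; simp
  | put => cases h₂; simp
  | seq _ _ ih₁ ih₂ =>
    cases h₂ with
    | seq g₁ g₂ =>
      obtain ⟨rfl, rfl⟩ := ih₁ g₁
      obtain ⟨rfl, rfl⟩ := ih₂ g₂
      simp
  | ite_true hb _ ih =>
    cases h₂ with
    | ite_true _ g => obtain ⟨rfl, rfl⟩ := ih g; simp
    | ite_false hb' _ => simp [hb] at hb'
  | ite_false hb _ ih =>
    cases h₂ with
    | ite_true hb' _ => simp [hb] at hb'
    | ite_false _ g => obtain ⟨rfl, rfl⟩ := ih g; simp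
  | loop_true hb _ _ ih₁ ih₂ =>
    cases h₂ with
    | loop_true _ g₁ g₂ =>
      obtain ⟨rfl, rfl⟩ := ih₁ g₁
      obtain ⟨rfl, rfl⟩ := ih₂ g₂
      simp
    | loop_false hb' => simp [hb] at hb'
  | loop_false hb =>
    cases h₂ with
    | loop_true hb' _ _ => simp [hb] at hb'
    | loop_false _ => simp

/-! ## Registers and arrays of the decision procedure

With `m` primitive tests there are `2 ^ m` atoms, numbered `0, …, 2 ^ m - 1`: the `j`-th test holds
in the atom `a` when the `j`-th binary digit of `a` is one. As the number of atoms is fixed, a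
function on atoms is stored in `2 ^ m` arrays, and loops over atoms are unrolled. -/

/-- Three tables of functions from atoms to `2 + Σ × X`. -/
inductive Tbl where
  /-- The initial pseudostate of the subexpression with a given root node. -/
  | ini
  /-- What replaces acceptance in the subexpression with a given root node. -/
  | cont
  /-- The transition map: the row of a state. -/
  | delta
  deriving DecidableEq

/-- The arrays. -/
inductive Arr where
  /-- Input: the symbols of the two expressions. -/
  | tok
  /-- Input: the name of the test or action, for symbols that are tests or actions. -/
  | arg
  /-- The operands of a node. -/
  | c1 | c2 | c3
  /-- The stack of the parser. -/
  | stk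
  /-- The state that belongs to an occurrence of an action. -/
  | sid
  /-- The entry for an atom in a row of a table: `0` is rejection, `1` acceptance, and `2` is a
  transition, whose action and target are in `act` and `tgt`. -/
  | res (t : Tbl) (a : ℕ) | act (t : Tbl) (a : ℕ) | tgt (t : Tbl) (a : ℕ)
  /-- For every atom, the linked lists of predecessors of the states (`0` ends a list, and `x + 1`
  stands for the state `x`). -/
  | rhead (a : ℕ) | rnext (a : ℕ)
  /-- The marks of live states, and the queue of the reverse breadth-first search. -/
  | live | bfs
  /-- The union-find forest. -/
  | parent | rank
  /-- The queue of pairs of states that have to be checked. -/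
  | todoX | todoY
  deriving DecidableEq

/-- The registers. -/
inductive Var where
  /-- Input: the number of symbols. -/
  | n
  /-- Output: `1` for equivalent, `0` for not equivalent. -/
  | out
  /-- The number of states. -/
  | states
  /-- The roots of the two expressions. -/
  | root1 | root2
  /-- The two start states. -/
  | start1 | start2
  | i | sp | hd | tl | x | y | z | w | rx | ry
  deriving DecidableEq

abbrev Prog := Cmd Var Arr

/-! ## The decision procedure -/

namespace Prog

/-- Sequential composition of a list of programs. -/
def block : List Prog → Prog
  | [] => .skip
  | [c] => c
  | c :: cs => .seq c (block cs)

/-- The program `f a` for each atom `a` in turn. -/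
def forAtoms (m : ℕ) (f : ℕ → Prog) : Prog := block ((List.range (2 ^ m)).map f)

/-- `for v = 0, …, b - 1 do c`. -/
def forUp (v b : Var) (c : Prog) : Prog :=
  block [.set v (.lit 0), .loop (.lt (.reg v) (.reg b)) (block [c, .set v (.succ (.reg v))])]

/-- `for v = b - 1, …, 0 do c`. -/
def forDown (v b : Var) (c : Prog) : Prog :=
  block [.set v (.reg b),
    .loop (.lt (.lit 0) (.reg v)) (block [.set v (.pred (.reg v)), c])]

/-- Case distinction on the value of a term; nothing happens if no case applies. -/
def switch (t : Tm Var Arr) : List (ℕ × Prog) → Prog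
  | [] => .skip
  | (k, c) :: cs => .ite (.eq t (.lit k)) c (switch t cs)

/-- `if c then p`. -/
def when (c : Cnd Var Arr) (p : Prog) : Prog := .ite c p .skip

/-- Copies the entry for the atom `a` of row `j` of table `u` to row `i` of table `t`. -/
def copy (a : ℕ) (t : Tbl) (i : Tm Var Arr) (u : Tbl) (j : Tm Var Arr) : Prog :=
  block [.put (.res t a) i (.get (.res u a) j), .put (.act t a) i (.get (.act u a) j),
    .put (.tgt t a) i (.get (.tgt u a) j)]

/-- The entry for the atom `a` in row `j` of table `t` is `k`. -/
def resIs (a : ℕ) (t : Tbl) (j : Tm Var Arr) (k : ℕ) : Cnd Var Arr :=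
  .eq (.get (.res t a) j) (.lit k)

/-- The symbol at the current position, and the nodes of its operands. -/
def tok : Tm Var Arr := .get .tok (.reg .i)
def arg : Tm Var Arr := .get .arg (.reg .i)
def op1 : Tm Var Arr := .get .c1 (.reg .i)
def op2 : Tm Var Arr := .get .c2 (.reg .i)
def op3 : Tm Var Arr := .get .c3 (.reg .i)

/-- Pops the stack into the cell `a[i]`. -/
def pop (a : Arr) : Prog :=
  block [.set .sp (.pred (.reg .sp)), .put a (.reg .i) (.get .stk (.reg .sp))]

/-- The symbols. -/
def kFls : ℕ := 0
def kTru : ℕ := 1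
def kTest : ℕ := 2
def kAnd : ℕ := 3
def kOr : ℕ := 4
def kNot : ℕ := 5
def kAct : ℕ := 6
def kSeq : ℕ := 7
def kIte : ℕ := 8
def kLoop : ℕ := 9

/-- Parsing: finds the operands of every node of the two syntax trees, and their roots. -/
def parse : Prog := block [
  .set .sp (.lit 0),
  forUp .i .n (block [
    switch tok [
      (kAnd, block [pop .c2, pop .c1]),
      (kOr, block [pop .c2, pop .c1]),
      (kNot, pop .c1),
      (kSeq, block [pop .c2, pop .c1]),
      (kIte, block [pop .c3, pop .c2, pop .c1]),
      (kLoop, block [pop .c2, pop .c1])],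
    .put .stk (.reg .sp) (.reg .i),
    .set .sp (.succ (.reg .sp))]),
  .set .root1 (.get .stk (.lit 0)),
  .set .root2 (.get .stk (.lit 1))]

/-- First half of the Thompson construction: bottom-up, the initial pseudostates of all
subexpressions, with a new state for every occurrence of an action. The row of a Boolean
expression holds its truth values, which make up its initial pseudostate. -/
def pseudostates (m : ℕ) : Prog := block [
  .set .states (.lit 0),
  forUp .i .n (switch tok [
    (kFls, forAtoms m fun a => .put (.res .ini a) (.reg .i) (.lit 0)),
    (kTru, forAtoms m fun a => .put (.res .ini a) (.reg .i) (.lit 1)),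
    (kTest, forAtoms m fun a => switch arg ((List.range m).map fun j =>
      (j, .put (.res .ini a) (.reg .i) (.lit (if a.testBit j then 1 else 0))))),
    (kAnd, forAtoms m fun a =>
      .ite (.and (resIs a .ini op1 1) (resIs a .ini op2 1))
        (.put (.res .ini a) (.reg .i) (.lit 1))
        (.put (.res .ini a) (.reg .i) (.lit 0))),
    (kOr, forAtoms m fun a =>
      .ite (.and (resIs a .ini op1 0) (resIs a .ini op2 0))
        (.put (.res .ini a) (.reg .i) (.lit 0))
        (.put (.res .ini a) (.reg .i) (.lit 1))),
    (kNot, forAtoms m fun a =>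
      .ite (resIs a .ini op1 1)
        (.put (.res .ini a) (.reg .i) (.lit 0))
        (.put (.res .ini a) (.reg .i) (.lit 1))),
    (kAct, block [
      .put .sid (.reg .i) (.reg .states),
      .set .states (.succ (.reg .states)),
      forAtoms m fun a => block [
        .put (.res .ini a) (.reg .i) (.lit 2),
        .put (.act .ini a) (.reg .i) arg,
        .put (.tgt .ini a) (.reg .i) (.get .sid (.reg .i))]]),
    (kSeq, forAtoms m fun a =>
      .ite (resIs a .ini op1 1) (copy a .ini (.reg .i) .ini op2) (copy a .ini (.reg .i) .ini op1)),
    (kIte, forAtoms m fun a =>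
      .ite (resIs a .ini op1 1) (copy a .ini (.reg .i) .ini op2) (copy a .ini (.reg .i) .ini op3)),
    (kLoop, forAtoms m fun a =>
      .ite (resIs a .ini op1 0) (.put (.res .ini a) (.reg .i) (.lit 1))
        (.ite (resIs a .ini op2 1) (.put (.res .ini a) (.reg .i) (.lit 0))
          (copy a .ini (.reg .i) .ini op2)))])]

/-- Second half of the Thompson construction: top-down, the uniform continuations of all
subexpressions, and from them the transitions of all states. -/
def transitions (m : ℕ) : Prog := block [
  forAtoms m fun a => block [
    .put (.res .cont a) (.reg .root1) (.lit 1),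
    .put (.res .cont a) (.reg .root2) (.lit 1)],
  forDown .i .n (switch tok [
    (kAct, forAtoms m fun a => copy a .delta (.get .sid (.reg .i)) .cont (.reg .i)),
    (kSeq, forAtoms m fun a => block [
      copy a .cont op2 .cont (.reg .i),
      .ite (resIs a .ini op2 1) (copy a .cont op1 .cont (.reg .i)) (copy a .cont op1 .ini op2)]),
    (kIte, forAtoms m fun a => block [
      copy a .cont op2 .cont (.reg .i),
      copy a .cont op3 .cont (.reg .i)]),
    (kLoop, forAtoms m fun a =>
      .ite (resIs a .ini (.reg .i) 1) (copy a .cont op2 .cont (.reg .i))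
        (copy a .cont op2 .ini (.reg .i)))])]

/-- A new start state whose row is the initial pseudostate at the given root. -/
def startState (m : ℕ) (v root : Var) : Prog := block [
  .set v (.reg .states),
  .set .states (.succ (.reg .states)),
  forAtoms m fun a => copy a .delta (.reg v) .ini (.reg root)]

/-- The Thompson automata of the two expressions, with disjoint sets of states. -/
def thompson (m : ℕ) : Prog := block [
  parse, pseudostates m, transitions m, startState m .start1 .root1, startState m .start2 .root2]

/-- Marks the given state as live, unless it is marked already, and queues it for the search. -/
def mark (t : Tm Var Arr) : Prog :=
  when (.eq (.get .live t) (.lit 0)) (block [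
    .put .live t (.lit 1),
    .put .bfs (.reg .tl) t,
    .set .tl (.succ (.reg .tl))])

/-- Normalization: finds the live states, by a reverse breadth-first search from the accepting
states, and redirects the transitions to dead states to rejection. -/
def normalize (m : ℕ) : Prog := block [
  forUp .x .states (block [
    .put .live (.reg .x) (.lit 0),
    forAtoms m fun a => .put (.rhead a) (.reg .x) (.lit 0)]),
  .set .hd (.lit 0),
  .set .tl (.lit 0),
  forUp .x .states (forAtoms m fun a => block [
    when (resIs a .delta (.reg .x) 1) (mark (.reg .x)),
    when (resIs a .delta (.reg .x) 2) (block [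
      .set .y (.get (.tgt .delta a) (.reg .x)),
      .put (.rnext a) (.reg .x) (.get (.rhead a) (.reg .y)),
      .put (.rhead a) (.reg .y) (.succ (.reg .x))])]),
  .loop (.lt (.reg .hd) (.reg .tl)) (block [
    .set .y (.get .bfs (.reg .hd)),
    .set .hd (.succ (.reg .hd)),
    forAtoms m fun a => block [
      .set .z (.get (.rhead a) (.reg .y)),
      .loop (.lt (.lit 0) (.reg .z)) (block [
        .set .x (.pred (.reg .z)),
        mark (.reg .x),
        .set .z (.get (.rnext a) (.reg .x))])]]),
  forUp .x .states (forAtoms m fun a =>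
    when (.and (resIs a .delta (.reg .x) 2)
        (.eq (.get .live (.get (.tgt .delta a) (.reg .x))) (.lit 0)))
      (.put (.res .delta a) (.reg .x) (.lit 0)))]

/-- Union-find: the forest in which every state is a root. -/
def disjointForest : Prog :=
  forUp .x .states (block [.put .parent (.reg .x) (.reg .x), .put .rank (.reg .x) (.lit 0)])

/-- Union-find: puts the root of `v` into `r`, with path compression. -/
def find (v r : Var) : Prog := block [
  .set r (.reg v),
  .loop (.not (.eq (.get .parent (.reg r)) (.reg r))) (.set r (.get .parent (.reg r))),
  .set .z (.reg v),
  .loop (.not (.eq (.reg .z) (.reg r))) (block [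
    .set .w (.get .parent (.reg .z)),
    .put .parent (.reg .z) (.reg r),
    .set .z (.reg .w)])]

/-- Union-find: joins the trees with roots `rx` and `ry`, by rank. -/
def union : Prog :=
  .ite (.lt (.get .rank (.reg .rx)) (.get .rank (.reg .ry)))
    (.put .parent (.reg .rx) (.reg .ry))
    (block [
      .put .parent (.reg .ry) (.reg .rx),
      when (.eq (.get .rank (.reg .rx)) (.get .rank (.reg .ry)))
        (.put .rank (.reg .rx) (.succ (.get .rank (.reg .rx))))])

/-- Appends a pair of states to the queue of pairs that have to be checked. -/
def push (t u : Tm Var Arr) : Prog := block [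
  .put .todoX (.reg .tl) t,
  .put .todoY (.reg .tl) u,
  .set .tl (.succ (.reg .tl))]

/-- Compares the entries for the atom `a` in the rows of the states `x` and `y`: nothing happens if
both reject or both accept; if both are transitions with the same action, then their targets have
to be checked; in all other cases the start states are not bisimilar. -/
def compare (a : ℕ) : Prog :=
  .ite (.and (.eq (.get (.res .delta a) (.reg .x)) (.get (.res .delta a) (.reg .y)))
      (.not (resIs a .delta (.reg .x) 2)))
    .skip
    (.ite (.and (.and (resIs a .delta (.reg .x) 2) (resIs a .delta (.reg .y) 2))
        (.eq (.get (.act .delta a) (.reg .x)) (.get (.act .delta a) (.reg .y))))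
      (push (.get (.tgt .delta a) (.reg .x)) (.get (.tgt .delta a) (.reg .y)))
      (.set .out (.lit 0)))

/-- The algorithm of Hopcroft and Karp, which checks whether the start states are bisimilar. It
stops as soon as `out` is `0`. -/
def hopcroftKarp (m : ℕ) : Prog := block [
  .set .hd (.lit 0),
  .set .tl (.lit 0),
  push (.reg .start1) (.reg .start2),
  disjointForest,
  .set .out (.lit 1),
  .loop (.and (.lt (.reg .hd) (.reg .tl)) (.eq (.reg .out) (.lit 1))) (block [
    .set .x (.get .todoX (.reg .hd)),
    .set .y (.get .todoY (.reg .hd)),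
    .set .hd (.succ (.reg .hd)),
    find .x .rx,
    find .y .ry,
    when (.not (.eq (.reg .rx) (.reg .ry))) (block [
      forAtoms m fun a => when (.eq (.reg .out) (.lit 1)) (compare a),
      when (.eq (.reg .out) (.lit 1)) union])])]

/-- The decision procedure, for `m` primitive tests. -/
def decideEquiv (m : ℕ) : Prog := block [thompson m, normalize m, hopcroftKarp m]

end Prog

/-! ## The input

An expression is given as the list of its symbols in postfix order. A symbol is a pair of numbers:
its kind, and the number of the test or the code of the action (`0` for all other symbols). -/

/-- The symbols of a Boolean expression; the function `τ` numbers the primitive tests. -/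
def BExp.symbols {T : Type*} (τ : T → ℕ) : BExp T → List (ℕ × ℕ)
  | .fls => [(Prog.kFls, 0)]
  | .tru => [(Prog.kTru, 0)]
  | .test t => [(Prog.kTest, τ t)]
  | .and b c => b.symbols τ ++ c.symbols τ ++ [(Prog.kAnd, 0)]
  | .or b c => b.symbols τ ++ c.symbols τ ++ [(Prog.kOr, 0)]
  | .not b => b.symbols τ ++ [(Prog.kNot, 0)]

/-- The symbols of an expression; the functions `τ` and `code` number the primitive tests and the
actions. -/
def Exp.symbols {T P : Type*} (τ : T → ℕ) (code : P → ℕ) : Exp T P → List (ℕ × ℕ)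
  | .act p => [(Prog.kAct, code p)]
  | .assert b => b.symbols τ
  | .seq e f => e.symbols τ code ++ f.symbols τ code ++ [(Prog.kSeq, 0)]
  | .ite b e f => b.symbols τ ++ e.symbols τ code ++ f.symbols τ code ++ [(Prog.kIte, 0)]
  | .loop b e => b.symbols τ ++ e.symbols τ code ++ [(Prog.kLoop, 0)]

/-- The memory that holds the given symbols as input, and is zero elsewhere. -/
def inputMem (l : List (ℕ × ℕ)) : Mem Var Arr where
  reg
    | .n => l.length
    | _ => 0
  arr
    | .tok => fun i => (l.getD i (0, 0)).1
    | .arg => fun i => (l.getD i (0, 0)).2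
    | _ => fun _ => 0

end GKAT

set_option linter.constructorNameAsVariable false

namespace GKAT

/-! ## Reasoning about programs -/

section Machine

variable {V A : Type}

/-! Correctness of the automata. The Thompson construction is read in continuation style: for every
row `k`, the pseudostate `Row.andThen (e.ini q) k` accepts exactly the product of the language of
`e` and the language of `k` (`Exp.accepts_andThen`, by induction on `e`). In the case of a loop one
turn is split off at a time; a turn without an action is rejected, so every turn shortens the word.
With acceptance as the continuation this gives `Exp.accepts_ini`, and equality of the two
denotations becomes language equality of two states of a disjoint union (`langEq_thompsonMap`).
Normalization does not change languages (`accepts_prune`), and after it every transition is the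
beginning of an accepted string. Hence language equality is a bisimulation (`match_of_langEq`),
while every bisimulation is contained in language equality (`langEq_of_bisimulation`).

Correctness of the last phase rests on the invariant `Joined`. On the one hand, if the start states
are language equivalent, then so are all pairs in the queue, and "false" is never answered. On the
other hand, every equivalence relation that contains the classes of the forest and the queued pairs
relates the start states, and the rows of states in one class match up to it. Once the queue is
empty, "same root" is such a relation, hence a bisimulation.

Correctness of the programs. A program without loops has an effect that can be computed (`Cmd.run`),
so a counted loop is an iterate of a function on memories. In postfix order every subexpression
occupies an interval of nodes that ends with its root; each pass over the nodes is therefore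
described by structural induction, as what a number of rounds equal to the size of a subexpression
does to its interval. The programs for different atoms do not interact (`forAtoms_run_local`), so a
claim about a row reduces to a claim about one entry.

Running time. The passes over nodes and states cost a constant, depending on `m`, per round. In the
reverse search every state is queued at most once, and for each atom the lists of predecessors have
total length at most the number `N` of states (`search_runs`). In the last phase a comparison
without conflict is followed by a union, which uses up a root and has queued at most `2 ^ m` pairs,
so the number of searches for roots is linear in `N` for fixed `m`. Their cost is amortized by a
potential that counts, for each node, pairs of a level and an iteration count not yet reached by the
rank of its parent. Compressing a path of length `l` costs `K + 1` beyond the drop in potential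
(`Forest.potential_compress`), since among the nodes of one level all but the last lose potential
(`phi_lt`); a union adds at most `K` (`Forest.link`). Here `K` is any number with `N ≤ ack K 1`, and
`invAck n + 1` is one (`add_two_le_ack_invAck`). The function `credit` puts these accounts together,
and `joinBody_exec` shows that it pays for every round. -/

@[simp] theorem Mem.set_reg [DecidableEq V] (s : Mem V A) (x y : V) (v : ℕ) :
    (s.set x v).reg y = if y = x then v else s.reg y := by
  simp [Mem.set, Function.update_apply]

@[simp] theorem Mem.set_arr [DecidableEq V] (s : Mem V A) (x : V) (v : ℕ) :
    (s.set x v).arr = s.arr := rfl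

@[simp] theorem Mem.put_reg [DecidableEq A] (s : Mem V A) (a : A) (i v : ℕ) :
    (s.put a i v).reg = s.reg := rfl

@[simp] theorem Mem.put_arr [DecidableEq A] (s : Mem V A) (a b : A) (i j v : ℕ) :
    (s.put a i v).arr b j = if b = a ∧ j = i then v else s.arr b j := by
  by_cases h : b = a
  · subst h; simp [Mem.put, Function.update_apply]
  · simp [Mem.put, h]

theorem Mem.put_arr_of_ne [DecidableEq A] (s : Mem V A) {a b : A} (h : b ≠ a) (i v : ℕ) :
    (s.put a i v).arr b = s.arr b := by
  simp [Mem.put, h]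

theorem Mem.ext' {s s' : Mem V A} (h₁ : ∀ x, s.reg x = s'.reg x) (h₂ : ∀ a, s.arr a = s'.arr a) :
    s = s' := by
  cases s; cases s'; simp only [Mem.mk.injEq]
  exact ⟨funext h₁, funext h₂⟩

theorem Cnd.eval_eq_iff {s : Mem V A} {t u : Tm V A} :
    (Cnd.eq t u).eval s = true ↔ t.eval s = u.eval s := decide_eq_true_iff

theorem Cnd.eval_lt_iff {s : Mem V A} {t u : Tm V A} :
    (Cnd.lt t u).eval s = true ↔ t.eval s < u.eval s := decide_eq_true_iff

theorem Cnd.eval_and_iff {s : Mem V A} {c d : Cnd V A} :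
    (Cnd.and c d).eval s = true ↔ c.eval s = true ∧ d.eval s = true := Bool.and_eq_true_iff

theorem Cnd.eval_not_iff {s : Mem V A} {c : Cnd V A} :
    (Cnd.not c).eval s = true ↔ ¬ c.eval s = true := by simp [Cnd.eval]

/-! ### Programs without loops: effect, cost, and what they read and write -/

/-- A program without loops. -/
def Cmd.LoopFree : Cmd V A → Prop
  | .skip => True
  | .set _ _ => True
  | .put _ _ _ => True
  | .seq c d => c.LoopFree ∧ d.LoopFree
  | .ite _ c d => c.LoopFree ∧ d.LoopFree
  | .loop _ _ => False

/-- An upper bound for the cost of a program without loops. -/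
def Cmd.bound : Cmd V A → ℕ
  | .skip => 1
  | .set _ t => t.cost + 1
  | .put _ i t => i.cost + t.cost + 1
  | .seq c d => c.bound + d.bound
  | .ite b c d => b.cost + (c.bound + d.bound)
  | .loop _ _ => 0

/-- The program may write to the register `x`. -/
def Cmd.WritesReg (x : V) : Cmd V A → Prop
  | .skip => False
  | .set y _ => x = y
  | .put _ _ _ => False
  | .seq c d => c.WritesReg x ∨ d.WritesReg x
  | .ite _ c d => c.WritesReg x ∨ d.WritesReg x
  | .loop _ c => c.WritesReg x

/-- The program may write to the array `a`. -/
def Cmd.WritesArr (a : A) : Cmd V A → Prop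
  | .skip => False
  | .set _ _ => False
  | .put b _ _ => a = b
  | .seq c d => c.WritesArr a ∨ d.WritesArr a
  | .ite _ c d => c.WritesArr a ∨ d.WritesArr a
  | .loop _ c => c.WritesArr a

/-- All arrays that occur in a term satisfy `S`. -/
def Tm.UsesIn (S : A → Prop) : Tm V A → Prop
  | .lit _ => True
  | .reg _ => True
  | .get a i => S a ∧ i.UsesIn S
  | .succ t => t.UsesIn S
  | .pred t => t.UsesIn S

/-- All arrays that occur in a condition satisfy `S`. -/
def Cnd.UsesIn (S : A → Prop) : Cnd V A → Prop
  | .eq t u => t.UsesIn S ∧ u.UsesIn S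
  | .lt t u => t.UsesIn S ∧ u.UsesIn S
  | .and c d => c.UsesIn S ∧ d.UsesIn S
  | .not c => c.UsesIn S

/-- All arrays that a program reads satisfy `S`. -/
def Cmd.UsesIn (S : A → Prop) : Cmd V A → Prop
  | .skip => True
  | .set _ t => t.UsesIn S
  | .put _ i t => i.UsesIn S ∧ t.UsesIn S
  | .seq c d => c.UsesIn S ∧ d.UsesIn S
  | .ite b c d => b.UsesIn S ∧ c.UsesIn S ∧ d.UsesIn S
  | .loop b c => b.UsesIn S ∧ c.UsesIn S

section Agree

variable {S : A → Prop} {s s' : Mem V A}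

theorem Tm.eval_congr (hr : s.reg = s'.reg) (ha : ∀ a, S a → s.arr a = s'.arr a) {t : Tm V A}
    (ht : t.UsesIn S) : t.eval s = t.eval s' := by
  induction t with
  | lit => rfl
  | reg x => simp [Tm.eval, hr]
  | get a i ih => simp [Tm.eval, ih ht.2, ha a ht.1]
  | succ t ih => simp [Tm.eval, ih ht]
  | pred t ih => simp [Tm.eval, ih ht]

theorem Cnd.eval_congr (hr : s.reg = s'.reg) (ha : ∀ a, S a → s.arr a = s'.arr a) {c : Cnd V A}
    (hc : c.UsesIn S) : c.eval s = c.eval s' := by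
  induction c with
  | eq t u => simp [Cnd.eval, Tm.eval_congr hr ha hc.1, Tm.eval_congr hr ha hc.2]
  | lt t u => simp [Cnd.eval, Tm.eval_congr hr ha hc.1, Tm.eval_congr hr ha hc.2]
  | and c d ihc ihd => simp [Cnd.eval, ihc hc.1, ihd hc.2]
  | not c ih => simp [Cnd.eval, ih hc]

end Agree

variable [DecidableEq V] [DecidableEq A]

/-- The effect of a program without loops. -/
def Cmd.run : Cmd V A → Mem V A → Mem V A
  | .skip, s => s
  | .set x t, s => s.set x (t.eval s)
  | .put a i t, s => s.put a (i.eval s) (t.eval s)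
  | .seq c d, s => d.run (c.run s)
  | .ite b c d, s => if b.eval s = true then c.run s else d.run s
  -- A default value, never the true effect of a loop. With it the lemmas on unwritten registers and
  -- arrays hold for `run` without a hypothesis `LoopFree`.
  | .loop _ _, s => s

theorem Cmd.run_reg_of_not_writes {x : V} {c : Cmd V A} (h : ¬ c.WritesReg x) (s : Mem V A) :
    (c.run s).reg x = s.reg x := by
  induction c generalizing s with
  | skip => rfl
  | set y t => simp [Cmd.run, show x ≠ y from h]
  | put => rfl
  | seq c d ihc ihd =>
    simp only [Cmd.WritesReg, not_or] at h
    simp [Cmd.run, ihc h.1, ihd h.2]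
  | ite b c d ihc ihd =>
    simp only [Cmd.WritesReg, not_or] at h
    simp only [Cmd.run]; split_ifs <;> simp [ihc h.1, ihd h.2]
  | loop => rfl

theorem Cmd.run_arr_of_not_writes {a : A} {c : Cmd V A} (h : ¬ c.WritesArr a) (s : Mem V A) :
    (c.run s).arr a = s.arr a := by
  induction c generalizing s with
  | skip => rfl
  | set => rfl
  | put b i t => exact Mem.put_arr_of_ne _ h _ _
  | seq c d ihc ihd =>
    simp only [Cmd.WritesArr, not_or] at h
    simp [Cmd.run, ihc h.1, ihd h.2]
  | ite b c d ihc ihd =>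
    simp only [Cmd.WritesArr, not_or] at h
    simp only [Cmd.run]; split_ifs <;> simp [ihc h.1, ihd h.2]
  | loop => rfl

/-- A frame rule. Being written is a property of the syntax, so it applies to programs with loops,
whatever number of rounds they make. -/
theorem Exec.reg_eq {x : V} {c : Cmd V A} {s s' : Mem V A} {k : ℕ} (h : Exec c s s' k)
    (hx : ¬ c.WritesReg x) : s'.reg x = s.reg x := by
  induction h with
  | skip => rfl
  | set y t => simp [show x ≠ y from hx]
  | put => rfl
  | seq _ _ ih₁ ih₂ =>
    simp only [Cmd.WritesReg, not_or] at hx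
    rw [ih₂ hx.2, ih₁ hx.1]
  | ite_true _ _ ih => simp only [Cmd.WritesReg, not_or] at hx; exact ih hx.1
  | ite_false _ _ ih => simp only [Cmd.WritesReg, not_or] at hx; exact ih hx.2
  | loop_true _ _ _ ih₁ ih₂ => rw [ih₂ hx, ih₁ hx]
  | loop_false => rfl

theorem Exec.arr_eq {a : A} {c : Cmd V A} {s s' : Mem V A} {k : ℕ} (h : Exec c s s' k)
    (ha : ¬ c.WritesArr a) : s'.arr a = s.arr a := by
  induction h with
  | skip => rfl
  | set => rfl
  | put => exact Mem.put_arr_of_ne _ ha _ _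
  | seq _ _ ih₁ ih₂ =>
    simp only [Cmd.WritesArr, not_or] at ha
    rw [ih₂ ha.2, ih₁ ha.1]
  | ite_true _ _ ih => simp only [Cmd.WritesArr, not_or] at ha; exact ih ha.1
  | ite_false _ _ ih => simp only [Cmd.WritesArr, not_or] at ha; exact ih ha.2
  | loop_true _ _ _ ih₁ ih₂ => rw [ih₂ ha, ih₁ ha]
  | loop_false => rfl

/-- A program that reads only arrays in `S` makes the same decisions and writes the same values in
both memories; writes outside `S` are never seen again. This is the source of the independence of
different atoms. -/
theorem Cmd.run_congr {S : A → Prop} {c : Cmd V A} (hc : c.UsesIn S) {s s' : Mem V A}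
    (hr : s.reg = s'.reg) (ha : ∀ a, S a → s.arr a = s'.arr a) :
    (c.run s).reg = (c.run s').reg ∧ ∀ a, S a → (c.run s).arr a = (c.run s').arr a := by
  induction c generalizing s s' with
  | skip => exact ⟨hr, ha⟩
  | set x t =>
    refine ⟨?_, ha⟩
    funext y
    simp [Cmd.run, Tm.eval_congr hr ha hc, hr]
  | put b i t =>
    refine ⟨hr, fun a h => ?_⟩
    funext j
    simp [Cmd.run, Tm.eval_congr hr ha hc.1, Tm.eval_congr hr ha hc.2, ha a h]
  | seq c d ihc ihd =>
    obtain ⟨h₁, h₂⟩ := ihc hc.1 hr ha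
    exact ihd hc.2 h₁ h₂
  | ite b c d ihc ihd =>
    simp only [Cmd.run, Cnd.eval_congr hr ha hc.1]
    split_ifs
    · exact ihc hc.2.1 hr ha
    · exact ihd hc.2.2 hr ha
  | loop => exact ⟨hr, ha⟩

/-- Connects the relational semantics with the computed effect. From here on, programs without loops
are handled by simplifying `run`. -/
theorem Cmd.LoopFree.exec {c : Cmd V A} (h : c.LoopFree) (s : Mem V A) :
    ∃ k ≤ c.bound, Exec c s (c.run s) k := by
  induction c generalizing s with
  | skip => exact ⟨_, le_rfl, .skip s⟩
  | set x t => exact ⟨_, le_rfl, .set x t s⟩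
  | put a i t => exact ⟨_, le_rfl, .put a i t s⟩
  | seq c d ihc ihd =>
    obtain ⟨k, hk, h₁⟩ := ihc h.1 s
    obtain ⟨l, hl, h₂⟩ := ihd h.2 (c.run s)
    exact ⟨k + l, Nat.add_le_add hk hl, .seq h₁ h₂⟩
  | ite b c d ihc ihd =>
    by_cases hb : b.eval s = true
    · obtain ⟨k, hk, h₁⟩ := ihc h.1 s
      refine ⟨b.cost + k, by simp only [Cmd.bound]; omega, ?_⟩
      simp only [Cmd.run, hb, if_true]
      exact .ite_true hb h₁
    · obtain ⟨k, hk, h₁⟩ := ihd h.2 s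
      refine ⟨b.cost + k, by simp only [Cmd.bound]; omega, ?_⟩
      simp only [Cmd.run, hb]
      exact .ite_false (by simpa using hb) h₁
  | loop => exact h.elim

/-! ### Total correctness with a bound on the number of steps -/

/-- The program `c`, started in the memory `s`, halts within `t` steps in a memory with the
property `Q`. -/
def Runs (c : Cmd V A) (s : Mem V A) (t : ℕ) (Q : Mem V A → Prop) : Prop :=
  ∃ s' k, Exec c s s' k ∧ k ≤ t ∧ Q s'

namespace Runs

variable {c d : Cmd V A} {s : Mem V A} {t t₁ t₂ : ℕ} {Q R : Mem V A → Prop}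

theorem mono (h : Runs c s t₁ Q) (ht : t₁ ≤ t₂) (hQ : ∀ s', Q s' → R s') : Runs c s t₂ R := by
  obtain ⟨s', k, h, hk, hs⟩ := h
  exact ⟨s', k, h, hk.trans ht, hQ _ hs⟩

theorem of_loopFree (h : c.LoopFree) (ht : c.bound ≤ t) (hQ : Q (c.run s)) : Runs c s t Q := by
  obtain ⟨k, hk, he⟩ := h.exec s
  exact ⟨_, k, he, hk.trans ht, hQ⟩

theorem seq (h₁ : Runs c s t₁ R) (h₂ : ∀ s', R s' → Runs d s' t₂ Q) :
    Runs (.seq c d) s (t₁ + t₂) Q := by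
  obtain ⟨s', k, h, hk, hs⟩ := h₁
  obtain ⟨s'', l, h', hl, hs'⟩ := h₂ s' hs
  exact ⟨s'', k + l, .seq h h', Nat.add_le_add hk hl, hs'⟩

/-- The rule for loops: the invariant `I s u` says that `u` more steps are allowed in `s`. -/
theorem loop {b : Cnd V A} (I : Mem V A → ℕ → Prop) {u : ℕ} (h₀ : I s u)
    (hstep : ∀ s u, I s u → b.eval s = true →
      ∃ t, Runs c s t fun s' => ∃ u', I s' u' ∧ b.cost + t + u' ≤ u)
    (hend : ∀ s u, I s u → b.eval s = false → b.cost ≤ u ∧ Q s) : Runs (.loop b c) s u Q := by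
  -- Termination comes from the budget alone: every test costs at least one step, so `u` decreases
  -- strictly from round to round, and no other variant is needed.
  have hb₀ : 1 ≤ b.cost := by cases b <;> simp [Cnd.cost]
  induction u using Nat.strong_induction_on generalizing s with
  | _ u ih =>
    by_cases hb : b.eval s = true
    · obtain ⟨t, s', k, h, hk, u', hI, hu⟩ := hstep s u h₀ hb
      obtain ⟨s'', l, h', hl, hQ⟩ := ih u' (by omega) hI
      exact ⟨s'', _, .loop_true hb h h', by omega, hQ⟩
    · have hb' : b.eval s = false := by simpa using hb
      obtain ⟨h₁, h₂⟩ := hend s u h₀ hb'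
      exact ⟨s, _, .loop_false hb', h₁, h₂⟩

theorem and_reg_eq (h : Runs c s t Q) :
    Runs c s t fun s' => Q s' ∧ (∀ x, ¬ c.WritesReg x → s'.reg x = s.reg x) ∧
      ∀ a, ¬ c.WritesArr a → s'.arr a = s.arr a := by
  obtain ⟨s', k, h, hk, hs⟩ := h
  exact ⟨s', k, h, hk, hs, fun x hx => h.reg_eq hx, fun a ha => h.arr_eq ha⟩

end Runs

end Machine

/-! ### Blocks, switches and unrolled loops over the atoms -/

namespace Prog

theorem block_cons_run (c : Prog) (cs : List Prog) (s : Mem Var Arr) :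
    (block (c :: cs)).run s = (block cs).run (c.run s) := by
  cases cs <;> rfl

theorem block_writesReg (cs : List Prog) (x : Var) :
    (block cs).WritesReg x ↔ ∃ c ∈ cs, c.WritesReg x := by
  induction cs with
  | nil => simp [block, Cmd.WritesReg]
  | cons c cs ih =>
    cases cs with
    | nil => simp [block]
    | cons d ds => simp only [block, Cmd.WritesReg, ih]; simp

theorem block_writesArr (cs : List Prog) (a : Arr) :
    (block cs).WritesArr a ↔ ∃ c ∈ cs, c.WritesArr a := by
  induction cs with
  | nil => simp [block, Cmd.WritesArr]
  | cons c cs ih =>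
    cases cs with
    | nil => simp [block]
    | cons d ds => simp only [block, Cmd.WritesArr, ih]; simp

theorem block_usesIn (cs : List Prog) (S : Arr → Prop) :
    (block cs).UsesIn S ↔ ∀ c ∈ cs, c.UsesIn S := by
  induction cs with
  | nil => simp [block, Cmd.UsesIn]
  | cons c cs ih =>
    cases cs with
    | nil => simp [block]
    | cons d ds => simp only [block, Cmd.UsesIn, ih]; simp

theorem block_loopFree (cs : List Prog) : (block cs).LoopFree ↔ ∀ c ∈ cs, c.LoopFree := by
  induction cs with
  | nil => simp [block, Cmd.LoopFree]
  | cons c cs ih =>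
    cases cs with
    | nil => simp [block]
    | cons d ds => simp only [block, Cmd.LoopFree, ih]; simp

theorem forAtoms_writesReg (m : ℕ) (f : ℕ → Prog) (x : Var) :
    (forAtoms m f).WritesReg x ↔ ∃ a < 2 ^ m, (f a).WritesReg x := by
  simp [forAtoms, block_writesReg]

theorem forAtoms_writesArr (m : ℕ) (f : ℕ → Prog) (x : Arr) :
    (forAtoms m f).WritesArr x ↔ ∃ a < 2 ^ m, (f a).WritesArr x := by
  simp [forAtoms, block_writesArr]

theorem forAtoms_loopFree (m : ℕ) (f : ℕ → Prog) :
    (forAtoms m f).LoopFree ↔ ∀ a < 2 ^ m, (f a).LoopFree := by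
  simp [forAtoms, block_loopFree]

theorem switch_writesReg (t : Tm Var Arr) (cs : List (ℕ × Prog)) (x : Var) :
    (switch t cs).WritesReg x ↔ ∃ c ∈ cs, c.2.WritesReg x := by
  induction cs with
  | nil => simp [switch, Cmd.WritesReg]
  | cons c cs ih => simp [switch, Cmd.WritesReg, ih]

theorem switch_writesArr (t : Tm Var Arr) (cs : List (ℕ × Prog)) (x : Arr) :
    (switch t cs).WritesArr x ↔ ∃ c ∈ cs, c.2.WritesArr x := by
  induction cs with
  | nil => simp [switch, Cmd.WritesArr]
  | cons c cs ih => simp [switch, Cmd.WritesArr, ih]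

theorem switch_usesIn (t : Tm Var Arr) (ht : t.UsesIn S) (cs : List (ℕ × Prog))
    (hcs : ∀ c ∈ cs, c.2.UsesIn S) : (switch t cs).UsesIn S := by
  induction cs with
  | nil => simp [switch, Cmd.UsesIn]
  | cons c cs ih =>
    exact ⟨⟨ht, trivial⟩, hcs c (by simp), ih fun d hd => hcs d (by simp [hd])⟩

theorem switch_loopFree (t : Tm Var Arr) (cs : List (ℕ × Prog)) :
    (switch t cs).LoopFree ↔ ∀ c ∈ cs, c.2.LoopFree := by
  induction cs with
  | nil => simp [switch, Cmd.LoopFree]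
  | cons c cs ih => simp [switch, Cmd.LoopFree, ih]

theorem switch_map_run (t : Tm Var Arr) (f : ℕ → Prog) (l : List ℕ) (s : Mem Var Arr)
    (h : t.eval s ∈ l) : (switch t (l.map fun j => (j, f j))).run s = (f (t.eval s)).run s := by
  induction l with
  | nil => simp at h
  | cons k l ih =>
    simp only [List.map_cons, switch, Cmd.run, Cnd.eval_eq_iff, Tm.eval]
    by_cases hk : t.eval s = k
    · simp [hk]
    · rw [if_neg hk]
      exact ih (by simpa [hk] using h)

/-- The rule for unrolled loops. The start `a` is general so that the induction can peel off the
first program; the extra step pays for the `skip` of an empty block. -/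
theorem block_runs {I : ℕ → Mem Var Arr → Prop} (t : ℕ → ℕ) (f : ℕ → Prog) (k a : ℕ)
    {s : Mem Var Arr} (h₀ : I a s)
    (hstep : ∀ b, a ≤ b → b < a + k → ∀ s, I b s → Runs (f b) s (t b) (I (b + 1))) :
    Runs (block ((List.range' a k).map f)) s (∑ b ∈ Finset.range k, t (a + b) + 1)
      (I (a + k)) := by
  induction k generalizing a s with
  | zero => exact ⟨s, 1, .skip s, by simp, h₀⟩
  | succ k ih =>
    rw [List.range'_succ, List.map_cons, Finset.sum_range_succ']
    have h₁ := hstep a le_rfl (by omega) s h₀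
    have h₂ : ∀ s', I (a + 1) s' → Runs (block ((List.range' (a + 1) k).map f)) s'
        (∑ b ∈ Finset.range k, t (a + 1 + b) + 1) (I (a + 1 + k)) := fun s' hs' =>
      ih (a + 1) hs' fun b hb hb' => hstep b (by omega) (by omega)
    have e : ∑ b ∈ Finset.range k, t (a + (b + 1)) = ∑ b ∈ Finset.range k, t (a + 1 + b) :=
      Finset.sum_congr rfl fun b _ => by congr 1; omega
    rw [e, show a + (k + 1) = a + 1 + k by omega]
    -- The block of a one-element list is its element, without a trailing `skip`, so the last
    -- program is not the left half of a composition and needs a case of its own.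
    cases k with
    | zero =>
      simp only [List.range'_zero, List.map_nil, block, Finset.range_zero, Finset.sum_empty] at *
      exact h₁.mono (by simp) fun s' h => h
    | succ k =>
      rw [List.range'_succ, List.map_cons] at *
      exact (h₁.seq h₂).mono (by simp; omega) fun s' h => h

theorem forAtoms_runs {m : ℕ} {f : ℕ → Prog} {s : Mem Var Arr} (I : ℕ → Mem Var Arr → Prop)
    (t : ℕ → ℕ) (h₀ : I 0 s)
    (hstep : ∀ a < 2 ^ m, ∀ s, I a s → Runs (f a) s (t a) (I (a + 1))) :
    Runs (forAtoms m f) s (∑ a ∈ Finset.range (2 ^ m), t a + 1) (I (2 ^ m)) := by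
  have := block_runs t f (2 ^ m) 0 h₀ fun b _ hb => hstep b (by omega)
  simpa [forAtoms, List.range_eq_range'] using this

theorem block_run_inv {I : ℕ → Mem Var Arr → Prop} (f : ℕ → Prog) (k a : ℕ)
    {s : Mem Var Arr} (h₀ : I a s)
    (hstep : ∀ b, a ≤ b → b < a + k → ∀ s, I b s → I (b + 1) ((f b).run s)) :
    I (a + k) ((block ((List.range' a k).map f)).run s) := by
  induction k generalizing a s with
  | zero => exact h₀
  | succ k ih =>
    rw [List.range'_succ, List.map_cons, block_cons_run, show a + (k + 1) = a + 1 + k by omega]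
    exact ih (a + 1) (hstep a le_rfl (by omega) s h₀) fun b hb hb' => hstep b (by omega) (by omega)

theorem forAtoms_run_inv {m : ℕ} {f : ℕ → Prog} {s : Mem Var Arr} (I : ℕ → Mem Var Arr → Prop)
    (h₀ : I 0 s) (hstep : ∀ a < 2 ^ m, ∀ s, I a s → I (a + 1) ((f a).run s)) :
    I (2 ^ m) ((forAtoms m f).run s) := by
  have := block_run_inv f (2 ^ m) 0 h₀ fun b _ hb => hstep b (by omega)
  simpa [forAtoms, List.range_eq_range'] using this

/-! ### Independence of the programs for different atoms -/

/-- The atom that an array belongs to. -/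
def _root_.GKAT.Arr.atom : Arr → Option ℕ
  | .res _ a => some a
  | .act _ a => some a
  | .tgt _ a => some a
  | .rhead a => some a
  | .rnext a => some a
  | _ => none

/-- The program only uses shared arrays and arrays of the atom `a`, and only writes to the
latter. -/
structure Local (a : ℕ) (c : Prog) : Prop where
  uses : c.UsesIn fun r => r.atom = none ∨ r.atom = some a
  writesArr : ∀ r, c.WritesArr r → r.atom = some a
  writesReg : ∀ x, ¬ c.WritesReg x

/-- Programs for different atoms that are local do not interact. -/
theorem forAtoms_run_local {m : ℕ} {f : ℕ → Prog} (hf : ∀ a, Local a (f a)) (s : Mem Var Arr) :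
    ((forAtoms m f).run s).reg = s.reg ∧
    (∀ r, r.atom = none → ((forAtoms m f).run s).arr r = s.arr r) ∧
    ∀ r a, r.atom = some a → a < 2 ^ m →
      ((forAtoms m f).run s).arr r = ((f a).run s).arr r := by
  -- Before the turn of `k`, the arrays of smaller atoms are as their own program alone would have
  -- left them, and all other arrays are as at the start.
  let I : ℕ → Mem Var Arr → Prop := fun k s' => s'.reg = s.reg ∧
    (∀ r, r.atom = none → s'.arr r = s.arr r) ∧
    (∀ r a, r.atom = some a → a < k → s'.arr r = ((f a).run s).arr r) ∧
    ∀ r a, r.atom = some a → k ≤ a → s'.arr r = s.arr r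
  have hI : I (2 ^ m) ((forAtoms m f).run s) := by
    refine forAtoms_run_inv I ⟨rfl, fun _ _ => rfl, fun _ _ _ h => by omega, fun _ _ _ _ => rfl⟩ ?_
    rintro a - s' ⟨h₁, h₂, h₃, h₄⟩
    have hne : ∀ r, r.atom ≠ some a → ((f a).run s').arr r = s'.arr r := fun r hr =>
      Cmd.run_arr_of_not_writes (fun h => hr ((hf a).writesArr r h)) s'
    -- When the turn of `a` comes, everything that its program can read is still as in `s`.
    have hco := Cmd.run_congr (hf a).uses h₁ (fun r hr => by
      rcases hr with hr | hr
      · exact h₂ r hr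
      · exact h₄ r a hr le_rfl)
    refine ⟨?_, fun r hr => ?_, fun r b hr hb => ?_, fun r b hr hb => ?_⟩
    · funext x
      rw [Cmd.run_reg_of_not_writes ((hf a).writesReg x), h₁]
    · rw [hne r (by simp [hr]), h₂ r hr]
    · by_cases hab : b = a
      · subst hab; exact hco.2 r (Or.inr hr)
      · rw [hne r (by simpa [hr] using hab), h₃ r b hr (by omega)]
    · rw [hne r (by simp [hr]; omega), h₄ r b hr (by omega)]
  exact ⟨hI.1, hI.2.1, fun r a hr ha => hI.2.2.1 r a hr ha⟩

/-! ### Counted loops as iterates -/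

/-- One round of the loop `forUp v b c`. -/
def roundUp (v : Var) (c : Prog) (s : Mem Var Arr) : Mem Var Arr :=
  (c.run s).set v (s.reg v + 1)

/-- One round of the loop `forDown v b c`. -/
def roundDown (v : Var) (c : Prog) (s : Mem Var Arr) : Mem Var Arr :=
  c.run (s.set v (s.reg v - 1))

theorem roundUp_iterate_reg {v x : Var} {c : Prog} (hx : x ≠ v) (h : ¬ c.WritesReg x) (k : ℕ)
    (s : Mem Var Arr) : ((roundUp v c)^[k] s).reg x = s.reg x := by
  induction k generalizing s with
  | zero => rfl
  | succ k ih => simp [ih, roundUp, hx, Cmd.run_reg_of_not_writes h]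

theorem roundUp_iterate_arr {v : Var} {a : Arr} {c : Prog} (h : ¬ c.WritesArr a) (k : ℕ)
    (s : Mem Var Arr) : ((roundUp v c)^[k] s).arr a = s.arr a := by
  induction k generalizing s with
  | zero => rfl
  | succ k ih => simp [ih, roundUp, Cmd.run_arr_of_not_writes h]

theorem roundUp_iterate_counter {v : Var} {c : Prog} (k : ℕ)
    (s : Mem Var Arr) : ((roundUp v c)^[k] s).reg v = s.reg v + k := by
  induction k generalizing s with
  | zero => rfl
  | succ k ih => simp [ih, roundUp]; omega

theorem roundDown_iterate_reg {v x : Var} {c : Prog} (hx : x ≠ v) (h : ¬ c.WritesReg x) (k : ℕ)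
    (s : Mem Var Arr) : ((roundDown v c)^[k] s).reg x = s.reg x := by
  induction k generalizing s with
  | zero => rfl
  | succ k ih => simp [ih, roundDown, hx, Cmd.run_reg_of_not_writes h]

theorem roundDown_iterate_arr {v : Var} {a : Arr} {c : Prog} (h : ¬ c.WritesArr a) (k : ℕ)
    (s : Mem Var Arr) : ((roundDown v c)^[k] s).arr a = s.arr a := by
  induction k generalizing s with
  | zero => rfl
  | succ k ih => simp [ih, roundDown, Cmd.run_arr_of_not_writes h]

theorem roundDown_iterate_counter {v : Var} {c : Prog} (h : ¬ c.WritesReg v) (k : ℕ)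
    (s : Mem Var Arr) : ((roundDown v c)^[k] s).reg v = s.reg v - k := by
  induction k generalizing s with
  | zero => rfl
  | succ k ih => simp [ih, roundDown, Cmd.run_reg_of_not_writes h]; omega

/-- Since the body has no loops, the whole loop is an iterate, and what it achieves can be proved
about iterates without mentioning executions. Per round there are three steps for the test and three
for the increment; the five steps at the end of the bound are the initial assignment and the last
test. -/
theorem forUp_runs {v b : Var} {c : Prog} (hc : c.LoopFree) (hv : ¬ c.WritesReg v)
    (hb : ¬ c.WritesReg b) (hvb : b ≠ v) (s : Mem Var Arr) {Q : Mem Var Arr → Prop}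
    (hQ : Q ((roundUp v c)^[s.reg b] (s.set v 0))) :
    Runs (forUp v b c) s ((c.bound + 6) * s.reg b + 5) Q := by
  have h₁ : Runs (.set v (.lit 0)) s 2 (· = s.set v 0) :=
    ⟨_, _, .set v _ s, le_rfl, rfl⟩
  refine (h₁.seq (t₂ := (c.bound + 6) * s.reg b + 3) (Q := Q) fun s' hs' => ?_).mono (by omega)
    fun _ h => h
  subst hs'
  refine Runs.loop (fun s' u => ∃ j, j ≤ s.reg b ∧ s' = (roundUp v c)^[j] (s.set v 0) ∧
    u = (c.bound + 6) * (s.reg b - j) + 3) ⟨0, by simp⟩ ?_ ?_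
  · rintro s' u ⟨j, hj, hs', rfl⟩ hlt
    have e₁ : s'.reg v = j := by rw [hs', roundUp_iterate_counter]; simp
    have e₂ : s'.reg b = s.reg b := by rw [hs', roundUp_iterate_reg hvb hb]; simp [hvb]
    simp only [Cnd.eval, Tm.eval, e₁, e₂, decide_eq_true_eq] at hlt
    refine ⟨c.bound + 3, Runs.of_loopFree (by simp [block, Cmd.LoopFree, hc]) le_rfl ?_⟩
    refine ⟨_, ⟨j + 1, hlt, ?_, rfl⟩, ?_⟩
    · rw [Function.iterate_succ_apply', ← hs']
      simp [block, Cmd.run, roundUp, Tm.eval, Cmd.run_reg_of_not_writes hv]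
    · obtain ⟨d, hd⟩ : ∃ d, s.reg b - j = d + 1 := ⟨s.reg b - j - 1, by omega⟩
      rw [show s.reg b - (j + 1) = d by omega, hd]
      simp only [Cnd.cost, Tm.cost]; ring_nf; omega
  · rintro s' u ⟨j, hj, hs', rfl⟩ hlt
    have e₁ : s'.reg v = j := by rw [hs', roundUp_iterate_counter]; simp
    have e₂ : s'.reg b = s.reg b := by rw [hs', roundUp_iterate_reg hvb hb]; simp [hvb]
    simp only [Cnd.eval, Tm.eval, e₁, e₂, decide_eq_false_iff_not] at hlt
    obtain rfl : j = s.reg b := by omega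
    exact ⟨by simp [Cnd.cost, Tm.cost], hs' ▸ hQ⟩

theorem forDown_runs {v b : Var} {c : Prog} (hc : c.LoopFree) (hv : ¬ c.WritesReg v)
    (s : Mem Var Arr) {Q : Mem Var Arr → Prop}
    (hQ : Q ((roundDown v c)^[s.reg b] (s.set v (s.reg b)))) :
    Runs (forDown v b c) s ((c.bound + 6) * s.reg b + 5) Q := by
  have h₁ : Runs (.set v (.reg b)) s 2 (· = s.set v (s.reg b)) :=
    ⟨_, _, .set v _ s, le_rfl, rfl⟩
  refine (h₁.seq (t₂ := (c.bound + 6) * s.reg b + 3) (Q := Q) fun s' hs' => ?_).mono (by omega)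
    fun _ h => h
  subst hs'
  refine Runs.loop (fun s' u => ∃ j, j ≤ s.reg b ∧
    s' = (roundDown v c)^[j] (s.set v (s.reg b)) ∧
    u = (c.bound + 6) * (s.reg b - j) + 3) ⟨0, by simp⟩ ?_ ?_
  · rintro s' u ⟨j, hj, hs', rfl⟩ hlt
    have e₁ : s'.reg v = s.reg b - j := by rw [hs', roundDown_iterate_counter hv]; simp
    simp only [Cnd.eval, Tm.eval, e₁, decide_eq_true_eq] at hlt
    refine ⟨c.bound + 3, Runs.of_loopFree (by simp [block, Cmd.LoopFree, hc]) ?_ ?_⟩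
    · simp [block, Cmd.bound, Tm.cost]; omega
    refine ⟨_, ⟨j + 1, by omega, ?_, rfl⟩, ?_⟩
    · rw [Function.iterate_succ_apply', ← hs']
      simp [block, Cmd.run, roundDown, Tm.eval]
    · obtain ⟨d, hd⟩ : ∃ d, s.reg b - j = d + 1 := ⟨s.reg b - j - 1, by omega⟩
      rw [show s.reg b - (j + 1) = d by omega, hd]
      simp only [Cnd.cost, Tm.cost]; ring_nf; omega
  · rintro s' u ⟨j, hj, hs', rfl⟩ hlt
    have e₁ : s'.reg v = s.reg b - j := by rw [hs', roundDown_iterate_counter hv]; simp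
    simp only [Cnd.eval, Tm.eval, e₁, decide_eq_false_iff_not] at hlt
    obtain rfl : j = s.reg b := by omega
    exact ⟨by simp [Cnd.cost, Tm.cost], hs' ▸ hQ⟩

end Prog

end GKAT

namespace GKAT

/-! ## Automata and their languages -/

section Language

variable {T P : Type*}

/-- The value of a transition map for one state and one atom. States are natural numbers. -/
inductive Entry (P : Type*) where
  | rej : Entry P
  | acc : Entry P
  | step : P → ℕ → Entry P

/-- The values of a transition map for one state. -/
abbrev Row (T P : Type*) := Atom T → Entry P

/-- The guarded string `⟨α, w⟩` is accepted from the pseudostate `r`, where `D` is the transition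
map. -/
def Accepts (D : ℕ → Row T P) : Row T P → Atom T → List (P × Atom T) → Prop
  | r, α, [] => r α = .acc
  | r, α, (p, β) :: w => ∃ x, r α = .step p x ∧ Accepts D (D x) β w

/-- Two pseudostates accept the same guarded strings. -/
def LangEq (D : ℕ → Row T P) (r r' : Row T P) : Prop := ∀ α w, Accepts D r α w ↔ Accepts D r' α w

/-- Replaces acceptance by the continuation. -/
def Entry.andThen : Entry P → Entry P → Entry P
  | .rej, _ => .rej
  | .acc, v => v
  | .step p x, _ => .step p x

/-- Replaces acceptance in the row `r` by the continuation `k`. -/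
def Row.andThen (r k : Row T P) : Row T P := fun α => (r α).andThen (k α)

theorem Row.andThen_assoc (r r' k : Row T P) :
    Row.andThen (Row.andThen r r') k = Row.andThen r (Row.andThen r' k) := by
  funext α
  simp only [Row.andThen]
  cases r α <;> rfl

theorem Row.andThen_acc (r : Row T P) : Row.andThen r (fun _ => .acc) = r := by
  funext α
  simp only [Row.andThen]
  cases r α <;> rfl

/-- Only the value at the first atom counts: after one action the run continues in `D`, not in the
pseudostate. -/
theorem Accepts.congr {D : ℕ → Row T P} {r r' : Row T P} {α : Atom T} (h : r α = r' α)
    (w : List (P × Atom T)) : Accepts D r α w ↔ Accepts D r' α w := by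
  rcases w with _ | ⟨⟨p, β⟩, w⟩ <;> simp [Accepts, h]

theorem not_accepts_of_rej {D : ℕ → Row T P} {r : Row T P} {α : Atom T} (h : r α = .rej)
    (w : List (P × Atom T)) : ¬ Accepts D r α w := by
  rcases w with _ | ⟨⟨p, β⟩, w⟩ <;> simp [Accepts, h]

theorem accepts_acc {D : ℕ → Row T P} {α : Atom T} {w : List (P × Atom T)} :
    Accepts D (fun _ => .acc) α w ↔ w = [] := by
  rcases w with _ | ⟨⟨p, β⟩, w⟩ <;> simp [Accepts]

/-! ### Guarded strings -/

theorem last_nil (α : Atom T) : (⟨α, []⟩ : GStr T P).last = α := rfl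

theorem last_cons (α β : Atom T) (p : P) (u : List (P × Atom T)) :
    (⟨α, (p, β) :: u⟩ : GStr T P).last = (⟨β, u⟩ : GStr T P).last := by
  cases u <;> simp [GStr.last, List.getLast?_cons]

theorem last_append (α : Atom T) (u v : List (P × Atom T)) :
    (⟨α, u ++ v⟩ : GStr T P).last = (⟨(⟨α, u⟩ : GStr T P).last, v⟩ : GStr T P).last := by
  induction u generalizing α with
  | nil => rfl
  | cons x u ih => obtain ⟨p, β⟩ := x; simp only [List.cons_append, last_cons, ih]

/-- As a guarded string is a head with a tail, fusion is concatenation of tails, and the head of the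
second factor is forced to be the last atom of the first. All later arguments use this form. -/
theorem mem_fuse {L K : Set (GStr T P)} {α : Atom T} {w : List (P × Atom T)} :
    (⟨α, w⟩ : GStr T P) ∈ fuse L K ↔
      ∃ u v, w = u ++ v ∧ (⟨α, u⟩ : GStr T P) ∈ L ∧ (⟨(⟨α, u⟩ : GStr T P).last, v⟩ : GStr T P) ∈ K := by
  constructor
  · rintro ⟨⟨β, u⟩, hx, ⟨γ, v⟩, hy, hl, hz⟩
    simp only [GStr.mk.injEq] at hz
    obtain ⟨rfl, rfl⟩ := hz
    dsimp only at hl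
    subst hl
    exact ⟨u, v, rfl, hx, hy⟩
  · rintro ⟨u, v, rfl, hu, hv⟩
    exact ⟨_, hu, _, hv, rfl, rfl⟩

theorem mem_atoms {B : Set (Atom T)} {α : Atom T} {w : List (P × Atom T)} :
    (⟨α, w⟩ : GStr T P) ∈ atoms B ↔ α ∈ B ∧ w = [] := by
  constructor
  · rintro ⟨β, hβ, h⟩
    simp only [GStr.mk.injEq] at h
    exact ⟨h.1 ▸ hβ, h.2⟩
  · rintro ⟨h, rfl⟩; exact ⟨α, h, rfl⟩

theorem mem_fuse_atoms {B : Set (Atom T)} {L : Set (GStr T P)} {α : Atom T}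
    {w : List (P × Atom T)} :
    (⟨α, w⟩ : GStr T P) ∈ fuse (atoms B) L ↔ α ∈ B ∧ (⟨α, w⟩ : GStr T P) ∈ L := by
  rw [mem_fuse]
  constructor
  · rintro ⟨u, v, rfl, hu, hv⟩
    obtain ⟨hB, rfl⟩ := mem_atoms.1 hu
    exact ⟨hB, hv⟩
  · rintro ⟨hB, hw⟩
    exact ⟨[], w, rfl, mem_atoms.2 ⟨hB, rfl⟩, hw⟩

theorem fuse_assoc (L K M : Set (GStr T P)) : fuse (fuse L K) M = fuse L (fuse K M) := by
  ext ⟨α, w⟩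
  simp only [mem_fuse]
  constructor
  · rintro ⟨_, v, rfl, ⟨u, u', rfl, h₁, h₂⟩, h₃⟩
    exact ⟨u, u' ++ v, by simp, h₁, u', v, rfl, h₂, by rwa [last_append] at h₃⟩
  · rintro ⟨u, _, rfl, h₁, u', v, rfl, h₂, h₃⟩
    exact ⟨u ++ u', v, by simp, ⟨u, u', rfl, h₁, h₂⟩, by rwa [last_append]⟩

theorem fuse_univ_atoms_left (L : Set (GStr T P)) : fuse (atoms Set.univ) L = L := by
  ext ⟨α, w⟩
  simp [mem_fuse_atoms]

theorem fuse_univ_atoms_right (L : Set (GStr T P)) : fuse L (atoms Set.univ) = L := by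
  ext ⟨α, w⟩
  rw [mem_fuse]
  constructor
  · rintro ⟨u, v, rfl, hu, hv⟩
    obtain ⟨-, rfl⟩ := mem_atoms.1 hv
    simpa using hu
  · intro h
    exact ⟨w, [], by simp, h, mem_atoms.2 ⟨trivial, rfl⟩⟩

/-- Powers are defined by multiplication on the right; loops are unrolled from the front. -/
theorem power_succ' (L : Set (GStr T P)) (k : ℕ) : power L (k + 1) = fuse L (power L k) := by
  induction k with
  | zero => simp [power, fuse_univ_atoms_left, fuse_univ_atoms_right]
  | succ k ih =>
    conv_lhs => rw [power, ih, fuse_assoc]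
    rfl

/-- The fixed point equation of the loop: leave at once, or make one turn and start again. -/
theorem mem_den_loop {b : BExp T} {e : Exp T P} {α : Atom T} {w : List (P × Atom T)} :
    (⟨α, w⟩ : GStr T P) ∈ (Exp.loop b e).den ↔
      (b.eval α = false ∧ w = []) ∨ (b.eval α = true ∧ ∃ u v, w = u ++ v ∧
        (⟨α, u⟩ : GStr T P) ∈ e.den ∧
        (⟨(⟨α, u⟩ : GStr T P).last, v⟩ : GStr T P) ∈ (Exp.loop b e).den) := by
  simp only [Exp.den, Set.mem_iUnion]
  constructor
  · rintro ⟨k, hk⟩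
    cases k with
    | zero =>
      rw [power, mem_fuse_atoms, mem_atoms] at hk
      exact Or.inl ⟨by simpa [BExp.den] using hk.2.1, hk.2.2⟩
    | succ k =>
      rw [power_succ', fuse_assoc, fuse_assoc, mem_fuse_atoms, mem_fuse] at hk
      obtain ⟨hb, u, v, rfl, hu, hv⟩ := hk
      exact Or.inr ⟨hb, u, v, rfl, hu, k, hv⟩
  · rintro (⟨hb, rfl⟩ | ⟨hb, u, v, rfl, hu, k, hk⟩)
    · exact ⟨0, by rw [power, mem_fuse_atoms, mem_atoms]; exact ⟨trivial, by simp [BExp.den, hb], rfl⟩⟩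
    · refine ⟨k + 1, ?_⟩
      rw [power_succ', fuse_assoc, fuse_assoc, mem_fuse_atoms, mem_fuse]
      exact ⟨hb, u, v, rfl, hu, hk⟩

theorem mem_den_ite {b : BExp T} {e f : Exp T P} {α : Atom T} {w : List (P × Atom T)} :
    (⟨α, w⟩ : GStr T P) ∈ (Exp.ite b e f).den ↔
      if b.eval α then (⟨α, w⟩ : GStr T P) ∈ e.den else (⟨α, w⟩ : GStr T P) ∈ f.den := by
  simp only [Exp.den, Set.mem_union, mem_fuse_atoms]
  by_cases h : b.eval α = true <;> simp [BExp.den, h]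

theorem mem_den_act {p : P} {α : Atom T} {w : List (P × Atom T)} :
    (⟨α, w⟩ : GStr T P) ∈ (Exp.act p).den ↔ ∃ β, w = [(p, β)] := by
  simp [Exp.den]

theorem mem_den_assert {b : BExp T} {α : Atom T} {w : List (P × Atom T)} :
    (⟨α, w⟩ : GStr T P) ∈ (Exp.assert b).den ↔ b.eval α = true ∧ w = [] := by
  simp [Exp.den, mem_atoms, BExp.den]

theorem mem_den_seq {e f : Exp T P} {α : Atom T} {w : List (P × Atom T)} :
    (⟨α, w⟩ : GStr T P) ∈ (Exp.seq e f).den ↔ ∃ u v, w = u ++ v ∧ (⟨α, u⟩ : GStr T P) ∈ e.den ∧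
      (⟨(⟨α, u⟩ : GStr T P).last, v⟩ : GStr T P) ∈ f.den := mem_fuse

/-! ### The Thompson construction

The occurrences of actions in an expression are numbered from left to right, starting from a given
number `q`. -/

/-- The number of occurrences of actions. -/
def Exp.acts : Exp T P → ℕ
  | .act _ => 1
  | .assert _ => 0
  | .seq e f => e.acts + f.acts
  | .ite _ e f => e.acts + f.acts
  | .loop _ e => e.acts

/-- The row of truth values of a Boolean expression. -/
def BExp.row (b : BExp T) : Row T P := fun α => bif b.eval α then .acc else .rej

/-- The body of a loop must not accept immediately. -/
def Entry.loopBody : Entry P → Entry P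
  | .rej => .rej
  | .acc => .rej
  | .step p x => .step p x

/-- The initial pseudostate of an expression. -/
def Exp.ini : Exp T P → ℕ → Row T P
  | .act p, q => fun _ => .step p q
  | .assert b, _ => b.row
  | .seq e f, q => Row.andThen (e.ini q) (f.ini (q + e.acts))
  | .ite b e f, q => fun α => if b.eval α then e.ini q α else f.ini (q + e.acts) α
  | .loop b e, q => fun α => if b.eval α then (e.ini q α).loopBody else .acc

/-- The transition map of an expression whose acceptance is replaced by the continuation `k`. -/
def Exp.delta : Exp T P → ℕ → Row T P → ℕ → Row T P
  | .act _, _, k, _ => k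
  -- An assertion has no states, so this is a default value; no statement below uses it.
  | .assert _, _, k, _ => k
  | .seq e f, q, k, x =>
    if x < q + e.acts then e.delta q (Row.andThen (f.ini (q + e.acts)) k) x
    else f.delta (q + e.acts) k x
  | .ite _ e f, q, k, x =>
    if x < q + e.acts then e.delta q k x else f.delta (q + e.acts) k x
  | .loop b e, q, k, x => e.delta q (Row.andThen ((Exp.loop b e).ini q) k) x

/-- The interesting case is a loop whose body accepts immediately. A turn without an action leaves
the atom unchanged, so the test stays true and the loop is never left; this justifies that
`Entry.loopBody` turns acceptance into rejection. -/
theorem Exp.ini_eq_acc {e : Exp T P} {q : ℕ} {α : Atom T} :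
    e.ini q α = .acc ↔ (⟨α, []⟩ : GStr T P) ∈ e.den := by
  induction e generalizing q with
  | act p => simp [Exp.ini, mem_den_act]
  | assert b => cases hb : b.eval α <;> simp [Exp.ini, mem_den_assert, BExp.row, hb]
  | seq e f ihe ihf =>
    simp only [Exp.ini, Row.andThen, mem_den_seq, List.nil_eq_append_iff]
    have h : (∃ u v : List (P × Atom T), (u = [] ∧ v = []) ∧ (⟨α, u⟩ : GStr T P) ∈ e.den ∧
        (⟨(⟨α, u⟩ : GStr T P).last, v⟩ : GStr T P) ∈ f.den) ↔
        e.ini q α = .acc ∧ f.ini (q + e.acts) α = .acc := by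
      rw [ihe, ihf]
      constructor
      · rintro ⟨u, v, ⟨rfl, rfl⟩, h⟩; exact h
      · intro h; exact ⟨[], [], ⟨rfl, rfl⟩, h⟩
    rw [h]
    cases e.ini q α <;> simp [Entry.andThen]
  | ite b e f ihe ihf =>
    rw [mem_den_ite]
    simp only [Exp.ini]
    by_cases h : b.eval α = true <;> simp [h, ihe, ihf]
  | loop b e ih =>
    rw [mem_den_loop]
    simp only [Exp.ini]
    by_cases h : b.eval α = true
    · simp only [h, if_true]
      constructor
      · intro h'; cases he : e.ini q α <;> simp [he, Entry.loopBody] at h'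
      · rintro (⟨h', -⟩ | ⟨-, u, v, huv, hu, hv⟩)
        · simp at h'
        · exfalso
          -- a derivation of the empty tail would be infinite
          have : ∀ k, (⟨α, []⟩ : GStr T P) ∉
              fuse (power (fuse (atoms b.den) e.den) k) (atoms b.denᶜ) := by
            intro k
            induction k with
            | zero =>
              rw [power, mem_fuse_atoms, mem_atoms]
              rintro ⟨-, h', -⟩
              exact h' h
            | succ k ihk =>
              rw [power_succ', fuse_assoc, mem_fuse]
              rintro ⟨u, v, huv, -, hv⟩
              obtain ⟨rfl, rfl⟩ := List.nil_eq_append_iff.1 huv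
              exact ihk hv
          obtain ⟨rfl, rfl⟩ := List.nil_eq_append_iff.1 huv
          simp only [Exp.den, Set.mem_iUnion, last_nil] at hv
          obtain ⟨k, hk⟩ := hv
          exact this k hk
    · simp [h]

/-- The language accepted with a continuation is the product of the language of the expression and
the language of the continuation. -/
theorem Exp.accepts_andThen {e : Exp T P} {q : ℕ} {k : Row T P} {D : ℕ → Row T P}
    (hD : ∀ x, q ≤ x → x < q + e.acts → D x = e.delta q k x) {α : Atom T}
    {w : List (P × Atom T)} :
    Accepts D (Row.andThen (e.ini q) k) α w ↔ ∃ u v, w = u ++ v ∧ (⟨α, u⟩ : GStr T P) ∈ e.den ∧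
      Accepts D k (⟨α, u⟩ : GStr T P).last v := by
  induction e generalizing q k α w with
  | act p =>
    have hq : D q = k := hD q le_rfl (by simp [Exp.acts])
    rcases w with _ | ⟨⟨p', β⟩, w⟩
    · simp only [Accepts, Exp.ini, Row.andThen, Entry.andThen, mem_den_act]
      constructor
      · intro h; cases h
      · rintro ⟨_, v, h, ⟨β, rfl⟩, -⟩; simp at h
    · simp only [Accepts, Exp.ini, Row.andThen, Entry.andThen, mem_den_act, Entry.step.injEq]
      constructor
      · rintro ⟨x, ⟨rfl, rfl⟩, h⟩
        exact ⟨[(p, β)], w, rfl, ⟨β, rfl⟩, by rw [last_cons, last_nil, ← hq]; exact h⟩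
      · rintro ⟨_, v, h, ⟨β', rfl⟩, hv⟩
        simp only [List.cons_append, List.nil_append, List.cons.injEq, Prod.mk.injEq] at h
        obtain ⟨⟨rfl, rfl⟩, rfl⟩ := h
        rw [last_cons, last_nil, ← hq] at hv
        exact ⟨q, ⟨rfl, rfl⟩, hv⟩
  | assert b =>
    constructor
    · intro h
      by_cases hb : b.eval α = true
      · refine ⟨[], w, rfl, mem_den_assert.2 ⟨hb, rfl⟩, ?_⟩
        exact (Accepts.congr (by simp [Row.andThen, Exp.ini, BExp.row, hb, Entry.andThen, last_nil]) w).1 h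
      · exact absurd h (not_accepts_of_rej
          (by simp [Row.andThen, Exp.ini, BExp.row, hb, Entry.andThen]) w)
    · rintro ⟨u, v, rfl, hu, hv⟩
      obtain ⟨hb, rfl⟩ := mem_den_assert.1 hu
      refine (Accepts.congr (by simp [Row.andThen, Exp.ini, BExp.row, hb, Entry.andThen]) v).2 hv
  | seq e f ihe ihf =>
    have he := @ihe q (Row.andThen (f.ini (q + e.acts)) k) (fun x h₁ h₂ => by
      rw [hD x h₁ (by simp only [Exp.acts]; omega), Exp.delta, if_pos h₂])
    have hf := @ihf (q + e.acts) k (fun x h₁ h₂ => by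
      rw [hD x (by omega) (by simp only [Exp.acts]; omega), Exp.delta, if_neg (by omega)])
    rw [Exp.ini, Row.andThen_assoc, he]
    constructor
    · rintro ⟨u, v, rfl, hu, hv⟩
      obtain ⟨u', v', rfl, hu', hv'⟩ := hf.1 hv
      exact ⟨u ++ u', v', by simp, mem_den_seq.2 ⟨u, u', rfl, hu, hu'⟩, by rwa [last_append]⟩
    · rintro ⟨_, v', rfl, hu, hv⟩
      obtain ⟨u, u', rfl, h₁, h₂⟩ := mem_den_seq.1 hu
      exact ⟨u, u' ++ v', by simp, h₁, hf.2 ⟨u', v', rfl, h₂, by rwa [last_append] at hv⟩⟩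
  | ite b e f ihe ihf =>
    have he := @ihe q k (fun x h₁ h₂ => by
      rw [hD x h₁ (by simp only [Exp.acts]; omega), Exp.delta, if_pos h₂])
    have hf := @ihf (q + e.acts) k (fun x h₁ h₂ => by
      rw [hD x (by omega) (by simp only [Exp.acts]; omega), Exp.delta, if_neg (by omega)])
    simp only [mem_den_ite]
    by_cases hb : b.eval α = true
    · rw [Accepts.congr (r' := Row.andThen (e.ini q) k) (by simp [Row.andThen, Exp.ini, hb]), he]
      simp [hb]
    · rw [Accepts.congr (r' := Row.andThen (f.ini (q + e.acts)) k)
        (by simp [Row.andThen, Exp.ini, hb]), hf]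
      simp [hb]
  | loop b e ih =>
    -- `K` is what happens after the body has accepted: the loop is entered again, or left with `k`.
    -- It is the continuation with which the states of the body are built.
    set K := Row.andThen ((Exp.loop b e).ini q) k with hK
    have he := @ih q K (fun x h₁ h₂ => hD x h₁ h₂)
    have hf : ∀ α w, b.eval α = false → (Accepts D K α w ↔ Accepts D k α w) := fun α w hb =>
      Accepts.congr (by simp [hK, Row.andThen, Exp.ini, hb, Entry.andThen]) w
    -- Where the test holds, `K` satisfies its fixed point equation. If the body accepts at once,
    -- the right side is `K` at the same atom, and this is rejection because of `loopBody`.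
    have ht : ∀ α w, b.eval α = true →
        (Accepts D K α w ↔ Accepts D (Row.andThen (e.ini q) K) α w) := fun α w hb => by
      apply Accepts.congr
      simp only [Row.andThen, hK, Exp.ini, hb, if_true]
      cases e.ini q α <;> rfl
    constructor
    · intro h
      -- One turn is split off at a time. The word gets shorter, because a turn without an action
      -- would end in rejection.
      induction hn : w.length using Nat.strong_induction_on generalizing α w with
      | _ n ihn =>
        cases hb : b.eval α with
        | false => exact ⟨[], w, rfl, mem_den_loop.2 (Or.inl ⟨hb, rfl⟩), (hf α w hb).1 h⟩
        | true =>
          obtain ⟨u, v, rfl, hu, hv⟩ := he.1 ((ht α w hb).1 h)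
          rcases u with _ | ⟨x, u⟩
          -- The turn has performed no action, so the body accepts at `α` and `K` rejects there.
          · refine absurd hv (not_accepts_of_rej ?_ _)
            have := (Exp.ini_eq_acc (q := q)).2 hu
            simp [hK, Row.andThen, Exp.ini, hb, last_nil, this, Entry.loopBody, Entry.andThen]
          · obtain ⟨u', v', rfl, hu', hv'⟩ := ihn v.length (by simp at hn; omega) hv rfl
            exact ⟨x :: u ++ u', v', by simp,
              mem_den_loop.2 (Or.inr ⟨hb, x :: u, u', rfl, hu, hu'⟩), by rwa [last_append]⟩
    · rintro ⟨u, v, rfl, hu, hv⟩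
      simp only [Exp.den, Set.mem_iUnion] at hu
      obtain ⟨n, hn⟩ := hu
      induction n generalizing α u with
      | zero =>
        rw [power, mem_fuse_atoms, mem_atoms] at hn
        obtain ⟨-, hb, rfl⟩ := hn
        exact (hf _ _ (by simpa [BExp.den] using hb)).2 hv
      | succ n ihn =>
        rw [power_succ', fuse_assoc, fuse_assoc, mem_fuse_atoms, mem_fuse] at hn
        obtain ⟨hb, u, u', rfl, hu, hu'⟩ := hn
        refine (ht _ _ hb).2 (he.2 ⟨u, u' ++ v, by simp, hu, ?_⟩)
        exact ihn u' (by rwa [last_append] at hv) hu'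

/-- The Thompson automaton of `e` accepts the language of `e`. -/
theorem Exp.accepts_ini {e : Exp T P} {q : ℕ} {D : ℕ → Row T P}
    (hD : ∀ x, q ≤ x → x < q + e.acts → D x = e.delta q (fun _ => .acc) x) {α : Atom T}
    {w : List (P × Atom T)} : Accepts D (e.ini q) α w ↔ (⟨α, w⟩ : GStr T P) ∈ e.den := by
  have := Exp.accepts_andThen hD (α := α) (w := w)
  rw [Row.andThen_acc] at this
  rw [this]
  simp [accepts_acc]

/-- The bound on the target keeps the automaton inside its set of states. The membership of the
action is recorded because the coding of actions is injective only on those that occur. -/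
theorem Exp.ini_eq_step {e : Exp T P} {q : ℕ} {α : Atom T} {p : P} {x : ℕ}
    (h : e.ini q α = .step p x) : p ∈ e.actions ∧ x < q + e.acts := by
  induction e generalizing q with
  | act p' => simp only [Exp.ini, Entry.step.injEq] at h; simp [Exp.actions, Exp.acts, h]
  | assert b => simp only [Exp.ini, BExp.row] at h; cases hb : b.eval α <;> simp [hb] at h
  | seq e f ihe ihf =>
    simp only [Exp.ini, Row.andThen] at h
    cases he : e.ini q α with
    | rej => simp [he, Entry.andThen] at h
    | acc =>
      rw [he] at h
      have := ihf h
      exact ⟨Or.inr this.1, by simp only [Exp.acts]; omega⟩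
    | step p' x' =>
      rw [he] at h
      have := ihe (he.trans h)
      exact ⟨Or.inl this.1, by simp only [Exp.acts]; omega⟩
  | ite b e f ihe ihf =>
    simp only [Exp.ini] at h
    split_ifs at h
    · have := ihe h
      exact ⟨Or.inl this.1, by simp only [Exp.acts]; omega⟩
    · have := ihf h
      exact ⟨Or.inr this.1, by simp only [Exp.acts]; omega⟩
  | loop b e ih =>
    simp only [Exp.ini] at h
    split_ifs at h
    cases he : e.ini q α with
    | rej => simp [he, Entry.loopBody] at h
    | acc => simp [he, Entry.loopBody] at h
    | step p' x' => rw [he] at h; exact ih (he.trans h)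

theorem Exp.delta_eq_step {e : Exp T P} {q : ℕ} {k : Row T P} {x : ℕ} {α : Atom T} {p : P} {y : ℕ}
    (h : e.delta q k x α = .step p y) :
    (p ∈ e.actions ∧ y < q + e.acts) ∨ k α = .step p y := by
  induction e generalizing q k with
  | act p' => exact Or.inr h
  | assert b => exact Or.inr h
  | seq e f ihe ihf =>
    simp only [Exp.delta] at h
    split_ifs at h
    · rcases ihe h with h | h
      · exact Or.inl ⟨Or.inl h.1, by simp only [Exp.acts]; omega⟩
      · simp only [Row.andThen] at h
        cases hf : f.ini (q + e.acts) α with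
        | rej => simp [hf, Entry.andThen] at h
        | acc => rw [hf] at h; exact Or.inr h
        | step p' x' =>
          rw [hf] at h
          have := Exp.ini_eq_step (hf.trans h)
          exact Or.inl ⟨Or.inr this.1, by simp only [Exp.acts]; omega⟩
    · rcases ihf h with h | h
      · exact Or.inl ⟨Or.inr h.1, by simp only [Exp.acts]; omega⟩
      · exact Or.inr h
  | ite b e f ihe ihf =>
    simp only [Exp.delta] at h
    split_ifs at h
    · rcases ihe h with h | h
      · exact Or.inl ⟨Or.inl h.1, by simp only [Exp.acts]; omega⟩
      · exact Or.inr h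
    · rcases ihf h with h | h
      · exact Or.inl ⟨Or.inr h.1, by simp only [Exp.acts]; omega⟩
      · exact Or.inr h
  | loop b e ih =>
    rcases ih h with h | h
    · exact Or.inl h
    · simp only [Row.andThen] at h
      cases hf : (Exp.loop b e).ini q α with
      | rej => simp [hf, Entry.andThen] at h
      | acc => rw [hf] at h; exact Or.inr h
      | step p' x' =>
        rw [hf] at h
        exact Or.inl (Exp.ini_eq_step (hf.trans h))

/-! ### Normalization -/

/-- Some guarded string is accepted from the state `x`. -/
def Live (D : ℕ → Row T P) (x : ℕ) : Prop := ∃ α w, Accepts D (D x) α w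

open Classical in
/-- Replaces transitions to dead states by rejection. -/
noncomputable def Entry.prune (D : ℕ → Row T P) : Entry P → Entry P
  | .rej => .rej
  | .acc => .acc
  | .step p x => if Live D x then .step p x else .rej

/-- The normalized transition map. -/
noncomputable def prune (D : ℕ → Row T P) (x : ℕ) : Row T P := fun α => (D x α).prune D

/-- An accepting run passes only through live states, so it never uses a transition that is removed.
-/
theorem accepts_prune {D : ℕ → Row T P} {r : Row T P} {α : Atom T} {w : List (P × Atom T)} :
    Accepts (prune D) (fun α => (r α).prune D) α w ↔ Accepts D r α w := by
  induction w generalizing r α with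
  | nil =>
    simp only [Accepts]
    cases r α <;> simp only [Entry.prune]
    split_ifs <;> simp
  | cons x w ih =>
    obtain ⟨p, β⟩ := x
    simp only [Accepts]
    constructor
    · rintro ⟨x, hx, h⟩
      cases hr : r α with
      | rej => simp [hr, Entry.prune] at hx
      | acc => simp [hr, Entry.prune] at hx
      | step p' x' =>
        simp only [hr, Entry.prune] at hx
        split_ifs at hx
        exact ⟨x, hx, ih.1 h⟩
    · rintro ⟨x, hx, h⟩
      refine ⟨x, ?_, ih.2 h⟩
      rw [hx, Entry.prune, if_pos ⟨β, w, h⟩]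

/-- Removing transitions could make further states dead, but by `accepts_prune` a state that was
live stays live. One pass therefore suffices. -/
theorem live_of_prune_eq_step {D : ℕ → Row T P} {x y : ℕ} {α : Atom T} {p : P}
    (h : prune D x α = .step p y) : D x α = .step p y ∧ Live (prune D) y := by
  simp only [prune] at h
  cases hr : D x α with
  | rej => simp [hr, Entry.prune] at h
  | acc => simp [hr, Entry.prune] at h
  | step p' x' =>
    simp only [hr, Entry.prune] at h
    split_ifs at h with hl
    obtain ⟨β, w, hw⟩ := hl
    cases h
    exact ⟨rfl, β, w, accepts_prune.2 hw⟩

/-! ### Bisimulation -/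

/-- The entries agree, up to the relation `E` on states. -/
def Entry.Match (E : ℕ → ℕ → Prop) : Entry P → Entry P → Prop
  | .rej, .rej => True
  | .acc, .acc => True
  | .step p x, .step p' x' => p = p' ∧ E x x'
  | _, _ => False

theorem Entry.Match.refl {E : ℕ → ℕ → Prop} (h : ∀ x, E x x) (u : Entry P) : u.Match E u := by
  cases u <;> simp [Entry.Match, h]

theorem Entry.Match.symm {E : ℕ → ℕ → Prop} (h : ∀ x y, E x y → E y x) {u v : Entry P}
    (hm : u.Match E v) : v.Match E u := by
  cases u <;> cases v <;> simp only [Entry.Match] at *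
  exact ⟨hm.1.symm, h _ _ hm.2⟩

theorem Entry.Match.trans {E : ℕ → ℕ → Prop} (h : ∀ x y z, E x y → E y z → E x z)
    {u v w : Entry P} (h₁ : u.Match E v) (h₂ : v.Match E w) : u.Match E w := by
  cases u <;> cases v <;> cases w <;> simp only [Entry.Match] at *
  exact ⟨h₁.1.trans h₂.1, h _ _ _ h₁.2 h₂.2⟩

/-- Induction on the word. The relation need not be an equivalence, and it is only consulted on
states below `N`, which transitions do not leave. -/
theorem langEq_of_bisimulation {D : ℕ → Row T P} {N : ℕ}
    (hD : ∀ x < N, ∀ α p y, D x α = .step p y → y < N) {E : ℕ → ℕ → Prop}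
    (hE : ∀ x < N, ∀ y < N, E x y → ∀ α, (D x α).Match E (D y α)) {x y : ℕ} (hx : x < N)
    (hy : y < N) (hxy : E x y) : LangEq D (D x) (D y) := by
  intro α w
  induction w generalizing x y α with
  | nil =>
    have := hE x hx y hy hxy α
    simp only [Accepts]
    cases h₁ : D x α <;> cases h₂ : D y α <;> simp_all [Entry.Match]
  | cons z w ih =>
    obtain ⟨p, β⟩ := z
    have := hE x hx y hy hxy α
    simp only [Accepts]
    cases h₁ : D x α <;> cases h₂ : D y α <;> simp only [h₁, h₂, Entry.Match] at this <;> try simp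
    rename_i p x' p' y'
    obtain ⟨rfl, hE'⟩ := this
    rw [ih (hD x hx _ _ _ h₁) (hD y hy _ _ _ h₂) hE']

/-- This is what normalization is for. A transition to a live state is the beginning of some
accepted string, so the other row must perform the same action at this atom; determinism then makes
the languages of the targets the residuals of one language. Without liveness, a transition to a dead
state and rejection could not be told apart by languages. -/
theorem match_of_langEq {D : ℕ → Row T P} {r r' : Row T P}
    (hr : ∀ α p y, r α = .step p y → Live D y) (hr' : ∀ α p y, r' α = .step p y → Live D y)
    (h : LangEq D r r') (α : Atom T) :
    (r α).Match (fun x y => LangEq D (D x) (D y)) (r' α) := by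
  have h₀ := h α []
  have h₁ : ∀ p β w, _ := fun p β w => h α ((p, β) :: w)
  simp only [Accepts] at h₀ h₁
  cases hu : r α with
  | rej =>
    cases hv : r' α with
    | rej => trivial
    | acc => simp [hu, hv] at h₀
    | step p y =>
      obtain ⟨β, w, hw⟩ := hr' α p y hv
      have := (h₁ p β w).2 ⟨y, hv, hw⟩
      simp [hu] at this
  | acc =>
    rw [hu] at h₀
    rw [h₀.1 rfl]
    trivial
  | step p x =>
    obtain ⟨β, w, hw⟩ := hr α p x hu
    obtain ⟨y, hy, -⟩ := (h₁ p β w).1 ⟨x, hu, hw⟩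
    rw [hy]
    refine ⟨rfl, fun β w => ?_⟩
    have := h₁ p β w
    simpa [hu, hy] using this

end Language

end GKAT

namespace GKAT

/-! ## Union-find: amortized analysis

The potential of a node `x` with rank `j`, whose parent has rank `R`, is the number of pairs
`(k, i)` with `k < K` and `i ≤ j` for which the `(i + 1)`-st iterate of `ack k` at `j` exceeds
`R`. -/

section UnionFind

/-- The potential of a node with rank `j` whose parent has rank `R`. -/
def phi (K j R : ℕ) : ℕ :=
  ((Finset.range K ×ˢ Finset.range (j + 1)).filter fun ki => R < (ack ki.1)^[ki.2 + 1] j).card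

theorem phi_le (K j R : ℕ) : phi K j R ≤ K * (j + 1) := by
  refine (Finset.card_filter_le _ _).trans ?_
  simp

theorem phi_anti {K j R R' : ℕ} (h : R ≤ R') : phi K j R' ≤ phi K j R :=
  Finset.card_le_card (Finset.monotone_filter_right _ fun _ _ h' => lt_of_le_of_lt h h')

/-- The recursion that defines `ack (k + 1)`, unrolled in its second argument. -/
theorem ack_iterate_one (k j : ℕ) : (ack k)^[j + 1] 1 = ack (k + 1) j := by
  induction j with
  | zero => simp
  | succ j ih => rw [Function.iterate_succ_apply', ih, ack_succ_succ]

/-- Let `k` be the level of the node, and let the rank `R` of the parent lie between two consecutive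
iterates of `ack k` at `j`. When the rank of the parent grows to `ack k R` or more, it passes the
upper one of these iterates, and the corresponding pair is no longer counted. -/
theorem phi_lt {K k j R R' : ℕ} (hk : k < K) (hj : 1 ≤ j) (h₁ : ack k j ≤ R)
    (h₂ : R < ack (k + 1) j) (h₃ : ack k R ≤ R') : phi K j R' < phi K j R := by
  have hmono : Monotone (ack k) := (ack_strictMono_right k).monotone
  -- Since `1 ≤ j`, this iterate is at least the one started at `1`, which is `ack (k + 1) j`. So at
  -- most `j` iterates can have been passed, which is why `phi` needs only indices up to `j`.
  have hex : R < (ack k)^[j + 1] j := by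
    refine h₂.trans_le ?_
    rw [← ack_iterate_one]
    exact hmono.iterate _ hj
  have hP : ∃ i, R < (ack k)^[i + 1] j := ⟨j, hex⟩
  obtain ⟨i, hi⟩ : ∃ i, Nat.find hP = i + 1 := by
    refine Nat.exists_eq_succ_of_ne_zero fun h => ?_
    have := Nat.find_spec hP
    rw [h] at this
    simp at this
    omega
  have hlt := Nat.find_spec hP
  rw [hi] at hlt
  have hle : (ack k)^[i + 1] j ≤ R := not_lt.1 (Nat.find_min hP (m := i) (by omega))
  have hij : i + 1 ≤ j := hi ▸ Nat.find_min' hP hex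
  refine Finset.card_lt_card ⟨Finset.monotone_filter_right _ fun _ _ h' => ?_, fun hsub => ?_⟩
  · refine lt_of_le_of_lt ?_ h'
    exact (lt_ack_right k R).le.trans h₃
  · have hmem : (k, i + 1) ∈ (Finset.range K ×ˢ Finset.range (j + 1)).filter
        fun ki => R < (ack ki.1)^[ki.2 + 1] j := by
      simp only [Finset.mem_filter, Finset.mem_product, Finset.mem_range]
      exact ⟨⟨hk, by omega⟩, hlt⟩
    have := hsub hmem
    simp only [Finset.mem_filter] at this
    have h' := this.2
    rw [Function.iterate_succ_apply'] at h'
    have := hmono hle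
    omega

/-! ### Union-find forests and their potential -/

variable {N K : ℕ} {p rk rt : ℕ → ℕ}

/-- The number of roots. -/
def roots (N : ℕ) (p : ℕ → ℕ) : ℕ := ((Finset.range N).filter fun x => p x = x).card

/-- A union-find forest with parents `p` and ranks `rk`, in which the root of `x` is `rt x`. -/
structure Forest (N : ℕ) (p rk rt : ℕ → ℕ) : Prop where
  p_lt : ∀ x < N, p x < N
  rt_lt : ∀ x < N, rt x < N
  rt_p : ∀ x < N, rt (p x) = rt x
  p_rt : ∀ x < N, p (rt x) = rt x
  rt_of_root : ∀ x < N, p x = x → rt x = x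
  rk_lt : ∀ x < N, p x ≠ x → rk x < rk (p x)
  -- A union raises a rank by at most one and uses up a root, so ranks stay below `N`. The usual
  -- logarithmic bound on ranks is not needed.
  rk_add_roots : ∀ x < N, rk x + roots N p ≤ N

/-- The potential of a node. -/
def pot (K : ℕ) (p rk : ℕ → ℕ) (x : ℕ) : ℕ :=
  -- The value at a root is the upper bound of `phi_le`, so becoming a child never raises the
  -- potential of a node.
  if p x = x then K * (rk x + 1) else phi K (rk x) (rk (p x))

/-- The potential of a forest. -/
def potential (N K : ℕ) (p rk : ℕ → ℕ) : ℕ := ∑ x ∈ Finset.range N, pot K p rk x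

namespace Forest

theorem roots_pos (h : Forest N p rk rt) {x : ℕ} (hx : x < N) : 0 < roots N p :=
  Finset.card_pos.2 ⟨rt x, by simp [h.rt_lt x hx, h.p_rt x hx]⟩

theorem rank_lt (h : Forest N p rk rt) {x : ℕ} (hx : x < N) : rk x < N := by
  have := h.rk_add_roots x hx
  have := h.roots_pos hx
  omega

theorem rt_rt (h : Forest N p rk rt) {x : ℕ} (hx : x < N) : rt (rt x) = rt x :=
  h.rt_of_root _ (h.rt_lt x hx) (h.p_rt x hx)

/-- Every node is connected to its root by a path. -/
theorem exists_path (h : Forest N p rk rt) {x : ℕ} (hx : x < N) :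
    ∃ l, p^[l] x = rt x ∧ ∀ i < l, p (p^[i] x) ≠ p^[i] x := by
  induction hn : N - rk x using Nat.strong_induction_on generalizing x with
  | _ n ih =>
    by_cases hr : p x = x
    · exact ⟨0, (h.rt_of_root x hx hr).symm, by simp⟩
    · have h₁ := h.rk_lt x hx hr
      have h₂ := h.rank_lt (h.p_lt x hx)
      obtain ⟨l, hl, hl'⟩ := ih _ (by omega) (h.p_lt x hx) rfl
      refine ⟨l + 1, by rw [Function.iterate_succ_apply, hl, h.rt_p x hx], fun i hi => ?_⟩
      cases i with
      | zero => exact hr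
      | succ i =>
        rw [Function.iterate_succ_apply]
        exact hl' i (by omega)

theorem iterate_lt (h : Forest N p rk rt) {x : ℕ} (hx : x < N) (i : ℕ) : p^[i] x < N := by
  induction i with
  | zero => exact hx
  | succ i ih => rw [Function.iterate_succ_apply']; exact h.p_lt _ ih

theorem rt_iterate (h : Forest N p rk rt) {x : ℕ} (hx : x < N) (i : ℕ) :
    rt (p^[i] x) = rt x := by
  induction i with
  | zero => rfl
  | succ i ih => rw [Function.iterate_succ_apply', h.rt_p _ (h.iterate_lt hx i), ih]

theorem rank_iterate_lt (h : Forest N p rk rt) {x l : ℕ} (hx : x < N)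
    (hl : ∀ i < l, p (p^[i] x) ≠ p^[i] x) {i j : ℕ} (hij : i < j) (hj : j ≤ l) :
    rk (p^[i] x) < rk (p^[j] x) := by
  induction j with
  | zero => omega
  | succ j ih =>
    have h₁ : rk (p^[j] x) < rk (p^[j + 1] x) := by
      rw [Function.iterate_succ_apply']
      exact h.rk_lt _ (h.iterate_lt hx j) (hl j (by omega))
    rcases Nat.lt_succ_iff_lt_or_eq.1 hij with h₂ | rfl
    · exact (ih h₂ (by omega)).trans h₁
    · exact h₁

theorem rank_le_rt (h : Forest N p rk rt) {x : ℕ} (hx : x < N) : rk x ≤ rk (rt x) := by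
  obtain ⟨l, hl, hl'⟩ := h.exists_path hx
  rcases Nat.eq_zero_or_pos l with rfl | h0
  · exact (congrArg rk hl).le
  · rw [← hl]
    exact (h.rank_iterate_lt hx hl' h0 le_rfl).le

theorem rank_lt_rt (h : Forest N p rk rt) {x : ℕ} (hx : x < N) (hr : p x ≠ x) :
    rk x < rk (rt x) := by
  have h₁ := h.rk_lt x hx hr
  have h₂ := h.rank_le_rt (h.p_lt x hx)
  rw [h.rt_p x hx] at h₂
  omega

end Forest

/-- The nodes on the path from `x`, up to length `l`. -/
def path (p : ℕ → ℕ) (x l : ℕ) : Finset ℕ := (Finset.range l).image fun i => p^[i] x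

/-- Path compression: all nodes on the path from `x` become children of `r`. -/
def compress (p : ℕ → ℕ) (x l r : ℕ) : ℕ → ℕ := fun z => if z ∈ path p x l then r else p z

namespace Forest

variable {x l : ℕ}

/-- No root is created or destroyed: the nodes on the path are not roots before compression, and
none of them is the node `rt x` that becomes their parent. -/
theorem compress_eq_self_iff (h : Forest N p rk rt) (hx : x < N)
    (hl : ∀ i < l, p (p^[i] x) ≠ p^[i] x) (z : ℕ) : compress p x l (rt x) z = z ↔ p z = z := by
  unfold compress
  split_ifs with hz
  · simp only [path, Finset.mem_image, Finset.mem_range] at hz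
    obtain ⟨i, hi, rfl⟩ := hz
    simp only [hl i hi, iff_false]
    intro hr
    exact hl i hi (hr ▸ h.p_rt x hx)
  · rfl

/-- Path compression preserves the properties of the forest. -/
theorem compress (h : Forest N p rk rt) (hx : x < N)
    (hl : ∀ i < l, p (p^[i] x) ≠ p^[i] x) : Forest N (compress p x l (rt x)) rk rt := by
  have hself := h.compress_eq_self_iff hx hl
  have hroots : roots N (GKAT.compress p x l (rt x)) = roots N p := by
    simp only [roots, hself]
  have key : ∀ z < N, (GKAT.compress p x l (rt x) z = p z) ∨
      (GKAT.compress p x l (rt x) z = rt z) := fun z _ => by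
    unfold GKAT.compress
    split_ifs with hz
    · simp only [path, Finset.mem_image, Finset.mem_range] at hz
      obtain ⟨i, hi, rfl⟩ := hz
      exact Or.inr (h.rt_iterate hx i).symm
    · exact Or.inl rfl
  refine ⟨fun z hz => ?_, h.rt_lt, fun z hz => ?_, fun z hz => (hself _).2 (h.p_rt z hz),
    fun z hz hp => h.rt_of_root z hz ((hself z).1 hp), fun z hz hp => ?_,
    fun z hz => hroots ▸ h.rk_add_roots z hz⟩
  · rcases key z hz with h' | h' <;> rw [h']
    exacts [h.p_lt z hz, h.rt_lt z hz]
  · rcases key z hz with h' | h' <;> rw [h']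
    exacts [h.rt_p z hz, h.rt_rt hz]
  · have hp' := fun e => hp ((hself z).2 e)
    rcases key z hz with h' | h' <;> rw [h']
    exacts [h.rk_lt z hz hp', h.rank_lt_rt hz hp']

theorem roots_compress (h : Forest N p rk rt) (hx : x < N)
    (hl : ∀ i < l, p (p^[i] x) ≠ p^[i] x) : roots N (GKAT.compress p x l (rt x)) = roots N p := by
  simp only [roots, h.compress_eq_self_iff hx hl]

/-- The level is the last `k` for which `ack k` of the rank does not exceed the rank of the parent.
It exists because `ack 0` is the successor and ranks increase towards the root; it is below `K`
because ranks are below `N ≤ ack K 1`. -/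
theorem exists_level (h : Forest N p rk rt) (hK : N ≤ ack K 1) (hx : x < N) (hr : p x ≠ x)
    (h1 : 1 ≤ rk x) : ∃ k < K, ack k (rk x) ≤ rk (p x) ∧ rk (p x) < ack (k + 1) (rk x) := by
  have hP : ∃ k, rk (p x) < ack k (rk x) :=
    ⟨K, (h.rank_lt (h.p_lt x hx)).trans_le (hK.trans ((ack_strictMono_right K).monotone h1))⟩
  have hne : Nat.find hP ≠ 0 := fun h0 => by
    have := Nat.find_spec hP
    rw [h0, ack_zero] at this
    have := h.rk_lt x hx hr
    omega
  obtain ⟨k, hk⟩ := Nat.exists_eq_succ_of_ne_zero hne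
  refine ⟨k, ?_, not_lt.1 (Nat.find_min hP (m := k) (by omega)), ?_⟩
  · have := Nat.find_min' hP
      ((h.rank_lt (h.p_lt x hx)).trans_le (hK.trans ((ack_strictMono_right K).monotone h1)))
    omega
  · have := Nat.find_spec hP
    rwa [hk] at this

/-- The amortized cost of path compression. -/
theorem potential_compress (h : Forest N p rk rt) (hK : N ≤ ack K 1) (hx : x < N)
    (hl : ∀ i < l, p (p^[i] x) ≠ p^[i] x) :
    potential N K (GKAT.compress p x l (rt x)) rk + l ≤ potential N K p rk + (K + 1) := by
  set p' := GKAT.compress p x l (rt x) with hp'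
  set S := path p x l with hS
  have hself := h.compress_eq_self_iff hx hl
  have hinj : ∀ i j, i < l → j < l → p^[i] x = p^[j] x → i = j := fun i j hi hj hij => by
    rcases lt_trichotomy i j with h' | h' | h'
    · have := h.rank_iterate_lt hx hl h' hj.le
      rw [hij] at this
      omega
    · exact h'
    · have := h.rank_iterate_lt hx hl h' hi.le
      rw [hij] at this
      omega
  have hcard : S.card = l := by
    rw [hS, path, Finset.card_image_of_injOn, Finset.card_range]
    intro i hi j hj hij
    exact hinj i j (by simpa using hi) (by simpa using hj) hij
  have hSN : S ⊆ Finset.range N := by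
    intro z hz
    simp only [hS, path, Finset.mem_image] at hz
    obtain ⟨i, -, rfl⟩ := hz
    exact Finset.mem_range.2 (h.iterate_lt hx i)
  have hpath : ∀ z ∈ S, ∃ i < l, p^[i] x = z := fun z hz => by
    simpa [hS, path] using hz
  -- after compression
  have hpS : ∀ z ∈ S, pot K p' rk z = phi K (rk z) (rk (rt x)) := fun z hz => by
    obtain ⟨i, hi, rfl⟩ := hpath z hz
    rw [pot, if_neg (by rw [hself]; exact hl i hi)]
    simp only [hp', GKAT.compress, ← hS, if_pos hz]
  have hpS' : ∀ z ∈ S, pot K p rk z = phi K (rk z) (rk (p z)) := fun z hz => by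
    obtain ⟨i, hi, rfl⟩ := hpath z hz
    rw [pot, if_neg (hl i hi)]
  have hle : ∀ z ∈ Finset.range N, pot K p' rk z ≤ pot K p rk z := fun z hz => by
    by_cases hzS : z ∈ S
    · rw [hpS z hzS, hpS' z hzS]
      refine phi_anti ?_
      have := h.rank_le_rt (h.p_lt z (by simpa using hz))
      rw [h.rt_p z (by simpa using hz)] at this
      obtain ⟨i, -, rfl⟩ := hpath z hzS
      rwa [h.rt_iterate hx] at this
    · have : p' z = p z := by simp [hp', GKAT.compress, ← hS, hzS]
      simp [pot, this]
  -- The nodes of the path that lose no potential. All others pay for themselves, so it remains to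
  -- show that at most `K + 1` nodes are bad: one of rank zero, and one for each level.
  set bad := S.filter fun z => pot K p' rk z = pot K p rk z with hbad
  have hsum : ∑ z ∈ Finset.range N, pot K p' rk z + (S.filter fun z => ¬ pot K p' rk z = pot K p rk z).card
      ≤ ∑ z ∈ Finset.range N, pot K p rk z := by
    have : (S.filter fun z => ¬ pot K p' rk z = pot K p rk z).card
        ≤ ∑ z ∈ Finset.range N, if z ∈ S.filter (fun z => ¬ pot K p' rk z = pot K p rk z)
          then 1 else 0 := by
      rw [Finset.sum_ite_mem, Finset.sum_const, smul_eq_mul, mul_one]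
      exact Finset.card_le_card
        (Finset.subset_inter ((Finset.filter_subset _ _).trans hSN) (Finset.Subset.refl _))
    refine (Nat.add_le_add_left this _).trans ?_
    rw [← Finset.sum_add_distrib]
    refine Finset.sum_le_sum fun z hz => ?_
    have := hle z hz
    split_ifs with hz'
    · have := (Finset.mem_filter.1 hz').2
      omega
    · omega
  have hsplit := Finset.card_filter_add_card_filter_not (s := S)
    (fun z => pot K p' rk z = pot K p rk z)
  have hbadcard : bad.card ≤ K + 1 := by
    -- Ranks increase strictly along the path. A node of rank zero has to be set aside because
    -- `phi_lt` requires `1 ≤ j`.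
    have h0 : (bad.filter fun z => rk z = 0).card ≤ 1 := by
      refine Finset.card_le_one.2 fun z hz z' hz' => ?_
      simp only [hbad, Finset.mem_filter] at hz hz'
      obtain ⟨i, hi, rfl⟩ := hpath z hz.1.1
      obtain ⟨j, hj, rfl⟩ := hpath z' hz'.1.1
      rcases lt_trichotomy i j with h' | rfl | h'
      · have := h.rank_iterate_lt hx hl h' hj.le
        omega
      · rfl
      · have := h.rank_iterate_lt hx hl h' hi.le
        omega
    have h1 : (bad.filter fun z => ¬ rk z = 0).card ≤ K := by
      have hlev : ∀ z ∈ bad.filter fun z => ¬ rk z = 0,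
          ∃ k < K, ack k (rk z) ≤ rk (p z) ∧ rk (p z) < ack (k + 1) (rk z) := fun z hz => by
        simp only [hbad, Finset.mem_filter] at hz
        obtain ⟨i, hi, rfl⟩ := hpath z hz.1.1
        exact h.exists_level hK (h.iterate_lt hx i) (hl i hi) (by omega)
      choose! lev hlev₁ hlev₂ hlev₃ using hlev
      -- Let the node `j` further up have the same level `k` as the node `i`. The rank of the parent
      -- of `i` is at most that of `j`, and `ack k` of the latter is at most the rank of the parent
      -- of `j`, hence at most the rank of the root. By `phi_lt` the potential of `i` drops, so `i`
      -- is not bad.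
      have hno : ∀ i j, i < j → j < l → p^[i] x ∈ (bad.filter fun z => ¬ rk z = 0) →
          p^[j] x ∈ (bad.filter fun z => ¬ rk z = 0) → lev (p^[i] x) ≠ lev (p^[j] x) := by
        intro i j hij hj hi₁ hj₁ he
        have hi₂ := hi₁
        simp only [hbad, Finset.mem_filter] at hi₂
        rw [hpS _ hi₂.1.1, hpS' _ hi₂.1.1] at hi₂
        refine (phi_lt (hlev₁ _ hi₁) (by omega) (hlev₂ _ hi₁) (hlev₃ _ hi₁) ?_).ne hi₂.1.2
        have e₁ : rk (p (p^[i] x)) ≤ rk (p^[j] x) := by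
          rw [← Function.iterate_succ_apply' p i x]
          rcases Nat.eq_or_lt_of_le (show i + 1 ≤ j from hij) with h' | h'
          · subst h'; exact le_rfl
          · exact (h.rank_iterate_lt hx hl h' hj.le).le
        have e₂ : rk (p (p^[j] x)) ≤ rk (rt x) := by
          have := h.rank_le_rt (h.p_lt _ (h.iterate_lt hx j))
          rwa [h.rt_p _ (h.iterate_lt hx j), h.rt_iterate hx] at this
        rw [he]
        exact ((ack_strictMono_right _).monotone e₁).trans ((hlev₂ _ hj₁).trans e₂)
      have := Finset.card_le_card_of_injOn (s := bad.filter fun z => ¬ rk z = 0)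
        (t := Finset.range K) lev (fun z hz => by simpa using hlev₁ z hz) (by
          intro z hz z' hz' he
          have hzS := (Finset.mem_filter.1 (Finset.mem_filter.1 hz).1).1
          have hzS' := (Finset.mem_filter.1 (Finset.mem_filter.1 hz').1).1
          obtain ⟨i, hi, rfl⟩ := hpath z hzS
          obtain ⟨j, hj, rfl⟩ := hpath z' hzS'
          rcases lt_trichotomy i j with h' | rfl | h'
          · exact absurd he (hno i j h' hj hz hz')
          · rfl
          · exact absurd he.symm (hno j i h' hi hz' hz))
      simpa using this
    have := Finset.card_filter_add_card_filter_not (s := bad) (fun z => rk z = 0)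
    omega
  rw [hcard, ← hbad] at hsplit
  unfold potential
  omega

/-- Union by rank: the root `a` becomes a child of the root `b`. -/
theorem link (h : Forest N p rk rt) {a b : ℕ} (ha : a < N) (hb : b < N) (hab : a ≠ b)
    (hpa : p a = a) (hpb : p b = b) (hrk : rk a ≤ rk b) {p' rk' : ℕ → ℕ}
    (hp' : ∀ z, p' z = if z = a then b else p z)
    (hrk' : ∀ z, rk' z = if z = b ∧ rk a = rk b then rk b + 1 else rk z) :
    Forest N p' rk' (fun z => if rt z = a then b else rt z) ∧
      roots N p' + 1 = roots N p ∧
      potential N K p' rk' ≤ potential N K p rk + K := by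
  have hra := h.rt_of_root a ha hpa
  have hrb := h.rt_of_root b hb hpb
  have hpne : ∀ z, z ≠ a → p' z = p z := fun z hz => by rw [hp', if_neg hz]
  have hpa' : p' a = b := by rw [hp', if_pos rfl]
  have hrkne : ∀ z, z ≠ b → rk' z = rk z := fun z hz => by rw [hrk', if_neg (by simp [hz])]
  have hrkb : rk b ≤ rk' b ∧ rk' b ≤ rk b + 1 ∧ rk a < rk' b := by
    rw [hrk']; split_ifs with h'
    · omega
    · have : rk a ≠ rk b := fun e => h' ⟨rfl, e⟩
      omega
  have hrkge : ∀ z, rk z ≤ rk' z ∧ rk' z ≤ rk z + 1 := fun z => by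
    by_cases hz : z = b
    · subst hz; omega
    · rw [hrkne z hz]; omega
  have hroots : roots N p' + 1 = roots N p := by
    have : (Finset.range N).filter (fun z => p z = z) =
        insert a ((Finset.range N).filter fun z => p' z = z) := by
      ext z
      simp only [Finset.mem_insert, Finset.mem_filter, Finset.mem_range]
      by_cases hz : z = a
      · subst hz; simp [ha, hpa]
      · simp [hz, hpne z hz]
    rw [roots, roots, this, Finset.card_insert_of_notMem]
    simp [hpa', hab.symm]
  refine ⟨⟨fun z hz => ?_, fun z hz => ?_, fun z hz => ?_, fun z hz => ?_, fun z hz hr => ?_,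
    fun z hz hr => ?_, fun z hz => ?_⟩, hroots, ?_⟩
  · rw [hp']; split_ifs
    exacts [hb, h.p_lt z hz]
  · split_ifs
    exacts [hb, h.rt_lt z hz]
  · by_cases hz' : z = a
    · subst hz'; simp [hpa', hra, hrb, hab.symm]
    · simp [hpne z hz', h.rt_p z hz]
  · split_ifs with hz'
    · rw [hpne b hab.symm, hpb]
    · rw [hpne _ hz', h.p_rt z hz]
  · have hza : z ≠ a := by rintro rfl; exact hab (hr.symm.trans hpa')
    rw [hpne z hza] at hr
    simp [h.rt_of_root z hz hr, hza]
  · by_cases hza : z = a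
    · subst hza
      rw [hpa', hrkne _ hab]
      exact hrkb.2.2
    · rw [hpne z hza] at hr ⊢
      have hzb : z ≠ b := by rintro rfl; exact hr hpb
      rw [hrkne z hzb]
      exact (h.rk_lt z hz hr).trans_le (hrkge _).1
  · have := h.rk_add_roots z hz
    have := (hrkge z).2
    omega
  -- Only `b` can gain potential, namely `K`, if its rank increases by one. The node `a` passes from
  -- the maximal value to one that is at most as large, and children of `b` can only lose, as the
  -- rank of their parent does not decrease.
  · have : potential N K p rk + K =
        ∑ z ∈ Finset.range N, (pot K p rk z + if z = b then K else 0) := by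
      rw [Finset.sum_add_distrib, Finset.sum_ite_eq' (Finset.range N) b]
      simp [hb, potential]
    rw [this]
    refine Finset.sum_le_sum fun z hz => ?_
    by_cases hzb : z = b
    · subst hzb
      rw [pot, pot, hpne z hab.symm, if_pos hpb, if_pos hpb, if_pos rfl]
      have := Nat.mul_le_mul_left K (show rk' z + 1 ≤ (rk z + 1) + 1 by omega)
      linarith
    · rw [if_neg hzb, add_zero]
      by_cases hza : z = a
      · subst hza
        rw [pot, pot, if_pos hpa, if_neg (by rw [hpa']; exact hab.symm), hrkne z hzb]
        exact phi_le _ _ _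
      · rw [pot, pot, hpne z hza, hrkne z hzb]
        split_ifs
        · exact le_rfl
        · exact phi_anti (hrkge _).1

end Forest

theorem forest_id (N : ℕ) {p rk : ℕ → ℕ} (hp : ∀ x < N, p x = x) (hrk : ∀ x < N, rk x = 0) :
    Forest N p rk id ∧ roots N p ≤ N ∧ potential N K p rk = N * K := by
  have hr : roots N p ≤ N := (Finset.card_filter_le _ _).trans (by simp)
  refine ⟨⟨fun x hx => (hp x hx).symm ▸ hx, fun x hx => hx, fun x hx => hp x hx,
    fun x hx => hp x hx, fun x hx _ => rfl, fun x hx h => absurd (hp x hx) h,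
    fun x hx => by rw [hrk x hx]; omega⟩, hr, ?_⟩
  rw [potential, Finset.sum_congr rfl (g := fun _ => K)]
  · simp
  · intro x hx
    simp only [Finset.mem_range] at hx
    simp [pot, hp x hx, hrk x hx]

/-- The rank of a forest is bounded by the inverse Ackermann function. -/
theorem add_two_le_ack_invAck (n : ℕ) : n + 2 ≤ ack (invAck n + 1) 1 := by
  have h₁ : n ≤ ack (invAck n) (invAck n) := Nat.find_spec (p := fun k => n ≤ ack k k) _
  set k := invAck n
  -- The chain is `n + 2 ≤ ack k k + 2 ≤ ack k (k + 2) ≤ ack k (ack k 1) = ack (k + 1) 1`. The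
  -- summand two is there for the two start states.
  have h₂ : k + 2 ≤ ack k 1 := add_lt_ack k 1
  have h₃ : ack (k + 1) 1 = ack k (ack k 1) := by
    rw [show (1 : ℕ) = 0 + 1 from rfl, ack_succ_succ, ack_succ_zero]
  have h₄ : ack k k + 2 ≤ ack k (k + 2) := by
    have a := ack_strictMono_right k (show k < k + 1 by omega)
    have b := ack_strictMono_right k (show k + 1 < k + 2 by omega)
    omega
  have h₅ := (ack_strictMono_right k).monotone h₂
  omega

/-- Needed to absorb additive constants into multiples of the inverse Ackermann function; it rests
on `ack 0 0 = 1`. -/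
theorem invAck_pos {n : ℕ} (h : 2 ≤ n) : 1 ≤ invAck n := by
  rw [Nat.one_le_iff_ne_zero]
  intro h0
  have h₁ : n ≤ ack (invAck n) (invAck n) := Nat.find_spec (p := fun k => n ≤ ack k k) _
  rw [h0] at h₁
  simp at h₁
  omega

end UnionFind

end GKAT

namespace GKAT

/-! ## Parsing -/

section Parse

variable {T P : Type*}

theorem BExp.size_pos (b : BExp T) : 0 < b.size := by cases b <;> simp [BExp.size]

theorem Exp.size_pos (e : Exp T P) : 0 < e.size := by
  cases e <;> simp [Exp.size, BExp.size_pos]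

theorem BExp.length_symbols (τ : T → ℕ) (b : BExp T) : (b.symbols τ).length = b.size := by
  induction b <;> simp [BExp.symbols, BExp.size, *, add_assoc]

theorem Exp.length_symbols (τ : T → ℕ) (code : P → ℕ) (e : Exp T P) :
    (e.symbols τ code).length = e.size := by
  induction e <;> simp [Exp.symbols, Exp.size, BExp.length_symbols, *, add_assoc]

/-- The symbols `l` are in the memory, from position `o` on. -/
def Stored (s : Mem Var Arr) (l : List (ℕ × ℕ)) (o : ℕ) : Prop :=
  ∀ (j : ℕ) (h : j < l.length), s.arr .tok (o + j) = l[j].1 ∧ s.arr .arg (o + j) = l[j].2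

theorem stored_append {s : Mem Var Arr} {l l' : List (ℕ × ℕ)} {o : ℕ} :
    Stored s (l ++ l') o ↔ Stored s l o ∧ Stored s l' (o + l.length) := by
  constructor
  · intro h
    refine ⟨fun j hj => ?_, fun j hj => ?_⟩
    · have := h j (by simp; omega)
      rwa [List.getElem_append_left hj] at this
    · have := h (l.length + j) (by simp; omega)
      rw [List.getElem_append_right (by omega)] at this
      simpa [add_assoc] using this
  · rintro ⟨h₁, h₂⟩ j hj
    by_cases hjl : j < l.length
    · rw [List.getElem_append_left hjl]
      exact h₁ j hjl
    · rw [List.getElem_append_right (by omega)]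
      have := h₂ (j - l.length) (by simp at hj; omega)
      rwa [show o + l.length + (j - l.length) = o + j by omega] at this

theorem stored_singleton {s : Mem Var Arr} {x : ℕ × ℕ} {o : ℕ} :
    Stored s [x] o ↔ s.arr .tok o = x.1 ∧ s.arr .arg o = x.2 := by
  constructor
  · intro h; simpa using h 0 (by simp)
  · intro h j hj
    obtain rfl : j = 0 := by simpa using hj
    simpa using h

theorem Stored.congr {s s' : Mem Var Arr} {l : List (ℕ × ℕ)} {o : ℕ} (h : Stored s l o)
    (h₁ : s'.arr .tok = s.arr .tok) (h₂ : s'.arr .arg = s.arr .arg) : Stored s' l o := fun j hj => by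
  rw [h₁, h₂]; exact h j hj

/-- The arrays that describe the syntax trees. -/
def Arr.IsTree (r : Arr) : Prop := r = .tok ∨ r = .arg ∨ r = .c1 ∨ r = .c2 ∨ r = .c3

/-- The nodes from `o` to `o + n - 1` are described in the same way in both memories. -/
def SameTree (s s' : Mem Var Arr) (o n : ℕ) : Prop :=
  ∀ r : Arr, r.IsTree → ∀ j, o ≤ j → j < o + n → s'.arr r j = s.arr r j

theorem SameTree.mono {s s' : Mem Var Arr} {o n o' n' : ℕ} (h : SameTree s s' o n)
    (h₁ : o ≤ o') (h₂ : o' + n' ≤ o + n) : SameTree s s' o' n' :=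
  fun r hr j hj hj' => h r hr j (by omega) (by omega)

/-- The syntax tree of `b` occupies the nodes from `o` to `o + b.size - 1`. -/
def BExp.Layout (τ : T → ℕ) (s : Mem Var Arr) : BExp T → ℕ → Prop
  | .fls, o => s.arr .tok o = Prog.kFls
  | .tru, o => s.arr .tok o = Prog.kTru
  | .test t, o => s.arr .tok o = Prog.kTest ∧ s.arr .arg o = τ t
  -- In postfix order the root of a subtree is the last node of its interval, so an operand is
  -- referred to by the end of its interval minus one.
  | .and b c, o => b.Layout τ s o ∧ c.Layout τ s (o + b.size) ∧
    s.arr .tok (o + b.size + c.size) = Prog.kAnd ∧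
    s.arr .c1 (o + b.size + c.size) = o + b.size - 1 ∧
    s.arr .c2 (o + b.size + c.size) = o + b.size + c.size - 1
  | .or b c, o => b.Layout τ s o ∧ c.Layout τ s (o + b.size) ∧
    s.arr .tok (o + b.size + c.size) = Prog.kOr ∧
    s.arr .c1 (o + b.size + c.size) = o + b.size - 1 ∧
    s.arr .c2 (o + b.size + c.size) = o + b.size + c.size - 1
  | .not b, o => b.Layout τ s o ∧ s.arr .tok (o + b.size) = Prog.kNot ∧
    s.arr .c1 (o + b.size) = o + b.size - 1

/-- The syntax tree of `e` occupies the nodes from `o` to `o + e.size - 1`. -/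
def Exp.Layout (τ : T → ℕ) (code : P → ℕ) (s : Mem Var Arr) : Exp T P → ℕ → Prop
  | .act p, o => s.arr .tok o = Prog.kAct ∧ s.arr .arg o = code p
  | .assert b, o => b.Layout τ s o
  | .seq e f, o => e.Layout τ code s o ∧ f.Layout τ code s (o + e.size) ∧
    s.arr .tok (o + e.size + f.size) = Prog.kSeq ∧
    s.arr .c1 (o + e.size + f.size) = o + e.size - 1 ∧
    s.arr .c2 (o + e.size + f.size) = o + e.size + f.size - 1
  | .ite b e f, o => b.Layout τ s o ∧ e.Layout τ code s (o + b.size) ∧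
    f.Layout τ code s (o + b.size + e.size) ∧
    s.arr .tok (o + b.size + e.size + f.size) = Prog.kIte ∧
    s.arr .c1 (o + b.size + e.size + f.size) = o + b.size - 1 ∧
    s.arr .c2 (o + b.size + e.size + f.size) = o + b.size + e.size - 1 ∧
    s.arr .c3 (o + b.size + e.size + f.size) = o + b.size + e.size + f.size - 1
  | .loop b e, o => b.Layout τ s o ∧ e.Layout τ code s (o + b.size) ∧
    s.arr .tok (o + b.size + e.size) = Prog.kLoop ∧
    s.arr .c1 (o + b.size + e.size) = o + b.size - 1 ∧
    s.arr .c2 (o + b.size + e.size) = o + b.size + e.size - 1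

theorem BExp.Layout.congr {τ : T → ℕ} {s s' : Mem Var Arr} {b : BExp T} {o : ℕ}
    (hb : b.Layout τ s o) (h : SameTree s s' o b.size) : b.Layout τ s' o := by
  induction b generalizing o with
  | fls => exact (h .tok (by simp [Arr.IsTree]) o le_rfl (by simp [BExp.size])).trans hb
  | tru => exact (h .tok (by simp [Arr.IsTree]) o le_rfl (by simp [BExp.size])).trans hb
  | test t =>
    exact ⟨(h .tok (by simp [Arr.IsTree]) o le_rfl (by simp [BExp.size])).trans hb.1,
      (h .arg (by simp [Arr.IsTree]) o le_rfl (by simp [BExp.size])).trans hb.2⟩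
  | and b c ihb ihc =>
    simp only [BExp.size] at h
    obtain ⟨hb, hc, k₁, k₂, k₃⟩ := hb
    exact ⟨ihb hb (h.mono (by omega) (by omega)), ihc hc (h.mono (by omega) (by omega)),
      (h .tok (by simp [Arr.IsTree]) _ (by omega) (by omega)).trans k₁,
      (h .c1 (by simp [Arr.IsTree]) _ (by omega) (by omega)).trans k₂,
      (h .c2 (by simp [Arr.IsTree]) _ (by omega) (by omega)).trans k₃⟩
  | or b c ihb ihc =>
    simp only [BExp.size] at h
    obtain ⟨hb, hc, k₁, k₂, k₃⟩ := hb
    exact ⟨ihb hb (h.mono (by omega) (by omega)), ihc hc (h.mono (by omega) (by omega)),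
      (h .tok (by simp [Arr.IsTree]) _ (by omega) (by omega)).trans k₁,
      (h .c1 (by simp [Arr.IsTree]) _ (by omega) (by omega)).trans k₂,
      (h .c2 (by simp [Arr.IsTree]) _ (by omega) (by omega)).trans k₃⟩
  | not b ihb =>
    simp only [BExp.size] at h
    obtain ⟨hb, k₁, k₂⟩ := hb
    exact ⟨ihb hb (h.mono (by omega) (by omega)),
      (h .tok (by simp [Arr.IsTree]) _ (by omega) (by omega)).trans k₁,
      (h .c1 (by simp [Arr.IsTree]) _ (by omega) (by omega)).trans k₂⟩

theorem Exp.Layout.congr {τ : T → ℕ} {code : P → ℕ} {s s' : Mem Var Arr} {e : Exp T P} {o : ℕ}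
    (he : e.Layout τ code s o) (h : SameTree s s' o e.size) : e.Layout τ code s' o := by
  induction e generalizing o with
  | act p =>
    exact ⟨(h .tok (by simp [Arr.IsTree]) o le_rfl (by simp [Exp.size])).trans he.1,
      (h .arg (by simp [Arr.IsTree]) o le_rfl (by simp [Exp.size])).trans he.2⟩
  | assert b => exact BExp.Layout.congr he h
  | seq e f ihe ihf =>
    simp only [Exp.size] at h
    obtain ⟨he, hf, k₁, k₂, k₃⟩ := he
    exact ⟨ihe he (h.mono (by omega) (by omega)), ihf hf (h.mono (by omega) (by omega)),
      (h .tok (by simp [Arr.IsTree]) _ (by omega) (by omega)).trans k₁,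
      (h .c1 (by simp [Arr.IsTree]) _ (by omega) (by omega)).trans k₂,
      (h .c2 (by simp [Arr.IsTree]) _ (by omega) (by omega)).trans k₃⟩
  | ite b e f ihe ihf =>
    simp only [Exp.size] at h
    obtain ⟨hb, he, hf, k₁, k₂, k₃, k₄⟩ := he
    exact ⟨hb.congr (h.mono (by omega) (by omega)), ihe he (h.mono (by omega) (by omega)),
      ihf hf (h.mono (by omega) (by omega)),
      (h .tok (by simp [Arr.IsTree]) _ (by omega) (by omega)).trans k₁,
      (h .c1 (by simp [Arr.IsTree]) _ (by omega) (by omega)).trans k₂,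
      (h .c2 (by simp [Arr.IsTree]) _ (by omega) (by omega)).trans k₃,
      (h .c3 (by simp [Arr.IsTree]) _ (by omega) (by omega)).trans k₄⟩
  | loop b e ihe =>
    simp only [Exp.size] at h
    obtain ⟨hb, he, k₁, k₂, k₃⟩ := he
    exact ⟨hb.congr (h.mono (by omega) (by omega)), ihe he (h.mono (by omega) (by omega)),
      (h .tok (by simp [Arr.IsTree]) _ (by omega) (by omega)).trans k₁,
      (h .c1 (by simp [Arr.IsTree]) _ (by omega) (by omega)).trans k₂,
      (h .c2 (by simp [Arr.IsTree]) _ (by omega) (by omega)).trans k₃⟩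

namespace Prog

/-- The body of the loop of the parser. -/
def parseBody : Prog := block [
    switch tok [
      (kAnd, block [pop .c2, pop .c1]),
      (kOr, block [pop .c2, pop .c1]),
      (kNot, pop .c1),
      (kSeq, block [pop .c2, pop .c1]),
      (kIte, block [pop .c3, pop .c2, pop .c1]),
      (kLoop, block [pop .c2, pop .c1])],
    .put .stk (.reg .sp) (.reg .i),
    .set .sp (.succ (.reg .sp))]

/-- The parser has gone from `s` to `s'` by reading `n` symbols from position `o` on, which
describe one syntax tree, when its stack had the height `d`. -/
structure Parsed (s s' : Mem Var Arr) (o n d : ℕ) : Prop where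
  i : s'.reg .i = o + n
  sp : s'.reg .sp = d + 1
  top : s'.arr .stk d = o + n - 1
  below : ∀ j < d, s'.arr .stk j = s.arr .stk j
  tok : s'.arr .tok = s.arr .tok
  arg : s'.arr .arg = s.arr .arg
  other : ∀ r : Arr, r.IsTree → ∀ j, j < o ∨ o + n ≤ j → s'.arr r j = s.arr r j

variable {s s₁ s₂ s₃ : Mem Var Arr} {o n₁ n₂ n₃ d : ℕ}

theorem Parsed.sameTree (h : Parsed s s₁ o n₁ d) {o' n' : ℕ}
    (ho : o' + n' ≤ o ∨ o + n₁ ≤ o') : SameTree s s₁ o' n' :=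
  fun r hr j h₁ h₂ => h.other r hr j (by omega)

theorem parsed_leaf (hi : s.reg .i = o) (hsp : s.reg .sp = d)
    (ht : s.arr .tok o = kFls ∨ s.arr .tok o = kTru ∨ s.arr .tok o = kTest ∨
      s.arr .tok o = kAct) : Parsed s (roundUp .i parseBody s) o 1 d := by
  have e : roundUp .i parseBody s = ((s.put .stk d o).set .sp (d + 1)).set .i (o + 1) := by
    rcases ht with ht | ht | ht | ht <;>
    simp [roundUp, parseBody, block, switch, Cmd.run, Cnd.eval_eq_iff, Tm.eval, Prog.tok, hi, hsp,
      ht, kAnd, kOr, kNot, kSeq, kIte, kLoop, kFls, kTru, kTest, kAct]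
  rw [e]
  refine ⟨by simp, by simp, by simp, fun j hj => by simp [hj.ne], by simp [Mem.put_arr_of_ne],
    by simp [Mem.put_arr_of_ne], fun r hr j hj => ?_⟩
  simp only [Arr.IsTree] at hr
  rcases hr with rfl | rfl | rfl | rfl | rfl <;> simp

theorem parsed_unary (h₁ : Parsed s s₁ o n₁ d) (hn₁ : 0 < n₁)
    (ht : s₁.arr .tok (o + n₁) = kNot) :
    Parsed s (roundUp .i parseBody s₁) o (n₁ + 1) d ∧
    SameTree s₁ (roundUp .i parseBody s₁) o n₁ ∧
    (roundUp .i parseBody s₁).arr .tok (o + n₁) = kNot ∧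
    (roundUp .i parseBody s₁).arr .c1 (o + n₁) = o + n₁ - 1 := by
  obtain ⟨hi, hsp, top, below, ht', ha', other⟩ := h₁
  have e : roundUp .i parseBody s₁ = ((((s₁.set .sp d).put .c1 (o + n₁) (o + n₁ - 1)).put .stk d
      (o + n₁)).set .sp (d + 1)).set .i (o + n₁ + 1) := by
    simp [roundUp, parseBody, block, switch, Cmd.run, Cnd.eval_eq_iff, Tm.eval, Prog.tok, hi, hsp,
      ht, pop, kAnd, kOr, kNot, top]
  rw [e]
  refine ⟨?_, ?_, ?_, ?_⟩
  · refine ⟨by simp; omega, by simp, by simp, fun j hj => by simp [hj.ne, below j hj],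
      by simp [Mem.put_arr_of_ne, ht'], by simp [Mem.put_arr_of_ne, ha'], fun r hr j hj => ?_⟩
    have hj' : j ≠ o + n₁ := by omega
    rw [← other r hr j (by omega)]
    simp only [Arr.IsTree] at hr
    rcases hr with rfl | rfl | rfl | rfl | rfl <;> simp [hj']
  · intro r hr j h₁ h₂
    have : j ≠ o + n₁ := by omega
    simp only [Arr.IsTree] at hr
    rcases hr with rfl | rfl | rfl | rfl | rfl <;> simp [this]
  · simpa using ht
  · simp

/-- The two topmost stack cells hold the roots of the operands, the right one on top. Popping both
and pushing the new root leaves the height `d + 1`, as after any other tree. -/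
theorem parsed_binary (h₁ : Parsed s s₁ o n₁ d) (hn₁ : 0 < n₁)
    (h₂ : Parsed s₁ s₂ (o + n₁) n₂ (d + 1)) (hn₂ : 0 < n₂) {k : ℕ}
    (hk : k = kAnd ∨ k = kOr ∨ k = kSeq ∨ k = kLoop)
    (ht : s₂.arr .tok (o + n₁ + n₂) = k) :
    Parsed s (roundUp .i parseBody s₂) o (n₁ + n₂ + 1) d ∧
    SameTree s₂ (roundUp .i parseBody s₂) o (n₁ + n₂) ∧
    (roundUp .i parseBody s₂).arr .tok (o + n₁ + n₂) = k ∧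
    (roundUp .i parseBody s₂).arr .c1 (o + n₁ + n₂) = o + n₁ - 1 ∧
    (roundUp .i parseBody s₂).arr .c2 (o + n₁ + n₂) = o + n₁ + n₂ - 1 := by
  have e : roundUp .i parseBody s₂ = ((((((s₂.set .sp (d + 1)).put .c2 (o + n₁ + n₂)
      (o + n₁ + n₂ - 1)).set .sp d).put .c1 (o + n₁ + n₂) (o + n₁ - 1)).put .stk d
      (o + n₁ + n₂)).set .sp (d + 1)).set .i (o + n₁ + n₂ + 1) := by
    rcases hk with rfl | rfl | rfl | rfl <;>
    simp [roundUp, parseBody, block, switch, Cmd.run, Cnd.eval_eq_iff, Tm.eval, Prog.tok, h₂.i,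
      h₂.sp, h₂.top, h₂.below, h₁.top,
      ht, pop, kAnd, kOr, kNot, kSeq, kIte, kLoop]
  rw [e]
  have hb := h₁.below
  have hb₂ := h₂.below
  have hot := h₁.other
  have hot₂ := h₂.other
  refine ⟨⟨?_, ?_, ?_, ?_, ?_, ?_, ?_⟩, ?_, ?_, ?_, ?_⟩
  · simp; omega
  · simp
  · simp; omega
  · intro j hj; simp [hj.ne, hb₂ j (by omega), hb j hj]
  · simp [Mem.put_arr_of_ne, h₂.tok, h₁.tok]
  · simp [Mem.put_arr_of_ne, h₂.arg, h₁.arg]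
  · intro r hr j hj
    have hj' : j ≠ o + n₁ + n₂ := by omega
    rw [← hot r hr j (by omega), ← hot₂ r hr j (by omega)]
    simp only [Arr.IsTree] at hr
    rcases hr with rfl | rfl | rfl | rfl | rfl <;> simp [hj']
  · intro r hr j h₁ h₂
    have : j ≠ o + n₁ + n₂ := by omega
    simp only [Arr.IsTree] at hr
    rcases hr with rfl | rfl | rfl | rfl | rfl <;> simp [this]
  · simpa using ht
  · simp
  · simp

theorem parsed_ternary (h₁ : Parsed s s₁ o n₁ d) (hn₁ : 0 < n₁)
    (h₂ : Parsed s₁ s₂ (o + n₁) n₂ (d + 1)) (hn₂ : 0 < n₂)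
    (h₃ : Parsed s₂ s₃ (o + n₁ + n₂) n₃ (d + 2)) (hn₃ : 0 < n₃)
    (ht : s₃.arr .tok (o + n₁ + n₂ + n₃) = kIte) :
    Parsed s (roundUp .i parseBody s₃) o (n₁ + n₂ + n₃ + 1) d ∧
    SameTree s₃ (roundUp .i parseBody s₃) o (n₁ + n₂ + n₃) ∧
    (roundUp .i parseBody s₃).arr .tok (o + n₁ + n₂ + n₃) = kIte ∧
    (roundUp .i parseBody s₃).arr .c1 (o + n₁ + n₂ + n₃) = o + n₁ - 1 ∧
    (roundUp .i parseBody s₃).arr .c2 (o + n₁ + n₂ + n₃) = o + n₁ + n₂ - 1 ∧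
    (roundUp .i parseBody s₃).arr .c3 (o + n₁ + n₂ + n₃) = o + n₁ + n₂ + n₃ - 1 := by
  have e : roundUp .i parseBody s₃ = ((((((((s₃.set .sp (d + 2)).put .c3 (o + n₁ + n₂ + n₃)
      (o + n₁ + n₂ + n₃ - 1)).set .sp (d + 1)).put .c2 (o + n₁ + n₂ + n₃)
      (o + n₁ + n₂ - 1)).set .sp d).put .c1 (o + n₁ + n₂ + n₃) (o + n₁ - 1)).put .stk d
      (o + n₁ + n₂ + n₃)).set .sp (d + 1)).set .i (o + n₁ + n₂ + n₃ + 1) := by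
    simp [roundUp, parseBody, block, switch, Cmd.run, Cnd.eval_eq_iff, Tm.eval, Prog.tok, h₃.i,
      h₃.sp, h₃.top, h₃.below, h₂.top, h₂.below, h₁.top, 
      ht, pop, kAnd, kOr, kNot, kSeq, kIte]
  rw [e]
  have hb := h₁.below
  have hb₂ := h₂.below
  have hb₃ := h₃.below
  have hot := h₁.other
  have hot₂ := h₂.other
  have hot₃ := h₃.other
  refine ⟨⟨?_, ?_, ?_, ?_, ?_, ?_, ?_⟩, ?_, ?_, ?_, ?_, ?_⟩
  · simp; omega
  · simp
  · simp; omega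
  · intro j hj; simp [hj.ne, hb₃ j (by omega), hb₂ j (by omega), hb j hj]
  · simp [Mem.put_arr_of_ne, h₃.tok, h₂.tok, h₁.tok]
  · simp [Mem.put_arr_of_ne, h₃.arg, h₂.arg, h₁.arg]
  · intro r hr j hj
    have hj' : j ≠ o + n₁ + n₂ + n₃ := by omega
    rw [← hot r hr j (by omega), ← hot₂ r hr j (by omega), ← hot₃ r hr j (by omega)]
    simp only [Arr.IsTree] at hr
    rcases hr with rfl | rfl | rfl | rfl | rfl <;> simp [hj']
  · intro r hr j h₁ h₂
    have : j ≠ o + n₁ + n₂ + n₃ := by omega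
    simp only [Arr.IsTree] at hr
    rcases hr with rfl | rfl | rfl | rfl | rfl <;> simp [this]
  · simpa using ht
  · simp
  · simp
  · simp

end Prog

open Prog

/-- The induction works because the position `o` and the height `d` are arbitrary: reading a subtree
has the net effect of pushing its root, and neither the stack below nor nodes outside the interval
change. The two binary connectives share one argument. -/
theorem BExp.parse {τ : T → ℕ} (b : BExp T) {s : Mem Var Arr} {o d : ℕ}
    (hs : Stored s (b.symbols τ) o) (hi : s.reg .i = o) (hsp : s.reg .sp = d) :
    Parsed s ((roundUp .i parseBody)^[b.size] s) o b.size d ∧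
      b.Layout τ ((roundUp .i parseBody)^[b.size] s) o := by
  have binary : ∀ (b c : BExp T) (k : ℕ), (k = kAnd ∨ k = kOr) →
      (∀ {s : Mem Var Arr} {o d : ℕ}, Stored s (b.symbols τ) o → s.reg .i = o → s.reg .sp = d →
        Parsed s ((roundUp .i parseBody)^[b.size] s) o b.size d ∧
          b.Layout τ ((roundUp .i parseBody)^[b.size] s) o) →
      (∀ {s : Mem Var Arr} {o d : ℕ}, Stored s (c.symbols τ) o → s.reg .i = o → s.reg .sp = d →
        Parsed s ((roundUp .i parseBody)^[c.size] s) o c.size d ∧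
          c.Layout τ ((roundUp .i parseBody)^[c.size] s) o) →
      ∀ {s : Mem Var Arr} {o d : ℕ}, Stored s (b.symbols τ ++ c.symbols τ ++ [(k, 0)]) o →
        s.reg .i = o → s.reg .sp = d → ∀ s', s' = (roundUp .i parseBody)^[b.size + c.size + 1] s →
        Parsed s s' o (b.size + c.size + 1) d ∧ b.Layout τ s' o ∧ c.Layout τ s' (o + b.size) ∧
          s'.arr .tok (o + b.size + c.size) = k ∧
          s'.arr .c1 (o + b.size + c.size) = o + b.size - 1 ∧
          s'.arr .c2 (o + b.size + c.size) = o + b.size + c.size - 1 := by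
    intro b c k hk ihb ihc s o d hs hi hsp s' hs'
    rw [stored_append, stored_append, stored_singleton, List.length_append, BExp.length_symbols,
      BExp.length_symbols] at hs
    obtain ⟨⟨hb, hc⟩, ht, -⟩ := hs
    obtain ⟨pb, lb⟩ := ihb hb hi hsp
    set s₁ := (roundUp .i parseBody)^[b.size] s with e₁
    obtain ⟨pc, lc⟩ := ihc (hc.congr pb.tok pb.arg) pb.i pb.sp
    set s₂ := (roundUp .i parseBody)^[c.size] s₁ with e₂
    have e : s' = roundUp .i parseBody s₂ := by
      rw [hs', e₂, e₁, ← Function.iterate_succ_apply' (roundUp .i parseBody),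
        ← Function.iterate_add_apply]
      congr 1
      omega
    obtain ⟨q₁, q₂, q₃⟩ := parsed_binary (k := k) pb b.size_pos pc c.size_pos
      (by tauto) (by rw [pc.tok, pb.tok, add_assoc]; exact ht)
    rw [e]
    exact ⟨q₁, (lb.congr (pc.sameTree (Or.inl (by omega)))).congr
      (q₂.mono (by omega) (by omega)), lc.congr (q₂.mono (by omega) (by omega)), q₃⟩
  induction b generalizing s o d with
  | fls =>
    have := stored_singleton.1 hs
    have p := parsed_leaf hi hsp (Or.inl this.1)
    exact ⟨p, (congrFun p.tok o).trans this.1⟩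
  | tru =>
    have := stored_singleton.1 hs
    have p := parsed_leaf hi hsp (Or.inr (Or.inl this.1))
    exact ⟨p, (congrFun p.tok o).trans this.1⟩
  | test t =>
    have := stored_singleton.1 hs
    have p := parsed_leaf hi hsp (Or.inr (Or.inr (Or.inl this.1)))
    exact ⟨p, (congrFun p.tok o).trans this.1, (congrFun p.arg o).trans this.2⟩
  | and b c ihb ihc => exact binary b c kAnd (Or.inl rfl) ihb ihc hs hi hsp _ rfl
  | or b c ihb ihc => exact binary b c kOr (Or.inr rfl) ihb ihc hs hi hsp _ rfl
  | not b ihb =>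
    rw [BExp.symbols, stored_append, stored_singleton, BExp.length_symbols] at hs
    obtain ⟨hb, ht, -⟩ := hs
    obtain ⟨pb, lb⟩ := ihb hb hi hsp
    obtain ⟨q₁, q₂, q₃⟩ := parsed_unary pb b.size_pos (by rw [pb.tok]; exact ht)
    simp only [BExp.size, Function.iterate_succ_apply']
    exact ⟨q₁, lb.congr q₂, q₃⟩

theorem Exp.parse {τ : T → ℕ} {code : P → ℕ} (e : Exp T P) {s : Mem Var Arr} {o d : ℕ}
    (hs : Stored s (e.symbols τ code) o) (hi : s.reg .i = o) (hsp : s.reg .sp = d) :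
    Parsed s ((roundUp .i parseBody)^[e.size] s) o e.size d ∧
      e.Layout τ code ((roundUp .i parseBody)^[e.size] s) o := by
  induction e generalizing s o d with
  | act p =>
    have := stored_singleton.1 hs
    have p := parsed_leaf hi hsp (Or.inr (Or.inr (Or.inr this.1)))
    exact ⟨p, (congrFun p.tok o).trans this.1, (congrFun p.arg o).trans this.2⟩
  | assert b => exact b.parse hs hi hsp
  | seq e f ihe ihf =>
    rw [Exp.symbols, stored_append, stored_append, stored_singleton, List.length_append,
      Exp.length_symbols, Exp.length_symbols] at hs
    obtain ⟨⟨he, hf⟩, ht, -⟩ := hs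
    obtain ⟨pe, le⟩ := ihe he hi hsp
    obtain ⟨pf, lf⟩ := ihf (hf.congr pe.tok pe.arg) pe.i pe.sp
    rw [← Function.iterate_add_apply, add_comm] at pf lf
    obtain ⟨q₁, q₂, q₃⟩ := parsed_binary (k := kSeq) pe e.size_pos pf f.size_pos
      (by tauto) (by rw [pf.tok, pe.tok, add_assoc]; exact ht)
    simp only [Exp.size, Function.iterate_succ_apply']
    exact ⟨q₁, (le.congr (pf.sameTree (Or.inl (by omega)))).congr
      (q₂.mono (by omega) (by omega)), lf.congr (q₂.mono (by omega) (by omega)), q₃⟩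
  | ite b e f ihe ihf =>
    rw [Exp.symbols, stored_append, stored_append, stored_append, stored_singleton,
      List.length_append, List.length_append, List.length_append,
      BExp.length_symbols, Exp.length_symbols, Exp.length_symbols] at hs
    obtain ⟨⟨⟨hb, he⟩, hf⟩, ht, -⟩ := hs
    obtain ⟨pb, lb⟩ := b.parse hb hi hsp
    obtain ⟨pe, le⟩ := ihe (he.congr pb.tok pb.arg) pb.i pb.sp
    rw [← Function.iterate_add_apply, add_comm e.size] at pe le
    rw [← add_assoc] at hf
    obtain ⟨pf, lf⟩ := ihf ((hf.congr pb.tok pb.arg).congr pe.tok pe.arg) pe.i pe.sp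
    rw [← Function.iterate_add_apply, add_comm f.size] at pf lf
    obtain ⟨q₁, q₂, q₃⟩ := parsed_ternary pb b.size_pos pe e.size_pos pf f.size_pos
      (by rw [pf.tok, pe.tok, pb.tok, add_assoc, add_assoc, ← add_assoc b.size]; exact ht)
    simp only [Exp.size, Function.iterate_succ_apply']
    exact ⟨q₁, ((lb.congr (pe.sameTree (Or.inl (by omega)))).congr
      (pf.sameTree (Or.inl (by omega)))).congr (q₂.mono (by omega) (by omega)),
      (le.congr (pf.sameTree (Or.inl (by omega)))).congr
      (q₂.mono (by omega) (by omega)), lf.congr (q₂.mono (by omega) (by omega)), q₃⟩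
  | loop b e ihe =>
    rw [Exp.symbols, stored_append, stored_append, stored_singleton, List.length_append,
      BExp.length_symbols, Exp.length_symbols] at hs
    obtain ⟨⟨hb, he⟩, ht, -⟩ := hs
    obtain ⟨pb, lb⟩ := b.parse hb hi hsp
    obtain ⟨pe, le⟩ := ihe (he.congr pb.tok pb.arg) pb.i pb.sp
    rw [← Function.iterate_add_apply, add_comm] at pe le
    obtain ⟨q₁, q₂, q₃⟩ := parsed_binary (k := kLoop) pb b.size_pos pe e.size_pos
      (by tauto) (by rw [pe.tok, pb.tok, add_assoc]; exact ht)
    simp only [Exp.size, Function.iterate_succ_apply']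
    exact ⟨q₁, (lb.congr (pe.sameTree (Or.inl (by omega)))).congr
      (q₂.mono (by omega) (by omega)), le.congr (q₂.mono (by omega) (by omega)), q₃⟩

end Parse

end GKAT

namespace GKAT

/-! ## Initial pseudostates -/

section Pseudostates

variable {T P : Type*}

/-- The atom with a given number. -/
def atomOf (τ : T → ℕ) (a : ℕ) : Atom T := fun t => a.testBit (τ t)

/-- The entry for the atom with number `a` in row `j` of the table `t` is the given one. -/
def Holds (code : P → ℕ) (s : Mem Var Arr) (t : Tbl) (a j : ℕ) : Entry P → Prop
  | .rej => s.arr (.res t a) j = 0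
  | .acc => s.arr (.res t a) j = 1
  | .step p x => s.arr (.res t a) j = 2 ∧ s.arr (.act t a) j = code p ∧ s.arr (.tgt t a) j = x

/-- Row `j` of the table `t` is the given one. -/
def HoldsRow (m : ℕ) (τ : T → ℕ) (code : P → ℕ) (s : Mem Var Arr) (t : Tbl) (j : ℕ)
    (r : Row T P) : Prop :=
  ∀ a < 2 ^ m, Holds code s t a j (r (atomOf τ a))

variable {m : ℕ} {τ : T → ℕ} {code : P → ℕ} {s s' : Mem Var Arr} {t u : Tbl} {a i j : ℕ}

theorem Holds.congr {v : Entry P} (h : Holds code s t a i v)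
    (h₁ : s'.arr (.res t a) j = s.arr (.res t a) i) (h₂ : s'.arr (.act t a) j = s.arr (.act t a) i)
    (h₃ : s'.arr (.tgt t a) j = s.arr (.tgt t a) i) : Holds code s' t a j v := by
  cases v <;> simp_all [Holds]

theorem HoldsRow.congr {r : Row T P} (h : HoldsRow m τ code s t j r)
    (h' : ∀ r : Arr, r.atom ≠ none → s'.arr r j = s.arr r j) : HoldsRow m τ code s' t j r :=
  fun a ha => (h a ha).congr (h' _ (by simp [Arr.atom])) (h' _ (by simp [Arr.atom]))
    (h' _ (by simp [Arr.atom]))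

namespace Prog

/-- Locality lets each atom be treated as if its program were the only one. -/
theorem holdsRow_forAtoms {f : ℕ → Prog} (hf : ∀ a, Local a (f a)) {r : Row T P}
    (h : ∀ a < 2 ^ m, Holds code ((f a).run s) t a j (r (atomOf τ a))) :
    HoldsRow m τ code ((forAtoms m f).run s) t j r := fun a ha => by
  have := (forAtoms_run_local (m := m) hf s).2.2
  exact (h a ha).congr (by rw [this _ a rfl ha]) (by rw [this _ a rfl ha]) (by rw [this _ a rfl ha])

/-- All arrays in the term are shared. -/
abbrev Shared (ti : Tm Var Arr) : Prop := ti.UsesIn fun r => r.atom = none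

theorem eval_put_of_shared {ti : Tm Var Arr} (hi : Shared ti) (s : Mem Var Arr) {r : Arr}
    (hr : r.atom ≠ none) (k v : ℕ) : ti.eval (s.put r k v) = ti.eval s :=
  Tm.eval_congr (s := s.put r k v) (s' := s) rfl
    (fun r' hr' => Mem.put_arr_of_ne s (by rintro rfl; exact hr hr') k v) hi

/-- The index terms must be shared: if they read arrays of the atom, the first of the three writes
could change where the others go. -/
theorem copy_run {ti tj : Tm Var Arr} (hi : Shared ti) (hj : Shared tj) (s : Mem Var Arr) :
    (copy a t ti u tj).run s =
      ((s.put (.res t a) (ti.eval s) (s.arr (.res u a) (tj.eval s))).put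
        (.act t a) (ti.eval s) (s.arr (.act u a) (tj.eval s))).put
        (.tgt t a) (ti.eval s) (s.arr (.tgt u a) (tj.eval s)) := by
  simp only [copy, block, Cmd.run, Tm.eval]
  have h₁ := fun (s : Mem Var Arr) k v =>
    eval_put_of_shared hi s (r := .res t a) (by simp [Arr.atom]) k v
  have h₂ := fun (s : Mem Var Arr) k v =>
    eval_put_of_shared hi s (r := .act t a) (by simp [Arr.atom]) k v
  have h₃ := fun (s : Mem Var Arr) k v =>
    eval_put_of_shared hj s (r := .res t a) (by simp [Arr.atom]) k v
  have h₄ := fun (s : Mem Var Arr) k v =>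
    eval_put_of_shared hj s (r := .act t a) (by simp [Arr.atom]) k v
  simp [h₁, h₂, h₃, h₄]

theorem holds_copy {ti tj : Tm Var Arr} (hi : Shared ti) (hj : Shared tj) {v : Entry P}
    (h : Holds code s u a (tj.eval s) v) :
    Holds code ((copy a t ti u tj).run s) t a (ti.eval s) v := by
  rw [copy_run hi hj]
  cases v <;> simp_all [Holds]

theorem Shared.usesIn {ti : Tm Var Arr} (hi : Shared ti) (a : ℕ) :
    ti.UsesIn fun r => r.atom = none ∨ r.atom = some a := by
  induction ti with
  | lit => trivial
  | reg => trivial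
  | get r i ih => exact ⟨Or.inl hi.1, ih hi.2⟩
  | succ t ih => exact ih hi
  | pred t ih => exact ih hi

theorem local_copy {ti tj : Tm Var Arr} (hi : Shared ti) (hj : Shared tj) :
    Local a (copy a t ti u tj) := by
  have hi' := hi.usesIn a
  have hj' := hj.usesIn a
  refine ⟨?_, ?_, ?_⟩
  · exact ⟨⟨hi', Or.inr rfl, hj'⟩, ⟨hi', Or.inr rfl, hj'⟩, hi', Or.inr rfl, hj'⟩
  · intro r hr
    simp only [copy, block, Cmd.WritesArr] at hr
    rcases hr with rfl | rfl | rfl <;> rfl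
  · intro x hx
    simp [copy, block, Cmd.WritesReg] at hx

theorem local_ite {b : Cnd Var Arr} {c d : Prog}
    (hb : b.UsesIn fun r => r.atom = none ∨ r.atom = some a) (hc : Local a c) (hd : Local a d) :
    Local a (.ite b c d) :=
  ⟨⟨hb, hc.uses, hd.uses⟩, fun r hr => hr.elim (hc.writesArr r) (hd.writesArr r),
    fun x hx => hx.elim (hc.writesReg x) (hd.writesReg x)⟩

theorem local_block {cs : List Prog} (h : ∀ c ∈ cs, Local a c) : Local a (block cs) :=
  ⟨(block_usesIn _ _).2 fun c hc => (h c hc).uses,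
    fun r hr => by
      obtain ⟨c, hc, h'⟩ := (block_writesArr _ _).1 hr
      exact (h c hc).writesArr r h',
    fun x hx => by
      obtain ⟨c, hc, h'⟩ := (block_writesReg _ _).1 hx
      exact (h c hc).writesReg x h'⟩

theorem local_switch {tm : Tm Var Arr} (ht : Shared tm) {cs : List (ℕ × Prog)}
    (h : ∀ c ∈ cs, Local a c.2) : Local a (switch tm cs) :=
  ⟨switch_usesIn _ (ht.usesIn a) _ fun c hc => (h c hc).uses,
    fun r hr => by
      obtain ⟨c, hc, h'⟩ := (switch_writesArr _ _ _).1 hr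
      exact (h c hc).writesArr r h',
    fun x hx => by
      obtain ⟨c, hc, h'⟩ := (switch_writesReg _ _ _).1 hx
      exact (h c hc).writesReg x h'⟩

theorem local_put {r : Arr} (hr : r.atom = some a) {ti tj : Tm Var Arr} (hi : Shared ti)
    (hj : Shared tj) : Local a (.put r ti tj) :=
  ⟨⟨hi.usesIn a, hj.usesIn a⟩, fun r' h => by obtain rfl : r' = r := h; exact hr, fun _ h => h⟩

theorem usesIn_resIs {tj : Tm Var Arr} (hj : Shared tj) (k : ℕ) :
    (resIs a t tj k).UsesIn fun r => r.atom = none ∨ r.atom = some a :=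
  ⟨⟨Or.inr rfl, hj.usesIn a⟩, trivial⟩

theorem shared_reg (x : Var) : Shared (.reg x) := trivial
theorem shared_arg : Shared arg := ⟨rfl, trivial⟩
theorem shared_op1 : Shared op1 := ⟨rfl, trivial⟩
theorem shared_op2 : Shared op2 := ⟨rfl, trivial⟩
theorem shared_op3 : Shared op3 := ⟨rfl, trivial⟩
theorem shared_sid : Shared (.get .sid (.reg .i)) := ⟨rfl, trivial⟩

/-- All writes to arrays go to the position that is in the register `x`. -/
def _root_.GKAT.Cmd.PutsAt {V A : Type} (x : V) : Cmd V A → Prop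
  | .skip => True
  | .set _ _ => True
  | .put _ i _ => i = .reg x
  | .seq c d => c.PutsAt x ∧ d.PutsAt x
  | .ite _ c d => c.PutsAt x ∧ d.PutsAt x
  | .loop _ c => c.PutsAt x

theorem _root_.GKAT.Cmd.run_arr_of_putsAt {V A : Type} [DecidableEq V] [DecidableEq A] {x : V}
    {c : Cmd V A} (h : c.PutsAt x) (hx : ¬ c.WritesReg x) (s : Mem V A) {j : ℕ}
    (hj : j ≠ s.reg x) (r : A) : (c.run s).arr r j = s.arr r j := by
  induction c generalizing s with
  | skip => rfl
  | set => rfl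
  | put b i t =>
    obtain rfl : i = .reg x := h
    simp [Cmd.run, Tm.eval, hj]
  | seq c d ihc ihd =>
    simp only [Cmd.WritesReg, not_or] at hx
    rw [Cmd.run, ihd h.2 hx.2 _ (by rwa [Cmd.run_reg_of_not_writes hx.1]), ihc h.1 hx.1 _ hj]
  | ite b c d ihc ihd =>
    simp only [Cmd.WritesReg, not_or] at hx
    simp only [Cmd.run]
    split_ifs
    exacts [ihc h.1 hx.1 _ hj, ihd h.2 hx.2 _ hj]
  | loop => rfl

theorem block_putsAt (cs : List Prog) (x : Var) :
    (block cs).PutsAt x ↔ ∀ c ∈ cs, c.PutsAt x := by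
  induction cs with
  | nil => simp [block, Cmd.PutsAt]
  | cons c cs ih =>
    cases cs with
    | nil => simp [block]
    | cons d ds => simp only [block, Cmd.PutsAt, ih]; simp

theorem switch_putsAt (t : Tm Var Arr) (cs : List (ℕ × Prog)) (x : Var) :
    (switch t cs).PutsAt x ↔ ∀ c ∈ cs, c.2.PutsAt x := by
  induction cs with
  | nil => simp [switch, Cmd.PutsAt]
  | cons c cs ih => simp [switch, Cmd.PutsAt, ih]

/-- If a round writes only at the position of the counter, results for nodes outside the interval
that is being visited persist. This carries the rows of the operands to the round of their parent.
-/
theorem roundUp_iterate_arr_outside {v : Var} {c : Prog} (h : c.PutsAt v) (hv : ¬ c.WritesReg v)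
    (k : ℕ) (s : Mem Var Arr) {j : ℕ} (hj : j < s.reg v ∨ s.reg v + k ≤ j) (r : Arr) :
    ((roundUp v c)^[k] s).arr r j = s.arr r j := by
  induction k with
  | zero => rfl
  | succ k ih =>
    have hc := roundUp_iterate_counter (v := v) (c := c) k s
    rw [Function.iterate_succ_apply', roundUp, Mem.set_arr,
      Cmd.run_arr_of_putsAt h hv _ (by rw [hc]; omega), ih (by omega)]

/-- The body of the loop of `pseudostates`. -/
def iniBody (m : ℕ) : Prog := switch tok [
    (kFls, forAtoms m fun a => .put (.res .ini a) (.reg .i) (.lit 0)),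
    (kTru, forAtoms m fun a => .put (.res .ini a) (.reg .i) (.lit 1)),
    (kTest, forAtoms m fun a => switch arg ((List.range m).map fun j =>
      (j, .put (.res .ini a) (.reg .i) (.lit (if a.testBit j then 1 else 0))))),
    (kAnd, forAtoms m fun a =>
      .ite (.and (resIs a .ini op1 1) (resIs a .ini op2 1))
        (.put (.res .ini a) (.reg .i) (.lit 1))
        (.put (.res .ini a) (.reg .i) (.lit 0))),
    (kOr, forAtoms m fun a =>
      .ite (.and (resIs a .ini op1 0) (resIs a .ini op2 0))
        (.put (.res .ini a) (.reg .i) (.lit 0))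
        (.put (.res .ini a) (.reg .i) (.lit 1))),
    (kNot, forAtoms m fun a =>
      .ite (resIs a .ini op1 1)
        (.put (.res .ini a) (.reg .i) (.lit 0))
        (.put (.res .ini a) (.reg .i) (.lit 1))),
    (kAct, block [
      .put .sid (.reg .i) (.reg .states),
      .set .states (.succ (.reg .states)),
      forAtoms m fun a => block [
        .put (.res .ini a) (.reg .i) (.lit 2),
        .put (.act .ini a) (.reg .i) arg,
        .put (.tgt .ini a) (.reg .i) (.get .sid (.reg .i))]]),
    (kSeq, forAtoms m fun a =>
      .ite (resIs a .ini op1 1) (copy a .ini (.reg .i) .ini op2) (copy a .ini (.reg .i) .ini op1)),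
    (kIte, forAtoms m fun a =>
      .ite (resIs a .ini op1 1) (copy a .ini (.reg .i) .ini op2) (copy a .ini (.reg .i) .ini op3)),
    (kLoop, forAtoms m fun a =>
      .ite (resIs a .ini op1 0) (.put (.res .ini a) (.reg .i) (.lit 1))
        (.ite (resIs a .ini op2 1) (.put (.res .ini a) (.reg .i) (.lit 0))
          (copy a .ini (.reg .i) .ini op2)))]

theorem iniBody_loopFree (m : ℕ) : (iniBody m).LoopFree := by
  simp [iniBody, switch_loopFree, forAtoms_loopFree, block_loopFree, Cmd.LoopFree, copy]

theorem iniBody_putsAt (m : ℕ) : (iniBody m).PutsAt .i := by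
  simp [iniBody, switch_putsAt, forAtoms, block_putsAt, Cmd.PutsAt, copy]

theorem iniBody_writesReg {m : ℕ} {x : Var} (hx : x ≠ .states) : ¬ (iniBody m).WritesReg x := by
  simp [iniBody, switch_writesReg, forAtoms, block_writesReg, Cmd.WritesReg, copy, hx]

theorem iniBody_writesArr {m : ℕ} {r : Arr} (hr : (iniBody m).WritesArr r) :
    r = .sid ∨ ∃ a, r = .res .ini a ∨ r = .act .ini a ∨ r = .tgt .ini a := by
  simp only [iniBody, switch_writesArr, forAtoms, copy] at hr
  simp [Cmd.WritesArr, block_writesArr, switch_writesArr] at hr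
  grind

theorem iniBody_writesArr_of_isTree {m : ℕ} {r : Arr} (hr : r.IsTree) :
    ¬ (iniBody m).WritesArr r := fun h => by
  have := iniBody_writesArr h
  rcases hr with rfl | rfl | rfl | rfl | rfl <;> simp at this

/-- One round of the loop of `pseudostates`. -/
abbrev iniRound (m : ℕ) : Mem Var Arr → Mem Var Arr := roundUp .i (iniBody m)

theorem iniRound_i (m k : ℕ) (s : Mem Var Arr) : ((iniRound m)^[k] s).reg .i = s.reg .i + k :=
  roundUp_iterate_counter k s

theorem iniRound_sameTree (m k : ℕ) (s : Mem Var Arr) (o n : ℕ) :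
    SameTree s ((iniRound m)^[k] s) o n := fun r hr j _ _ => by
  rw [roundUp_iterate_arr (iniBody_writesArr_of_isTree hr)]

theorem iniRound_tree (m k : ℕ) (s : Mem Var Arr) {r : Arr} (hr : r.IsTree) :
    ((iniRound m)^[k] s).arr r = s.arr r :=
  roundUp_iterate_arr (iniBody_writesArr_of_isTree hr) k s

theorem iniRound_outside (m k : ℕ) (s : Mem Var Arr) {j : ℕ}
    (hj : j < s.reg .i ∨ s.reg .i + k ≤ j) (r : Arr) : ((iniRound m)^[k] s).arr r j = s.arr r j :=
  roundUp_iterate_arr_outside (iniBody_putsAt m) (iniBody_writesReg (by simp)) k s hj r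

/-- Rounds of the loop that do not visit row `j` do not change it. -/
theorem _root_.GKAT.HoldsRow.iniRound {r : Row T P} (h : HoldsRow m τ code s t j r) {k : ℕ}
    (hj : j < s.reg .i ∨ s.reg .i + k ≤ j) :
    HoldsRow m τ code ((iniRound m)^[k] s) t j r :=
  h.congr fun _ _ => iniRound_outside m k s hj _

/-- The pattern for every symbol except actions: once the switch is resolved, what remains is a
claim about a single atom. No new state is allotted. -/
theorem iniRound_of_tok {f : ℕ → Prog} (hf : ∀ a, Local a (f a))
    (hrun : (iniBody m).run s = (forAtoms m f).run s) {r : Row T P}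
    (h : ∀ a < 2 ^ m, Holds code ((f a).run s) .ini a (s.reg .i) (r (atomOf τ a))) :
    HoldsRow m τ code (iniRound m s) .ini (s.reg .i) r ∧
      (iniRound m s).reg .states = s.reg .states := by
  have h₁ := holdsRow_forAtoms hf h
  have h₂ := (forAtoms_run_local (m := m) hf s).1
  simp only [iniRound, roundUp, hrun]
  exact ⟨h₁, by simp [h₂]⟩

end Prog

open Prog

theorem BExp.Layout.ini {b : BExp T} {s : Mem Var Arr} {o : ℕ} (hτ : ∀ t, τ t < m)
    (hb : b.Layout τ s o) (hi : s.reg .i = o) :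
    HoldsRow m τ code ((iniRound m)^[b.size] s) .ini (o + b.size - 1) b.row ∧
      ((iniRound m)^[b.size] s).reg .states = s.reg .states := by
  induction b generalizing s o with
  | fls =>
    subst hi
    refine iniRound_of_tok (f := fun a => .put (.res .ini a) (.reg .i) (.lit 0))
      (fun a => local_put rfl trivial trivial) ?_ ?_
    · simp [iniBody, switch, Cmd.run, Cnd.eval_eq_iff, Tm.eval, tok, show _ = _ from hb]
    · intro a _
      simp [BExp.row, BExp.eval, Holds, Cmd.run, Tm.eval]
  | tru =>
    subst hi
    refine iniRound_of_tok (f := fun a => .put (.res .ini a) (.reg .i) (.lit 1))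
      (fun a => local_put rfl trivial trivial) ?_ ?_
    · simp [iniBody, switch, Cmd.run, Cnd.eval_eq_iff, Tm.eval, tok, show _ = _ from hb, kFls, kTru]
    · intro a _
      simp [BExp.row, BExp.eval, Holds, Cmd.run, Tm.eval]
  | test x =>
    subst hi
    obtain ⟨hb, ha⟩ := hb
    refine iniRound_of_tok (f := fun a => switch arg ((List.range m).map fun j =>
      (j, .put (.res .ini a) (.reg .i) (.lit (if a.testBit j then 1 else 0)))))
      (fun a => local_switch shared_arg fun c hc => ?_) ?_ ?_
    · simp only [List.mem_map] at hc
      obtain ⟨j, -, rfl⟩ := hc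
      exact local_put rfl trivial trivial
    · simp [iniBody, switch, Cmd.run, Cnd.eval_eq_iff, Tm.eval, tok, hb, kFls, kTru, kTest]
    · intro a _
      have harg : arg.eval s = τ x := ha
      -- The numbering must take values below `m` here, because the unrolled switch has a case only
      -- for each `j < m`.
      rw [switch_map_run _ (fun j => .put (.res .ini a) (.reg .i)
        (.lit (if a.testBit j then 1 else 0))) _ _ (by rw [harg]; simpa using hτ x), harg]
      simp only [BExp.row, BExp.eval, atomOf]
      cases hx : a.testBit (τ x) <;> simp [Holds, Cmd.run, Tm.eval]
  | and b c ihb ihc =>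
    obtain ⟨lb, lc, k₁, k₂, k₃⟩ := hb
    have hbp := b.size_pos
    have hcp := c.size_pos
    obtain ⟨rb, sb⟩ := ihb lb hi
    have hi₁ := iniRound_i m b.size s
    set s₁ := (iniRound m)^[b.size] s with e₁
    obtain ⟨rc, sc⟩ := ihc (lc.congr (iniRound_sameTree m _ s _ _)) (hi₁.trans (by rw [hi]))
    have rb' := rb.iniRound (k := c.size) (by omega)
    have hi₂ := iniRound_i m c.size s₁
    set s₂ := (iniRound m)^[c.size] s₁ with e₂
    have e : (iniRound m)^[(b.and c).size] s = iniRound m s₂ := by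
      rw [e₂, e₁, ← Function.iterate_add_apply, ← Function.iterate_succ_apply' (iniRound m)]
      congr 1; simp only [BExp.size]; omega
    have hsyn : ∀ r : Arr, r.IsTree → s₂.arr r = s.arr r := fun r hr => by
      rw [e₂, e₁, iniRound_tree _ _ _ hr, iniRound_tree _ _ _ hr]
    have hi₃ : s₂.reg .i = o + b.size + c.size := by omega
    rw [← hsyn _ (by simp [Arr.IsTree]), ← hi₃] at k₁ k₂ k₃
    rw [e, show o + (b.and c).size - 1 = s₂.reg .i by simp only [BExp.size]; omega, ← sb, ← sc]
    refine iniRound_of_tok (f := fun a => .ite (.and (resIs a .ini op1 1) (resIs a .ini op2 1))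
        (.put (.res .ini a) (.reg .i) (.lit 1))
        (.put (.res .ini a) (.reg .i) (.lit 0)))
      (fun a => local_ite ⟨usesIn_resIs shared_op1 _, usesIn_resIs shared_op2 _⟩
        (local_put rfl trivial trivial) (local_put rfl trivial trivial)) ?_ ?_
    · simp [iniBody, switch, Cmd.run, Cnd.eval_eq_iff, Tm.eval, tok, k₁, kFls, kTru, kTest, kAnd]
    · intro a ha
      have h₁ := rb' a ha
      have h₂ := rc a ha
      rw [← hi₃] at h₂
      simp only [BExp.row, BExp.eval] at h₁ h₂ ⊢
      cases hb : b.eval (atomOf τ a) <;> cases hc : c.eval (atomOf τ a) <;>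
        simp [hb, Holds] at h₁ <;> simp [hc, Holds] at h₂ <;>
        simp [Holds, Cmd.run, Tm.eval, resIs, Cnd.eval_and_iff, Cnd.eval_eq_iff, op1, op2, k₂, k₃,
          h₁, h₂]
  | or b c ihb ihc =>
    obtain ⟨lb, lc, k₁, k₂, k₃⟩ := hb
    have hbp := b.size_pos
    have hcp := c.size_pos
    obtain ⟨rb, sb⟩ := ihb lb hi
    have hi₁ := iniRound_i m b.size s
    set s₁ := (iniRound m)^[b.size] s with e₁
    obtain ⟨rc, sc⟩ := ihc (lc.congr (iniRound_sameTree m _ s _ _)) (hi₁.trans (by rw [hi]))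
    have rb' := rb.iniRound (k := c.size) (by omega)
    have hi₂ := iniRound_i m c.size s₁
    set s₂ := (iniRound m)^[c.size] s₁ with e₂
    have e : (iniRound m)^[(b.or c).size] s = iniRound m s₂ := by
      rw [e₂, e₁, ← Function.iterate_add_apply, ← Function.iterate_succ_apply' (iniRound m)]
      congr 1; simp only [BExp.size]; omega
    have hsyn : ∀ r : Arr, r.IsTree → s₂.arr r = s.arr r := fun r hr => by
      rw [e₂, e₁, iniRound_tree _ _ _ hr, iniRound_tree _ _ _ hr]
    have hi₃ : s₂.reg .i = o + b.size + c.size := by omega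
    rw [← hsyn _ (by simp [Arr.IsTree]), ← hi₃] at k₁ k₂ k₃
    rw [e, show o + (b.or c).size - 1 = s₂.reg .i by simp only [BExp.size]; omega, ← sb, ← sc]
    refine iniRound_of_tok (f := fun a => .ite (.and (resIs a .ini op1 0) (resIs a .ini op2 0))
        (.put (.res .ini a) (.reg .i) (.lit 0))
        (.put (.res .ini a) (.reg .i) (.lit 1)))
      (fun a => local_ite ⟨usesIn_resIs shared_op1 _, usesIn_resIs shared_op2 _⟩
        (local_put rfl trivial trivial) (local_put rfl trivial trivial)) ?_ ?_
    · simp [iniBody, switch, Cmd.run, Cnd.eval_eq_iff, Tm.eval, tok, k₁, kFls, kTru, kTest, kAnd,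
        kOr]
    · intro a ha
      have h₁ := rb' a ha
      have h₂ := rc a ha
      rw [← hi₃] at h₂
      simp only [BExp.row, BExp.eval] at h₁ h₂ ⊢
      cases hb : b.eval (atomOf τ a) <;> cases hc : c.eval (atomOf τ a) <;>
        simp [hb, Holds] at h₁ <;> simp [hc, Holds] at h₂ <;>
        simp [Holds, Cmd.run, Tm.eval, resIs, Cnd.eval_and_iff, Cnd.eval_eq_iff, op1, op2, k₂, k₃,
          h₁, h₂]
  | not b ihb =>
    obtain ⟨lb, k₁, k₂⟩ := hb
    have hbp := b.size_pos
    obtain ⟨rb, sb⟩ := ihb lb hi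
    have hi₁ := iniRound_i m b.size s
    set s₁ := (iniRound m)^[b.size] s with e₁
    have e : (iniRound m)^[b.not.size] s = iniRound m s₁ := by
      rw [e₁, BExp.size, Function.iterate_succ_apply' (iniRound m)]
    have hsyn : ∀ r : Arr, r.IsTree → s₁.arr r = s.arr r := fun r hr => by
      rw [e₁, iniRound_tree _ _ _ hr]
    have hi₃ : s₁.reg .i = o + b.size := by omega
    rw [← hsyn _ (by simp [Arr.IsTree]), ← hi₃] at k₁ k₂
    rw [e, show o + b.not.size - 1 = s₁.reg .i by simp only [BExp.size]; omega, ← sb]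
    refine iniRound_of_tok (f := fun a => .ite (resIs a .ini op1 1)
        (.put (.res .ini a) (.reg .i) (.lit 0))
        (.put (.res .ini a) (.reg .i) (.lit 1)))
      (fun a => local_ite (usesIn_resIs shared_op1 _)
        (local_put rfl trivial trivial) (local_put rfl trivial trivial)) ?_ ?_
    · simp [iniBody, switch, Cmd.run, Cnd.eval_eq_iff, Tm.eval, tok, k₁, kFls, kTru, kTest, kAnd,
        kOr, kNot]
    · intro a ha
      have h₁ := rb a ha
      rw [← hi₃] at h₁
      simp only [BExp.row, BExp.eval] at h₁ ⊢
      cases hb : b.eval (atomOf τ a) <;>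
        simp [hb, Holds] at h₁ <;>
        simp [Holds, Cmd.run, Tm.eval, resIs, Cnd.eval_eq_iff, op1, k₂, h₁]

end Pseudostates

end GKAT

namespace GKAT

/-! ### Initial pseudostates of expressions -/

section Pseudostates

variable {T P : Type*} {m : ℕ} {τ : T → ℕ} {code : P → ℕ} {s s' : Mem Var Arr} {t u : Tbl}
  {a i j : ℕ}

open Prog

theorem Entry.andThen_of_ne_acc {v : Entry P} (hv : v ≠ .acc) (w : Entry P) : v.andThen w = v := by
  cases v <;> simp_all [Entry.andThen]

theorem Entry.loopBody_of_ne_acc {v : Entry P} (hv : v ≠ .acc) : v.loopBody = v := by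
  cases v <;> simp_all [Entry.loopBody]

theorem resIs_one_iff {tj : Tm Var Arr} {v : Entry P} (h : Holds code s t a (tj.eval s) v) :
    (resIs a t tj 1).eval s = true ↔ v = .acc := by
  rw [resIs, Cnd.eval_eq_iff]
  cases v <;> simp_all [Holds, Tm.eval]

theorem resIs_zero_iff {tj : Tm Var Arr} {v : Entry P} (h : Holds code s t a (tj.eval s) v) :
    (resIs a t tj 0).eval s = true ↔ v = .rej := by
  rw [resIs, Cnd.eval_eq_iff]
  cases v <;> simp_all [Holds, Tm.eval]

theorem resIs_two_iff {tj : Tm Var Arr} {v : Entry P} (h : Holds code s t a (tj.eval s) v) :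
    (resIs a t tj 2).eval s = true ↔ ∃ p x, v = .step p x := by
  rw [resIs, Cnd.eval_eq_iff]
  cases v <;> simp_all [Holds, Tm.eval]

/-- The arrays that hold the initial pseudostates. -/
def Arr.IsIni (r : Arr) : Prop :=
  r = .sid ∨ ∃ a, r = .res .ini a ∨ r = .act .ini a ∨ r = .tgt .ini a

/-- The initial pseudostates of all subexpressions of `e` have been computed; the nodes of `e` start
at `o`, and its states at `q`. -/
def Exp.IniOk (m : ℕ) (τ : T → ℕ) (code : P → ℕ) (s : Mem Var Arr) : Exp T P → ℕ → ℕ → Prop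
  | .act p, o, q => HoldsRow m τ code s .ini o ((Exp.act p).ini q) ∧ s.arr .sid o = q
  | .assert b, o, q => HoldsRow m τ code s .ini (o + b.size - 1) ((Exp.assert b).ini q)
  | .seq e f, o, q => e.IniOk m τ code s o q ∧ f.IniOk m τ code s (o + e.size) (q + e.acts) ∧
    HoldsRow m τ code s .ini (o + e.size + f.size) ((Exp.seq e f).ini q)
  -- The row of the test is not recorded: it is consulted only while the row of this node is
  -- computed, and never in the top-down pass.
  | .ite b e f, o, q => e.IniOk m τ code s (o + b.size) q ∧
    f.IniOk m τ code s (o + b.size + e.size) (q + e.acts) ∧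
    HoldsRow m τ code s .ini (o + b.size + e.size + f.size) ((Exp.ite b e f).ini q)
  | .loop b e, o, q => e.IniOk m τ code s (o + b.size) q ∧
    HoldsRow m τ code s .ini (o + b.size + e.size) ((Exp.loop b e).ini q)

theorem HoldsRow.congr_ini {r : Row T P} (h : HoldsRow m τ code s .ini j r)
    (h' : ∀ r : Arr, r.IsIni → s'.arr r j = s.arr r j) : HoldsRow m τ code s' .ini j r :=
  fun a ha => (h a ha).congr (h' _ (by simp [Arr.IsIni])) (h' _ (by simp [Arr.IsIni]))
    (h' _ (by simp [Arr.IsIni]))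

theorem Exp.IniOk.congr {e : Exp T P} {o q : ℕ} (he : e.IniOk m τ code s o q)
    (h : ∀ r : Arr, r.IsIni → ∀ j, o ≤ j → j < o + e.size → s'.arr r j = s.arr r j) :
    e.IniOk m τ code s' o q := by
  induction e generalizing o q with
  | act p =>
    exact ⟨he.1.congr_ini fun r hr => h r hr _ le_rfl (by simp [Exp.size]),
      (h _ (Or.inl rfl) _ le_rfl (by simp [Exp.size])).trans he.2⟩
  | assert b =>
    have := b.size_pos
    exact HoldsRow.congr_ini he fun r hr => h r hr _ (by omega) (by simp only [Exp.size]; omega)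
  | seq e f ihe ihf =>
    simp only [Exp.size] at h
    exact ⟨ihe he.1 fun r hr j h₁ h₂ => h r hr j (by omega) (by omega),
      ihf he.2.1 fun r hr j h₁ h₂ => h r hr j (by omega) (by omega),
      he.2.2.congr_ini fun r hr => h r hr _ (by omega) (by omega)⟩
  | ite b e f ihe ihf =>
    simp only [Exp.size] at h
    exact ⟨ihe he.1 fun r hr j h₁ h₂ => h r hr j (by omega) (by omega),
      ihf he.2.1 fun r hr j h₁ h₂ => h r hr j (by omega) (by omega),
      he.2.2.congr_ini fun r hr => h r hr _ (by omega) (by omega)⟩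
  | loop b e ihe =>
    simp only [Exp.size] at h
    exact ⟨ihe he.1 fun r hr j h₁ h₂ => h r hr j (by omega) (by omega),
      he.2.congr_ini fun r hr => h r hr _ (by omega) (by omega)⟩

theorem Exp.IniOk.row {e : Exp T P} {o q : ℕ} (he : e.IniOk m τ code s o q) :
    HoldsRow m τ code s .ini (o + e.size - 1) (e.ini q) := by
  cases e with
  | act p => exact he.1
  | assert b => exact he
  | seq e f =>
    rw [show o + (e.seq f).size - 1 = o + e.size + f.size by simp only [Exp.size]; omega]
    exact he.2.2
  | ite b e f =>
    rw [show o + (Exp.ite b e f).size - 1 = o + b.size + e.size + f.size by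
      simp only [Exp.size]; omega]
    exact he.2.2
  | loop b e =>
    rw [show o + (Exp.loop b e).size - 1 = o + b.size + e.size by simp only [Exp.size]; omega]
    exact he.2

theorem Exp.IniOk.iniRound {e : Exp T P} {o q k : ℕ} (he : e.IniOk m τ code s o q)
    (ho : o + e.size ≤ s.reg .i ∨ s.reg .i + k ≤ o) :
    e.IniOk m τ code ((iniRound m)^[k] s) o q :=
  he.congr fun r _ j _ _ => iniRound_outside m k s (by omega) r

/-- The register `states` holds `q` on entry to the interval of `e` and `q + e.acts` on exit, so the
machine numbers occurrences from left to right, just as `Exp.ini` does. -/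
theorem Exp.Layout.ini {e : Exp T P} {s : Mem Var Arr} {o q : ℕ} (hτ : ∀ t, τ t < m)
    (he : e.Layout τ code s o) (hi : s.reg .i = o) (hq : s.reg .states = q) :
    e.IniOk m τ code ((iniRound m)^[e.size] s) o q ∧
      ((iniRound m)^[e.size] s).reg .states = q + e.acts := by
  induction e generalizing s o q with
  | act p =>
    subst hi hq
    obtain ⟨k₁, k₂⟩ := he
    set f : ℕ → Prog := fun a => block [
        .put (.res .ini a) (.reg .i) (.lit 2),
        .put (.act .ini a) (.reg .i) arg,
        .put (.tgt .ini a) (.reg .i) (.get .sid (.reg .i))] with hf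
    -- The memory after the new state has been allotted. Only the rest of the round is a loop over
    -- atoms, so the common pattern `iniRound_of_tok` does not apply.
    set s₀ := (s.put .sid (s.reg .i) (s.reg .states)).set .states (s.reg .states + 1) with hs₀
    have hloc : ∀ a, Local a (f a) := fun a => by
      refine local_block fun c hc => ?_
      simp only [List.mem_cons, List.not_mem_nil, or_false] at hc
      rcases hc with rfl | rfl | rfl
      exacts [local_put rfl trivial trivial, local_put rfl trivial shared_arg,
        local_put rfl trivial shared_sid]
    have hrun : (iniBody m).run s = (forAtoms m f).run s₀ := by
      simp [iniBody, switch, Cmd.run, Cnd.eval_eq_iff, Tm.eval, tok, k₁, kFls, kTru, kTest, kAnd,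
        kOr, kNot, kAct, block, hf, hs₀]
    have h₂ := forAtoms_run_local (m := m) hloc s₀
    have h₁ : HoldsRow m τ code ((forAtoms m f).run s₀) .ini (s.reg .i)
        ((Exp.act p).ini (s.reg .states)) := by
      refine holdsRow_forAtoms hloc fun a _ => ?_
      simp [hf, hs₀, block, Cmd.run, Holds, Exp.ini, Tm.eval, arg, k₂]
    simp only [Exp.size, Function.iterate_one, roundUp, hrun]
    refine ⟨⟨h₁, ?_⟩, ?_⟩
    · rw [Mem.set_arr, h₂.2.1 .sid rfl]
      simp [hs₀]
    · rw [Mem.set_reg, if_neg (by simp), h₂.1]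
      simp [hs₀, Exp.acts]
  | assert b =>
    obtain ⟨h₁, h₂⟩ := BExp.Layout.ini (code := code) hτ he hi
    exact ⟨h₁, h₂.trans hq⟩
  | seq e f ihe ihf =>
    obtain ⟨lb, lc, k₁, k₂, k₃⟩ := he
    have hbp := e.size_pos
    have hcp := f.size_pos
    obtain ⟨rb, sb⟩ := ihe lb hi hq
    have hi₁ := iniRound_i m e.size s
    set s₁ := (iniRound m)^[e.size] s with e₁
    obtain ⟨rc, sc⟩ := ihf (lc.congr (iniRound_sameTree m _ s _ _)) (hi₁.trans (by rw [hi])) sb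
    have rb' := rb.iniRound (k := f.size) (by omega)
    have hi₂ := iniRound_i m f.size s₁
    set s₂ := (iniRound m)^[f.size] s₁ with e₂
    have e' : (iniRound m)^[(e.seq f).size] s = iniRound m s₂ := by
      rw [e₂, e₁, ← Function.iterate_add_apply, ← Function.iterate_succ_apply' (iniRound m)]
      congr 1; simp only [Exp.size]; omega
    have hsyn : ∀ r : Arr, r.IsTree → s₂.arr r = s.arr r := fun r hr => by
      rw [e₂, e₁, iniRound_tree _ _ _ hr, iniRound_tree _ _ _ hr]
    have hi₃ : s₂.reg .i = o + e.size + f.size := by omega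
    rw [← hsyn _ (by simp [Arr.IsTree]), ← hi₃] at k₁
    have ho₁ : op1.eval s₂ = o + e.size - 1 := by
      simp only [op1, Tm.eval]; rw [hi₃, hsyn _ (by simp [Arr.IsTree]), k₂]
    have ho₂ : op2.eval s₂ = o + e.size + f.size - 1 := by
      simp only [op2, Tm.eval]; rw [hi₃, hsyn _ (by simp [Arr.IsTree]), k₃]
    have key := iniRound_of_tok (m := m) (s := s₂) (τ := τ) (code := code)
      (f := fun a => .ite (resIs a .ini op1 1) (copy a .ini (.reg .i) .ini op2)
        (copy a .ini (.reg .i) .ini op1)) (r := (Exp.seq e f).ini q)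
      (fun a => local_ite (usesIn_resIs shared_op1 _)
        (local_copy trivial shared_op2) (local_copy trivial shared_op1))
      (by simp [iniBody, switch, Cmd.run, Cnd.eval_eq_iff, Tm.eval, tok, k₁, kFls, kTru, kTest,
            kAnd, kOr, kNot, kAct, kSeq])
      (fun a ha => by
        have h₁ := rb'.row a ha
        have h₂ := rc.row a ha
        rw [← ho₁] at h₁
        rw [← ho₂] at h₂
        simp only [Cmd.run]
        simp only [Exp.ini, Row.andThen]
        split_ifs with hv <;> rw [resIs_one_iff h₁] at hv
        · rw [hv]; exact holds_copy (shared_reg .i) shared_op2 h₂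
        · rw [Entry.andThen_of_ne_acc hv]
          exact holds_copy (shared_reg .i) shared_op1 h₁)
    rw [e']
    refine ⟨⟨rb'.iniRound (k := 1) (by omega), rc.iniRound (k := 1) (by omega), hi₃ ▸ key.1⟩, ?_⟩
    rw [key.2, sc, Exp.acts]; omega
  | ite b e f ihe ihf =>
    obtain ⟨lb, le, lf, k₁, k₂, k₃, k₄⟩ := he
    have hbp := b.size_pos
    have hep := e.size_pos
    have hfp := f.size_pos
    obtain ⟨rb, sb⟩ := BExp.Layout.ini (code := code) hτ lb hi
    have hi₁ := iniRound_i m b.size s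
    set s₁ := (iniRound m)^[b.size] s with e₁
    obtain ⟨re, se⟩ := ihe (le.congr (iniRound_sameTree m _ s _ _)) (hi₁.trans (by rw [hi]))
      (sb.trans hq)
    have rb' := rb.iniRound (k := e.size) (by omega)
    have hi₂ := iniRound_i m e.size s₁
    set s₂ := (iniRound m)^[e.size] s₁ with e₂
    obtain ⟨rf, sf⟩ := ihf ((lf.congr (iniRound_sameTree m _ s _ _)).congr
      (iniRound_sameTree m _ s₁ _ _)) (hi₂.trans (by rw [hi₁, hi])) se
    have rb'' := rb'.iniRound (k := f.size) (by omega)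
    have re' := re.iniRound (k := f.size) (by omega)
    have hi₃ := iniRound_i m f.size s₂
    set s₃ := (iniRound m)^[f.size] s₂ with e₃
    have e' : (iniRound m)^[(Exp.ite b e f).size] s = iniRound m s₃ := by
      rw [e₃, e₂, e₁, ← Function.iterate_add_apply, ← Function.iterate_add_apply,
        ← Function.iterate_succ_apply' (iniRound m)]
      congr 1; simp only [Exp.size]; omega
    have hsyn : ∀ r : Arr, r.IsTree → s₃.arr r = s.arr r := fun r hr => by
      rw [e₃, e₂, e₁, iniRound_tree _ _ _ hr, iniRound_tree _ _ _ hr, iniRound_tree _ _ _ hr]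
    have hi₃ : s₃.reg .i = o + b.size + e.size + f.size := by omega
    rw [← hsyn _ (by simp [Arr.IsTree]), ← hi₃] at k₁
    have ho₁ : op1.eval s₃ = o + b.size - 1 := by
      simp only [op1, Tm.eval]; rw [hi₃, hsyn _ (by simp [Arr.IsTree]), k₂]
    have ho₂ : op2.eval s₃ = o + b.size + e.size - 1 := by
      simp only [op2, Tm.eval]; rw [hi₃, hsyn _ (by simp [Arr.IsTree]), k₃]
    have ho₃ : op3.eval s₃ = o + b.size + e.size + f.size - 1 := by
      simp only [op3, Tm.eval]; rw [hi₃, hsyn _ (by simp [Arr.IsTree]), k₄]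
    have key := iniRound_of_tok (m := m) (s := s₃) (τ := τ) (code := code)
      (f := fun a => .ite (resIs a .ini op1 1) (copy a .ini (.reg .i) .ini op2)
        (copy a .ini (.reg .i) .ini op3)) (r := (Exp.ite b e f).ini q)
      (fun a => local_ite (usesIn_resIs shared_op1 _)
        (local_copy trivial shared_op2) (local_copy trivial shared_op3))
      (by simp [iniBody, switch, Cmd.run, Cnd.eval_eq_iff, Tm.eval, tok, k₁, kFls, kTru, kTest,
            kAnd, kOr, kNot, kAct, kSeq, kIte])
      (fun a ha => by
        have h₁ := rb'' a ha
        have h₂ := re'.row a ha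
        have h₃ := rf.row a ha
        rw [← ho₁] at h₁
        rw [← ho₂] at h₂
        rw [← ho₃] at h₃
        simp only [Cmd.run, Exp.ini]
        have hb := resIs_one_iff h₁
        cases hv : b.eval (atomOf τ a) <;> simp only [BExp.row, hv, cond_true, cond_false] at hb
        · rw [if_neg (by simp [hb]), if_neg (by simp)]
          exact holds_copy (shared_reg .i) shared_op3 h₃
        · rw [if_pos (by simp [hb]), if_pos rfl]
          exact holds_copy (shared_reg .i) shared_op2 h₂)
    rw [e']
    refine ⟨⟨re'.iniRound (k := 1) (by omega), rf.iniRound (k := 1) (by omega), hi₃ ▸ key.1⟩, ?_⟩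
    rw [key.2, sf, Exp.acts]; omega
  | loop b e ihe =>
    obtain ⟨lb, lc, k₁, k₂, k₃⟩ := he
    have hbp := b.size_pos
    have hcp := e.size_pos
    obtain ⟨rb, sb⟩ := BExp.Layout.ini (code := code) hτ lb hi
    have hi₁ := iniRound_i m b.size s
    set s₁ := (iniRound m)^[b.size] s with e₁
    obtain ⟨rc, sc⟩ := ihe (lc.congr (iniRound_sameTree m _ s _ _)) (hi₁.trans (by rw [hi]))
      (sb.trans hq)
    have rb' := rb.iniRound (k := e.size) (by omega)
    have hi₂ := iniRound_i m e.size s₁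
    set s₂ := (iniRound m)^[e.size] s₁ with e₂
    have e' : (iniRound m)^[(Exp.loop b e).size] s = iniRound m s₂ := by
      rw [e₂, e₁, ← Function.iterate_add_apply, ← Function.iterate_succ_apply' (iniRound m)]
      congr 1; simp only [Exp.size]; omega
    have hsyn : ∀ r : Arr, r.IsTree → s₂.arr r = s.arr r := fun r hr => by
      rw [e₂, e₁, iniRound_tree _ _ _ hr, iniRound_tree _ _ _ hr]
    have hi₃ : s₂.reg .i = o + b.size + e.size := by omega
    rw [← hsyn _ (by simp [Arr.IsTree]), ← hi₃] at k₁
    have ho₁ : op1.eval s₂ = o + b.size - 1 := by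
      simp only [op1, Tm.eval]; rw [hi₃, hsyn _ (by simp [Arr.IsTree]), k₂]
    have ho₂ : op2.eval s₂ = o + b.size + e.size - 1 := by
      simp only [op2, Tm.eval]; rw [hi₃, hsyn _ (by simp [Arr.IsTree]), k₃]
    have key := iniRound_of_tok (m := m) (s := s₂) (τ := τ) (code := code)
      (f := fun a => .ite (resIs a .ini op1 0) (.put (.res .ini a) (.reg .i) (.lit 1))
        (.ite (resIs a .ini op2 1) (.put (.res .ini a) (.reg .i) (.lit 0))
          (copy a .ini (.reg .i) .ini op2))) (r := (Exp.loop b e).ini q)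
      (fun a => local_ite (usesIn_resIs shared_op1 _) (local_put rfl trivial trivial)
        (local_ite (usesIn_resIs shared_op2 _) (local_put rfl trivial trivial)
          (local_copy trivial shared_op2)))
      (by simp [iniBody, switch, Cmd.run, Cnd.eval_eq_iff, Tm.eval, tok, k₁, kFls, kTru, kTest,
            kAnd, kOr, kNot, kAct, kSeq, kIte, kLoop])
      (fun a ha => by
        have h₁ := rb' a ha
        have h₂ := rc.row a ha
        rw [← ho₁] at h₁
        rw [← ho₂] at h₂
        simp only [Cmd.run, Exp.ini]
        have hb := resIs_zero_iff h₁
        cases hv : b.eval (atomOf τ a) <;> simp only [BExp.row, hv, cond_true, cond_false] at hb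
        · rw [if_pos (by simp [hb]), if_neg (by simp)]
          simp [Holds, Tm.eval]
        · rw [if_neg (by simp [hb]), if_pos rfl]
          split_ifs with hv <;> rw [resIs_one_iff h₂] at hv
          · simp [hv, Entry.loopBody, Holds, Tm.eval]
          · rw [Entry.loopBody_of_ne_acc hv]
            exact holds_copy (shared_reg .i) shared_op2 h₂)
    rw [e']
    refine ⟨⟨rc.iniRound (k := 1) (by omega), hi₃ ▸ key.1⟩, ?_⟩
    rw [key.2, sc, Exp.acts]

end Pseudostates

end GKAT

namespace GKAT

/-! ## Transitions -/

section Transitions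

variable {T P : Type*} {m : ℕ} {τ : T → ℕ} {code : P → ℕ} {s s' s'' : Mem Var Arr} {t u : Tbl}
  {a i j : ℕ}

/-- Row `j` of the table `t` is the same in both memories. -/
def SameRow (m : ℕ) (s s' : Mem Var Arr) (t : Tbl) (j : ℕ) : Prop :=
  ∀ a < 2 ^ m, s'.arr (.res t a) j = s.arr (.res t a) j ∧
    s'.arr (.act t a) j = s.arr (.act t a) j ∧ s'.arr (.tgt t a) j = s.arr (.tgt t a) j

theorem SameRow.trans (h : SameRow m s s' t j) (h' : SameRow m s' s'' t j) :
    SameRow m s s'' t j := fun a ha =>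
  ⟨(h' a ha).1.trans (h a ha).1, (h' a ha).2.1.trans (h a ha).2.1,
    (h' a ha).2.2.trans (h a ha).2.2⟩

theorem SameRow.of_arr_eq (h : ∀ r : Arr, s'.arr r = s.arr r) : SameRow m s s' t j :=
  fun a _ => ⟨by rw [h], by rw [h], by rw [h]⟩

theorem HoldsRow.of_sameRow {r : Row T P} (h : HoldsRow m τ code s t j r)
    (h' : SameRow m s s' t j) : HoldsRow m τ code s' t j r :=
  fun a ha => (h a ha).congr (h' a ha).1 (h' a ha).2.1 (h' a ha).2.2

namespace Prog

theorem sameRow_forAtoms {f : ℕ → Prog} (hf : ∀ a, Local a (f a))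
    (h : ∀ a < 2 ^ m, ((f a).run s).arr (.res t a) j = s.arr (.res t a) j ∧
      ((f a).run s).arr (.act t a) j = s.arr (.act t a) j ∧
      ((f a).run s).arr (.tgt t a) j = s.arr (.tgt t a) j) :
    SameRow m s ((forAtoms m f).run s) t j := fun a ha => by
  have := (forAtoms_run_local (m := m) hf s).2.2
  rw [this _ a rfl ha, this _ a rfl ha, this _ a rfl ha]
  exact h a ha

theorem eval_run_of_local {c : Prog} (hc : Local a c) {ti : Tm Var Arr} (hi : Shared ti)
    (s : Mem Var Arr) : ti.eval (c.run s) = ti.eval s := by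
  refine Tm.eval_congr (s := c.run s) (s' := s) ?_ (fun r hr => ?_) hi
  · funext x
    exact Cmd.run_reg_of_not_writes (hc.writesReg x) s
  · exact Cmd.run_arr_of_not_writes (fun h => by simp [hc.writesArr r h] at hr) s

theorem copy_arr_of_ne {ti tj : Tm Var Arr} (hi : Shared ti) (hj : Shared tj) {t' : Tbl}
    (h : t' ≠ t ∨ j ≠ ti.eval s) :
    ((copy a t ti u tj).run s).arr (.res t' a) j = s.arr (.res t' a) j ∧
      ((copy a t ti u tj).run s).arr (.act t' a) j = s.arr (.act t' a) j ∧
      ((copy a t ti u tj).run s).arr (.tgt t' a) j = s.arr (.tgt t' a) j := by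
  rw [copy_run hi hj]
  refine ⟨?_, ?_, ?_⟩ <;> simp <;> intro h₁ h₂ <;> simp_all

theorem holds_copy_of_ne {ti tj : Tm Var Arr} (hi : Shared ti) (hj : Shared tj) {t' : Tbl}
    (h : t' ≠ t ∨ j ≠ ti.eval s) {v : Entry P} (hv : Holds code s t' a j v) :
    Holds code ((copy a t ti u tj).run s) t' a j v := by
  obtain ⟨h₁, h₂, h₃⟩ := copy_arr_of_ne (a := a) (u := u) hi hj h
  exact hv.congr h₁ h₂ h₃

/-- The body of the loop of `transitions`. -/
def transBody (m : ℕ) : Prog := switch tok [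
    (kAct, forAtoms m fun a => copy a .delta (.get .sid (.reg .i)) .cont (.reg .i)),
    (kSeq, forAtoms m fun a => block [
      copy a .cont op2 .cont (.reg .i),
      .ite (resIs a .ini op2 1) (copy a .cont op1 .cont (.reg .i)) (copy a .cont op1 .ini op2)]),
    (kIte, forAtoms m fun a => block [
      copy a .cont op2 .cont (.reg .i),
      copy a .cont op3 .cont (.reg .i)]),
    (kLoop, forAtoms m fun a =>
      .ite (resIs a .ini (.reg .i) 1) (copy a .cont op2 .cont (.reg .i))
        (copy a .cont op2 .ini (.reg .i)))]

theorem transBody_loopFree (m : ℕ) : (transBody m).LoopFree := by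
  simp [transBody, switch_loopFree, forAtoms_loopFree, block_loopFree, Cmd.LoopFree, copy]

theorem transBody_writesReg {m : ℕ} {x : Var} : ¬ (transBody m).WritesReg x := by
  simp [transBody, switch_writesReg, forAtoms, block_writesReg, Cmd.WritesReg, copy]

theorem transBody_writesArr {m : ℕ} {r : Arr} (hr : (transBody m).WritesArr r) :
    ∃ a, r = .res .cont a ∨ r = .act .cont a ∨ r = .tgt .cont a ∨
      r = .res .delta a ∨ r = .act .delta a ∨ r = .tgt .delta a := by
  simp only [transBody, switch_writesArr, forAtoms, copy] at hr
  simp [Cmd.WritesArr, block_writesArr] at hr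
  grind

/-- One round of the loop of `transitions`. -/
abbrev transRound (m : ℕ) : Mem Var Arr → Mem Var Arr := roundDown .i (transBody m)

theorem transRound_i (m k : ℕ) (s : Mem Var Arr) : ((transRound m)^[k] s).reg .i = s.reg .i - k :=
  roundDown_iterate_counter transBody_writesReg k s

theorem transRound_tree (m k : ℕ) (s : Mem Var Arr) {r : Arr} (hr : r.IsTree) :
    ((transRound m)^[k] s).arr r = s.arr r := by
  refine roundDown_iterate_arr (fun h => ?_) k s
  have := transBody_writesArr h
  rcases hr with rfl | rfl | rfl | rfl | rfl <;> simp at this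

theorem transRound_ini (m k : ℕ) (s : Mem Var Arr) {r : Arr} (hr : r.IsIni) :
    ((transRound m)^[k] s).arr r = s.arr r := by
  refine roundDown_iterate_arr (fun h => ?_) k s
  have := transBody_writesArr h
  rcases hr with rfl | ⟨a, rfl | rfl | rfl⟩ <;> simp at this

theorem _root_.GKAT.Exp.Layout.after_transRounds {e : Exp T P} {o : ℕ} (h : e.Layout τ code s o) (k : ℕ) :
    e.Layout τ code ((transRound m)^[k] s) o :=
  h.congr fun _ hr j _ _ => congrFun (transRound_tree m k s hr) j

theorem _root_.GKAT.BExp.Layout.after_transRounds {b : BExp T} {o : ℕ} (h : b.Layout τ s o) (k : ℕ) :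
    b.Layout τ ((transRound m)^[k] s) o :=
  h.congr fun _ hr j _ _ => congrFun (transRound_tree m k s hr) j

theorem _root_.GKAT.Exp.IniOk.after_transRounds {e : Exp T P} {o q : ℕ} (h : e.IniOk m τ code s o q)
    (k : ℕ) : e.IniOk m τ code ((transRound m)^[k] s) o q :=
  h.congr fun _ hr j _ _ => congrFun (transRound_ini m k s hr) j

/-- The symbols in Boolean expressions are passed over. -/
theorem transRound_of_bool {o : ℕ} (k : ℕ) (s : Mem Var Arr) (hi : s.reg .i = o + k)
    (ht : ∀ j, o ≤ j → j < o + k → s.arr .tok j < kAct) (r : Arr) :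
    ((transRound m)^[k] s).arr r = s.arr r := by
  induction k generalizing s with
  | zero => rfl
  | succ k ih =>
    have hr : transRound m s = s.set .i (o + k) := by
      have := ht (o + k) (by omega) (by omega)
      simp only [kAct] at this
      have h₁ : s.arr .tok (o + k) ≠ 6 := by omega
      have h₂ : s.arr .tok (o + k) ≠ 7 := by omega
      have h₃ : s.arr .tok (o + k) ≠ 8 := by omega
      have h₄ : s.arr .tok (o + k) ≠ 9 := by omega
      simp [roundDown, transBody, switch, Cmd.run, Cnd.eval_eq_iff, Tm.eval, tok, hi,
        ← add_assoc, kAct, kSeq, kIte, kLoop, h₁, h₂, h₃, h₄]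
    rw [Function.iterate_succ_apply, hr, ih]
    · rfl
    · simp
    · intro j h₁ h₂
      exact ht j h₁ (by omega)

end Prog

open Prog

/-- The symbols are numbered so that the Boolean ones lie below `kAct`; one inequality then shows
that no case of the switch in `transBody` applies. -/
theorem BExp.Layout.tok_lt {b : BExp T} {o : ℕ} (h : b.Layout τ s o) :
    ∀ j, o ≤ j → j < o + b.size → s.arr .tok j < kAct := by
  have key : ∀ (b c : BExp T) (o k : ℕ), k < kAct →
      (∀ j, o ≤ j → j < o + b.size → s.arr .tok j < kAct) →
      (∀ j, o + b.size ≤ j → j < o + b.size + c.size → s.arr .tok j < kAct) →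
      s.arr .tok (o + b.size + c.size) = k →
      ∀ j, o ≤ j → j < o + (b.size + c.size + 1) → s.arr .tok j < kAct := by
    intro b c o k hk hb hc ht j h₁ h₂
    by_cases hj : j < o + b.size
    · exact hb j h₁ hj
    · by_cases hj' : j < o + b.size + c.size
      · exact hc j (by omega) hj'
      · obtain rfl : j = o + b.size + c.size := by omega
        rw [ht]; exact hk
  induction b generalizing o with
  | fls =>
    intro j h₁ h₂
    obtain rfl : j = o := by simp only [BExp.size] at h₂; omega
    rw [show s.arr .tok j = kFls from h]; decide
  | tru =>
    intro j h₁ h₂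
    obtain rfl : j = o := by simp only [BExp.size] at h₂; omega
    rw [show s.arr .tok j = kTru from h]; decide
  | test t =>
    intro j h₁ h₂
    obtain rfl : j = o := by simp only [BExp.size] at h₂; omega
    rw [show s.arr .tok j = kTest from h.1]; decide
  | and b c ihb ihc => exact key b c o kAnd (by decide) (ihb h.1) (ihc h.2.1) h.2.2.1
  | or b c ihb ihc => exact key b c o kOr (by decide) (ihb h.1) (ihc h.2.1) h.2.2.1
  | not b ihb =>
    intro j h₁ h₂
    by_cases hj : j < o + b.size
    · exact ihb h.1 j h₁ hj
    · obtain rfl : j = o + b.size := by simp only [BExp.size] at h₂; omega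
      rw [h.2.1]; decide

theorem BExp.Layout.trans {b : BExp T} {o : ℕ} (h : b.Layout τ s o)
    (hi : s.reg .i = o + b.size) (r : Arr) : ((transRound m)^[b.size] s).arr r = s.arr r :=
  transRound_of_bool _ s hi h.tok_lt r

/-- The rows of the states of `e`, which start at `q`, have been computed. -/
structure Exp.TransOk (m : ℕ) (τ : T → ℕ) (code : P → ℕ) (s s' : Mem Var Arr) (e : Exp T P)
    (o q : ℕ) (k : Row T P) : Prop where
  -- The `j + 1` includes the root of `e` among the unchanged nodes: the rounds inside `e` write
  -- continuations only for proper subexpressions.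
  cont : ∀ j, j < o ∨ o + e.size ≤ j + 1 → SameRow m s s' .cont j
  delta : ∀ x, x < q ∨ q + e.acts ≤ x → SameRow m s s' .delta x
  rows : ∀ x, q ≤ x → x < q + e.acts → HoldsRow m τ code s' .delta x (e.delta q k x)

/-- The top-down counterpart of the bottom-up pass. The round at the root turns its continuation `k`
into those of the operands, exactly as in the definition of `Exp.delta`; the remaining rounds visit
the operands from right to left. The states of the operands form disjoint intervals, so their rows
do not overwrite each other. -/
theorem Exp.Layout.trans {e : Exp T P} {s : Mem Var Arr} {o q : ℕ} {k : Row T P}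
    (he : e.Layout τ code s o) (hini : e.IniOk m τ code s o q) (hi : s.reg .i = o + e.size)
    (hk : HoldsRow m τ code s .cont (o + e.size - 1) k) :
    e.TransOk m τ code s ((transRound m)^[e.size] s) o q k := by
  induction e generalizing s o q k with
  | act p =>
    obtain ⟨k₁, k₂⟩ := he
    obtain ⟨h₁, hsid⟩ := hini
    simp only [Exp.size, Nat.add_sub_cancel] at hi hk
    set s₀ := s.set .i o with hs₀
    have hloc : ∀ a, Local a (copy a .delta (.get .sid (.reg .i)) .cont (.reg .i)) := fun a =>
      local_copy shared_sid (shared_reg .i)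
    have hrun : transRound m s =
        (forAtoms m fun a => copy a .delta (.get .sid (.reg .i)) .cont (.reg .i)).run s₀ := by
      simp [roundDown, transBody, switch, Cmd.run, Cnd.eval_eq_iff, Tm.eval, tok, hi, ← hs₀]
      simp [hs₀, k₁]
    have hev : (Tm.get Arr.sid (.reg .i)).eval s₀ = q := by simp [Tm.eval, hs₀, hsid]
    simp only [Exp.size, Function.iterate_one, hrun]
    refine ⟨fun j hj => ?_, fun x hx => ?_, fun x h₁ h₂ => ?_⟩
    · exact sameRow_forAtoms (s := s₀) hloc fun a _ =>
        copy_arr_of_ne shared_sid (shared_reg .i) (Or.inl (by simp))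
    · refine sameRow_forAtoms (s := s₀) hloc fun a _ =>
        copy_arr_of_ne shared_sid (shared_reg .i) (Or.inr ?_)
      rw [hev]; simp only [Exp.acts] at hx; omega
    · obtain rfl : x = q := by simp only [Exp.acts] at h₂; omega
      refine holdsRow_forAtoms hloc fun a ha => ?_
      have := holds_copy (t := .delta) shared_sid (shared_reg .i) (s := s₀)
        (show Holds code s₀ .cont a ((Tm.reg Var.i).eval s₀) (k (atomOf τ a)) by
          simp only [Tm.eval, hs₀, Mem.set_reg, if_true]; exact hk a ha)
      rwa [hev] at this
  | assert b =>
    have h : ∀ r, ((transRound m)^[b.size] s).arr r = s.arr r := BExp.Layout.trans he hi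
    refine ⟨fun j _ => SameRow.of_arr_eq h, fun x _ => SameRow.of_arr_eq h, fun x h₁ h₂ => ?_⟩
    simp only [Exp.acts] at h₂
    omega
  | seq e f ihe ihf =>
    obtain ⟨le, lf, k₁, k₂, k₃⟩ := he
    obtain ⟨ie, jf, ir⟩ := hini
    have hep := e.size_pos
    have hfp := f.size_pos
    simp only [Exp.size] at hi hk
    rw [show o + (e.size + f.size + 1) - 1 = o + e.size + f.size by omega] at hk
    set s₀ := s.set .i (o + e.size + f.size) with hs₀
    set g : ℕ → Prog := fun a => block [
      copy a .cont op2 .cont (.reg .i),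
      .ite (resIs a .ini op2 1) (copy a .cont op1 .cont (.reg .i)) (copy a .cont op1 .ini op2)]
      with hg
    have hloc : ∀ a, Local a (g a) := fun a => by
      refine local_block fun c hc => ?_
      simp only [List.mem_cons, List.not_mem_nil, or_false] at hc
      rcases hc with rfl | rfl
      exacts [local_copy shared_op2 (shared_reg .i), local_ite (usesIn_resIs shared_op2 _)
        (local_copy shared_op1 (shared_reg .i)) (local_copy shared_op1 shared_op2)]
    have hrun : transRound m s = (forAtoms m g).run s₀ := by
      simp [roundDown, transBody, switch, Cmd.run, Cnd.eval_eq_iff, Tm.eval, tok, hi, ← hs₀,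
        show o + (e.size + f.size + 1) - 1 = o + e.size + f.size by omega]
      simp [hs₀, k₁, kAct, kSeq, hg]
    have ho₁ : op1.eval s₀ = o + e.size - 1 := by simp [op1, Tm.eval, hs₀, k₂]
    have ho₂ : op2.eval s₀ = o + e.size + f.size - 1 := by simp [op2, Tm.eval, hs₀, k₃]
    -- the effect of the round on the entries for one atom
    have hone : ∀ a, ((resIs a .ini op2 1).eval ((copy a .cont op2 .cont (.reg .i)).run s₀) = true ∧
        (g a).run s₀ = (copy a .cont op1 .cont (.reg .i)).run
          ((copy a .cont op2 .cont (.reg .i)).run s₀)) ∨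
        (¬ (resIs a .ini op2 1).eval ((copy a .cont op2 .cont (.reg .i)).run s₀) = true ∧
        (g a).run s₀ = (copy a .cont op1 .ini op2).run
          ((copy a .cont op2 .cont (.reg .i)).run s₀)) := fun a => by
      by_cases h : (resIs a .ini op2 1).eval ((copy a .cont op2 .cont (.reg .i)).run s₀) = true
      · exact Or.inl ⟨h, by simp only [hg, block, Cmd.run, if_pos h]⟩
      · exact Or.inr ⟨h, by simp only [hg, block, Cmd.run, if_neg h]⟩
    have ho₁' : ∀ a, op1.eval ((copy a .cont op2 .cont (.reg .i)).run s₀) = o + e.size - 1 :=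
      fun a => (eval_run_of_local (local_copy (a := a) shared_op2 (shared_reg .i)) shared_op1 _).trans
        ho₁
    have ho₂' : ∀ a, op2.eval ((copy a .cont op2 .cont (.reg .i)).run s₀) =
        o + e.size + f.size - 1 :=
      fun a => (eval_run_of_local (local_copy (a := a) shared_op2 (shared_reg .i)) shared_op2 _).trans
        ho₂
    have hoi' : ∀ a, (Tm.reg Var.i).eval ((copy a .cont op2 .cont (.reg .i)).run s₀) =
        o + e.size + f.size :=
      fun a => (eval_run_of_local (local_copy (a := a) shared_op2 (shared_reg .i))
        (shared_reg .i) _).trans (by simp [Tm.eval, hs₀])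
    have hsame : ∀ t j, (t ≠ .cont ∨ (j ≠ o + e.size - 1 ∧ j ≠ o + e.size + f.size - 1)) →
        SameRow m s (transRound m s) t j := fun t j hj => by
      rw [hrun]
      refine sameRow_forAtoms (s := s₀) hloc fun a _ => ?_
      have h₁ := copy_arr_of_ne (s := s₀) (t := .cont) (u := .cont) (a := a) (j := j) (t' := t)
        shared_op2 (shared_reg .i) (by rw [ho₂]; tauto)
      rcases hone a with ⟨-, h⟩ | ⟨-, h⟩ <;> rw [h]
      · have h₂ := copy_arr_of_ne (s := (copy a .cont op2 .cont (.reg .i)).run s₀) (t := .cont)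
          (u := .cont) (a := a) (j := j) (t' := t) shared_op1 (shared_reg .i)
          (by rw [ho₁']; tauto)
        exact ⟨h₂.1.trans h₁.1, h₂.2.1.trans h₁.2.1, h₂.2.2.trans h₁.2.2⟩
      · have h₂ := copy_arr_of_ne (s := (copy a .cont op2 .cont (.reg .i)).run s₀) (t := .cont)
          (u := .ini) (a := a) (j := j) (t' := t) shared_op1 shared_op2
          (by rw [ho₁']; tauto)
        exact ⟨h₂.1.trans h₁.1, h₂.2.1.trans h₁.2.1, h₂.2.2.trans h₁.2.2⟩
    have hkf : HoldsRow m τ code (transRound m s) .cont (o + e.size + f.size - 1) k := by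
      rw [hrun]
      refine holdsRow_forAtoms hloc fun a ha => ?_
      have h₁ := holds_copy (t := .cont) shared_op2 (shared_reg .i) (s := s₀)
        (show Holds code s₀ .cont a ((Tm.reg Var.i).eval s₀) (k (atomOf τ a)) by
          simp only [Tm.eval, hs₀, Mem.set_reg, if_true]; exact hk a ha)
      rw [ho₂] at h₁
      rcases hone a with ⟨-, h⟩ | ⟨-, h⟩ <;> rw [h]
      · exact holds_copy_of_ne shared_op1 (shared_reg .i) (Or.inr (by rw [ho₁']; omega)) h₁
      · exact holds_copy_of_ne shared_op1 shared_op2 (Or.inr (by rw [ho₁']; omega)) h₁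
    have hke : HoldsRow m τ code (transRound m s) .cont (o + e.size - 1)
        (Row.andThen (f.ini (q + e.acts)) k) := by
      rw [hrun]
      refine holdsRow_forAtoms hloc fun a ha => ?_
      have h₀ : Holds code s₀ .cont a (o + e.size + f.size) (k (atomOf τ a)) := hk a ha
      have h₁ := holds_copy_of_ne (ti := op2) (tj := .reg .i) (t := .cont) (u := .cont) shared_op2
        (shared_reg .i) (Or.inr (by rw [ho₂]; omega)) h₀
      rw [← hoi' a] at h₁
      have h₂ : Holds code s₀ .ini a (o + e.size + f.size - 1)
        (f.ini (q + e.acts) (atomOf τ a)) := jf.row a ha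
      have h₃ := holds_copy_of_ne (ti := op2) (tj := .reg .i) (t := .cont) (u := .cont) shared_op2
        (shared_reg .i) (Or.inl (by simp)) h₂
      rw [← ho₂' a] at h₃
      simp only [Row.andThen]
      rcases hone a with ⟨hv, h⟩ | ⟨hv, h⟩ <;> rw [h] <;> rw [resIs_one_iff h₃] at hv
      · rw [hv]
        have := holds_copy (t := .cont) shared_op1 (shared_reg .i) h₁
        rwa [ho₁'] at this
      · rw [Entry.andThen_of_ne_acc hv]
        have := holds_copy (t := .cont) shared_op1 shared_op2 h₃
        rwa [ho₁'] at this
    have hi₁ := transRound_i m 1 s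
    have h₁ := ihf (lf.after_transRounds (m := m) 1) (jf.after_transRounds 1) (hi₁.trans (by omega)) hkf
    have hi₂ := transRound_i m f.size ((transRound m)^[1] s)
    -- The nodes of `f` come after those of `e`, so they are visited first. The continuation of `e`,
    -- written in the round of the root, survives this by `h₁.cont`.
    have h₂ := ihe ((le.after_transRounds (m := m) 1).after_transRounds (m := m) f.size)
      ((ie.after_transRounds 1).after_transRounds f.size)
      (hi₂.trans (by omega)) (hke.of_sameRow (h₁.cont _ (Or.inl (by omega))))
    rw [← Function.iterate_add_apply, ← Function.iterate_add_apply,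
      show e.size + (f.size + 1) = (e.seq f).size by simp only [Exp.size]; omega] at h₂
    refine ⟨fun j hj => ?_, fun x hx => ?_, fun x hx hx' => ?_⟩
    · simp only [Exp.size] at hj
      exact ((hsame _ _ (Or.inr (by omega))).trans (h₁.cont j (by omega))).trans
        (h₂.cont j (by omega))
    · simp only [Exp.acts] at hx
      exact ((hsame _ _ (Or.inl (by simp))).trans (h₁.delta x (by omega))).trans
        (h₂.delta x (by omega))
    · simp only [Exp.acts] at hx'
      simp only [Exp.delta]
      split_ifs with hlt
      · exact h₂.rows x hx hlt
      · exact (h₁.rows x (by omega) (by omega)).of_sameRow (h₂.delta x (by omega))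
  | ite b e f ihe ihf =>
    obtain ⟨lb, le, lf, k₁, k₂, k₃, k₄⟩ := he
    obtain ⟨ie, jf, ir⟩ := hini
    have hbp := b.size_pos
    have hep := e.size_pos
    have hfp := f.size_pos
    simp only [Exp.size] at hi hk
    rw [show o + (b.size + e.size + f.size + 1) - 1 = o + b.size + e.size + f.size by omega] at hk
    set s₀ := s.set .i (o + b.size + e.size + f.size) with hs₀
    set g : ℕ → Prog := fun a => block [
      copy a .cont op2 .cont (.reg .i), copy a .cont op3 .cont (.reg .i)] with hg
    have hloc : ∀ a, Local a (g a) := fun a => by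
      refine local_block fun c hc => ?_
      simp only [List.mem_cons, List.not_mem_nil, or_false] at hc
      rcases hc with rfl | rfl
      exacts [local_copy shared_op2 (shared_reg .i), local_copy shared_op3 (shared_reg .i)]
    have hrun : transRound m s = (forAtoms m g).run s₀ := by
      simp [roundDown, transBody, switch, Cmd.run, Cnd.eval_eq_iff, Tm.eval, tok, hi, ← hs₀,
        show o + (b.size + e.size + f.size + 1) - 1 = o + b.size + e.size + f.size by omega]
      simp [hs₀, k₁, kAct, kSeq, kIte, hg]
    have hone : ∀ a, (g a).run s₀ = (copy a .cont op3 .cont (.reg .i)).run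
        ((copy a .cont op2 .cont (.reg .i)).run s₀) := fun a => rfl
    have ho₂ : op2.eval s₀ = o + b.size + e.size - 1 := by simp [op2, Tm.eval, hs₀, k₃]
    have ho₃' : ∀ a, op3.eval ((copy a .cont op2 .cont (.reg .i)).run s₀) =
        o + b.size + e.size + f.size - 1 := fun a =>
      (eval_run_of_local (local_copy (a := a) shared_op2 (shared_reg .i)) shared_op3 _).trans
        (by simp [op3, Tm.eval, hs₀, k₄])
    have hoi' : ∀ a, (Tm.reg Var.i).eval ((copy a .cont op2 .cont (.reg .i)).run s₀) =
        o + b.size + e.size + f.size :=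
      fun a => (eval_run_of_local (local_copy (a := a) shared_op2 (shared_reg .i))
        (shared_reg .i) _).trans (by simp [Tm.eval, hs₀])
    have hsame : ∀ t j, (t ≠ .cont ∨ (j ≠ o + b.size + e.size - 1 ∧
        j ≠ o + b.size + e.size + f.size - 1)) → SameRow m s (transRound m s) t j := fun t j hj => by
      rw [hrun]
      refine sameRow_forAtoms (s := s₀) hloc fun a _ => ?_
      have h₁ := copy_arr_of_ne (s := s₀) (t := .cont) (u := .cont) (a := a) (j := j) (t' := t)
        shared_op2 (shared_reg .i) (by rw [ho₂]; tauto)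
      rw [hone]
      have h₂ := copy_arr_of_ne (s := (copy a .cont op2 .cont (.reg .i)).run s₀) (t := .cont)
        (u := .cont) (a := a) (j := j) (t' := t) shared_op3 (shared_reg .i)
        (by rw [ho₃']; tauto)
      exact ⟨h₂.1.trans h₁.1, h₂.2.1.trans h₁.2.1, h₂.2.2.trans h₁.2.2⟩
    have hke : HoldsRow m τ code (transRound m s) .cont (o + b.size + e.size - 1) k := by
      rw [hrun]
      refine holdsRow_forAtoms hloc fun a ha => ?_
      have h₁ := holds_copy (t := .cont) shared_op2 (shared_reg .i) (s := s₀)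
        (show Holds code s₀ .cont a ((Tm.reg Var.i).eval s₀) (k (atomOf τ a)) by
          simp only [Tm.eval, hs₀, Mem.set_reg, if_true]; exact hk a ha)
      rw [ho₂] at h₁
      rw [hone]
      exact holds_copy_of_ne shared_op3 (shared_reg .i) (Or.inr (by rw [ho₃']; omega)) h₁
    have hkf : HoldsRow m τ code (transRound m s) .cont (o + b.size + e.size + f.size - 1) k := by
      rw [hrun]
      refine holdsRow_forAtoms hloc fun a ha => ?_
      have h₀ : Holds code s₀ .cont a (o + b.size + e.size + f.size) (k (atomOf τ a)) := hk a ha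
      have h₁ := holds_copy_of_ne (ti := op2) (tj := .reg .i) (t := .cont) (u := .cont) shared_op2
        (shared_reg .i) (Or.inr (by rw [ho₂]; omega)) h₀
      rw [← hoi' a] at h₁
      rw [hone]
      have := holds_copy (t := .cont) shared_op3 (shared_reg .i) h₁
      rwa [ho₃'] at this
    have hi₁ := transRound_i m 1 s
    have h₁ := ihf (lf.after_transRounds (m := m) 1) (jf.after_transRounds 1) (hi₁.trans (by omega)) hkf
    have hi₂ := transRound_i m f.size ((transRound m)^[1] s)
    have h₂ := ihe ((le.after_transRounds (m := m) 1).after_transRounds (m := m) f.size)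
      ((ie.after_transRounds 1).after_transRounds f.size)
      (hi₂.trans (by omega)) (hke.of_sameRow (h₁.cont _ (Or.inl (by omega))))
    have hi₃ := transRound_i m e.size ((transRound m)^[f.size] ((transRound m)^[1] s))
    have h₃ := BExp.Layout.trans (m := m) (((lb.after_transRounds (m := m) 1).after_transRounds (m := m)
      f.size).after_transRounds (m := m) e.size) (hi₃.trans (by omega))
    have hfin : (transRound m)^[b.size] ((transRound m)^[e.size] ((transRound m)^[f.size]
        ((transRound m)^[1] s))) = (transRound m)^[(Exp.ite b e f).size] s := by
      rw [← Function.iterate_add_apply, ← Function.iterate_add_apply, ← Function.iterate_add_apply]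
      congr 1
    rw [hfin] at h₃
    refine ⟨fun j hj => ?_, fun x hx => ?_, fun x hx hx' => ?_⟩
    · simp only [Exp.size] at hj
      exact (((hsame _ _ (Or.inr (by omega))).trans (h₁.cont j (by omega))).trans
        (h₂.cont j (by omega))).trans (SameRow.of_arr_eq h₃)
    · simp only [Exp.acts] at hx
      exact (((hsame _ _ (Or.inl (by simp))).trans (h₁.delta x (by omega))).trans
        (h₂.delta x (by omega))).trans (SameRow.of_arr_eq h₃)
    · simp only [Exp.acts] at hx'
      simp only [Exp.delta]
      split_ifs with hlt
      · exact (h₂.rows x hx hlt).of_sameRow (SameRow.of_arr_eq h₃)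
      · exact ((h₁.rows x (by omega) (by omega)).of_sameRow (h₂.delta x (by omega))).of_sameRow
          (SameRow.of_arr_eq h₃)
  | loop b e ihe =>
    obtain ⟨lb, le, k₁, k₂, k₃⟩ := he
    obtain ⟨ie, ir⟩ := hini
    have hbp := b.size_pos
    have hep := e.size_pos
    simp only [Exp.size] at hi hk
    rw [show o + (b.size + e.size + 1) - 1 = o + b.size + e.size by omega] at hk
    set s₀ := s.set .i (o + b.size + e.size) with hs₀
    set g : ℕ → Prog := fun a => .ite (resIs a .ini (.reg .i) 1) (copy a .cont op2 .cont (.reg .i))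
        (copy a .cont op2 .ini (.reg .i)) with hg
    have hloc : ∀ a, Local a (g a) := fun a => local_ite (usesIn_resIs (shared_reg .i) _)
      (local_copy shared_op2 (shared_reg .i)) (local_copy shared_op2 (shared_reg .i))
    have hrun : transRound m s = (forAtoms m g).run s₀ := by
      simp [roundDown, transBody, switch, Cmd.run, Cnd.eval_eq_iff, Tm.eval, tok, hi, ← hs₀,
        show o + (b.size + e.size + 1) - 1 = o + b.size + e.size by omega]
      simp [hs₀, k₁, kAct, kSeq, kIte, kLoop, hg]
    have ho₂ : op2.eval s₀ = o + b.size + e.size - 1 := by simp [op2, Tm.eval, hs₀, k₃]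
    have hsame : ∀ t j, (t ≠ .cont ∨ j ≠ o + b.size + e.size - 1) →
        SameRow m s (transRound m s) t j := fun t j hj => by
      rw [hrun]
      refine sameRow_forAtoms (s := s₀) hloc fun a _ => ?_
      simp only [hg, Cmd.run]
      split_ifs
      · exact copy_arr_of_ne shared_op2 (shared_reg .i) (by rw [ho₂]; tauto)
      · exact copy_arr_of_ne shared_op2 (shared_reg .i) (by rw [ho₂]; tauto)
    have hke : HoldsRow m τ code (transRound m s) .cont (o + b.size + e.size - 1)
        (Row.andThen ((Exp.loop b e).ini q) k) := by
      rw [hrun]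
      refine holdsRow_forAtoms hloc fun a ha => ?_
      have h₁ : Holds code s₀ .cont a ((Tm.reg Var.i).eval s₀) (k (atomOf τ a)) := by
        simp only [Tm.eval, hs₀, Mem.set_reg, if_true]; exact hk a ha
      have h₂ : Holds code s₀ .ini a ((Tm.reg Var.i).eval s₀)
          ((Exp.loop b e).ini q (atomOf τ a)) := by
        simp only [Tm.eval, hs₀, Mem.set_reg, if_true]; exact ir a ha
      simp only [hg, Cmd.run, Row.andThen]
      split_ifs with hv <;> rw [resIs_one_iff h₂] at hv
      · rw [hv]
        have := holds_copy (t := .cont) shared_op2 (shared_reg .i) h₁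
        rwa [ho₂] at this
      · rw [Entry.andThen_of_ne_acc hv]
        have := holds_copy (t := .cont) shared_op2 (shared_reg .i) h₂
        rwa [ho₂] at this
    have hi₁ := transRound_i m 1 s
    have h₂ := ihe (le.after_transRounds (m := m) 1) (ie.after_transRounds 1) (hi₁.trans (by omega)) hke
    have hi₃ := transRound_i m e.size ((transRound m)^[1] s)
    have h₃ := BExp.Layout.trans (m := m) ((lb.after_transRounds (m := m) 1).after_transRounds (m := m) e.size)
      (hi₃.trans (by omega))
    have hfin : (transRound m)^[b.size] ((transRound m)^[e.size] ((transRound m)^[1] s)) =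
        (transRound m)^[(Exp.loop b e).size] s := by
      rw [← Function.iterate_add_apply, ← Function.iterate_add_apply]
      congr 1
    rw [hfin] at h₃
    refine ⟨fun j hj => ?_, fun x hx => ?_, fun x hx hx' => ?_⟩
    · simp only [Exp.size] at hj
      exact ((hsame _ _ (Or.inr (by omega))).trans (h₂.cont j (by omega))).trans
        (SameRow.of_arr_eq h₃)
    · simp only [Exp.acts] at hx
      exact ((hsame _ _ (Or.inl (by simp))).trans (h₂.delta x (by omega))).trans
        (SameRow.of_arr_eq h₃)
    · exact (h₂.rows x hx hx').of_sameRow (SameRow.of_arr_eq h₃)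

end Transitions

end GKAT

namespace GKAT

/-! ## The Thompson automata of two expressions -/

section Thompson

variable {T P : Type*} {m : ℕ} {τ : T → ℕ} {code : P → ℕ} {s s' : Mem Var Arr} {e₁ e₂ : Exp T P}

theorem Exp.acts_le_size (e : Exp T P) : e.acts ≤ e.size := by
  induction e with
  | act => simp [Exp.acts, Exp.size]
  | assert => simp [Exp.acts]
  | seq e f ihe ihf => simp only [Exp.acts, Exp.size]; omega
  | ite b e f ihe ihf => simp only [Exp.acts, Exp.size]; omega
  | loop b e ihe => simp only [Exp.acts, Exp.size]; omega

namespace Prog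

/-- The syntax trees of the two expressions, one after the other. -/
structure Trees (τ : T → ℕ) (code : P → ℕ) (s : Mem Var Arr) (e₁ e₂ : Exp T P) : Prop where
  n : s.reg .n = e₁.size + e₂.size
  root1 : s.reg .root1 = e₁.size - 1
  root2 : s.reg .root2 = e₁.size + e₂.size - 1
  left : e₁.Layout τ code s 0
  right : e₂.Layout τ code s e₁.size

theorem Trees.congr (h : Trees τ code s e₁ e₂) (hr : ∀ r : Arr, r.IsTree → s'.arr r = s.arr r)
    (hn : s'.reg .n = s.reg .n) (h₁ : s'.reg .root1 = s.reg .root1)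
    (h₂ : s'.reg .root2 = s.reg .root2) : Trees τ code s' e₁ e₂ :=
  ⟨hn.trans h.n, h₁.trans h.root1, h₂.trans h.root2,
    h.left.congr fun r h' j _ _ => congrFun (hr r h') j,
    h.right.congr fun r h' j _ _ => congrFun (hr r h') j⟩

theorem parseBody_loopFree : parseBody.LoopFree := by
  simp [parseBody, switch, block, pop, Cmd.LoopFree]

theorem parseBody_writesReg {x : Var} (hx : x ≠ .sp) : ¬ parseBody.WritesReg x := by
  simp [parseBody, switch, block, pop, Cmd.WritesReg, hx]

theorem parse_runs (hn : s.reg .n = e₁.size + e₂.size)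
    (hs : Stored s (e₁.symbols τ code ++ e₂.symbols τ code) 0) :
    Runs parse s ((parseBody.bound + 6) * (e₁.size + e₂.size) + 20)
      fun s' => Trees τ code s' e₁ e₂ := by
  have h₁ : Runs (.set .sp (.lit 0)) s 2 (· = s.set .sp 0) := ⟨_, _, .set _ _ _, le_rfl, rfl⟩
  refine (h₁.seq (t₂ := (parseBody.bound + 6) * (e₁.size + e₂.size) + 18) ?_).mono (by omega)
    fun _ h => h
  rintro _ rfl
  rw [stored_append, Exp.length_symbols] at hs
  obtain ⟨p₁, l₁⟩ := Exp.parse e₁ (s := (s.set .sp 0).set .i 0) (hs.1.congr rfl rfl)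
    (o := 0) (d := 0) (by simp) (by simp)
  obtain ⟨p₂, l₂⟩ := Exp.parse e₂ (o := 0 + e₁.size) (d := 1) (hs.2.congr p₁.tok p₁.arg)
    p₁.i p₁.sp
  rw [← Function.iterate_add_apply, add_comm e₂.size] at p₂ l₂
  have hf := forUp_runs (v := .i) (b := .n) parseBody_loopFree (parseBody_writesReg (by simp))
    (parseBody_writesReg (by simp)) (by simp) (s.set .sp 0)
    (Q := (· = (roundUp .i parseBody)^[e₁.size + e₂.size] ((s.set .sp 0).set .i 0)))
    (by simp [hn])
  rw [show (s.set .sp 0).reg .n = e₁.size + e₂.size by simp [hn]] at hf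
  refine (hf.seq (t₂ := 8) ?_).mono (by omega) fun _ h => h
  rintro _ rfl
  have hp := e₁.size_pos
  have hreg := roundUp_iterate_reg (v := .i) (x := .n) (c := parseBody) (by simp)
    (parseBody_writesReg (by simp)) (e₁.size + e₂.size) ((s.set .sp 0).set .i 0)
  have l₁' := l₁.congr (p₂.sameTree (o' := 0) (n' := e₁.size) (Or.inl (by omega)))
  have b₂ := p₂.below 0 (by omega)
  have t₁ := p₁.top
  have t₂ := p₂.top
  set w := (roundUp .i parseBody)^[e₁.size + e₂.size] ((s.set .sp 0).set .i 0) with hw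
  refine Runs.of_loopFree (by simp [block, Cmd.LoopFree])
    (by simp [block, Cmd.bound, Tm.cost]) ⟨?_, ?_, ?_, ?_, ?_⟩
  · simp [block, Cmd.run, Tm.eval, hreg, hn]
  · simp [block, Cmd.run, Tm.eval, b₂, t₁]
  · simp [block, Cmd.run, Tm.eval, t₂]
  · exact l₁'.congr fun r hr j _ _ => by simp [block, Cmd.run]
  · rw [zero_add] at l₂
    exact l₂.congr fun r hr j _ _ => by simp [block, Cmd.run]

/-- The initial pseudostates of all subexpressions of the two expressions have been computed. -/
structure Started (m : ℕ) (τ : T → ℕ) (code : P → ℕ) (s : Mem Var Arr) (e₁ e₂ : Exp T P) :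
    Prop where
  trees : Trees τ code s e₁ e₂
  states : s.reg .states = e₁.acts + e₂.acts
  left : e₁.IniOk m τ code s 0 0
  right : e₂.IniOk m τ code s e₁.size e₁.acts

theorem pseudostates_runs (hτ : ∀ t, τ t < m) (h : Trees τ code s e₁ e₂) :
    Runs (pseudostates m) s (((iniBody m).bound + 6) * (e₁.size + e₂.size) + 7)
      fun s' => Started m τ code s' e₁ e₂ := by
  have h₁ : Runs (.set .states (.lit 0)) s 2 (· = s.set .states 0) := ⟨_, _, .set _ _ _, le_rfl, rfl⟩
  refine (h₁.seq (t₂ := ((iniBody m).bound + 6) * (e₁.size + e₂.size) + 5) ?_).mono (by omega)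
    fun _ h => h
  rintro _ rfl
  set w := (s.set .states 0).set .i 0 with hw
  have ht : Trees τ code w e₁ e₂ := h.congr (fun _ _ => rfl) (by simp [hw]) (by simp [hw])
    (by simp [hw])
  obtain ⟨i₁, q₁⟩ := Exp.Layout.ini (m := m) hτ ht.left (q := 0) (by simp [hw]) (by simp [hw])
  have c₁ := iniRound_i m e₁.size w
  rw [show w.reg .i = 0 by simp [hw], zero_add] at c₁
  obtain ⟨i₂, q₂⟩ := Exp.Layout.ini (m := m) hτ
    (ht.right.congr (iniRound_sameTree m e₁.size w e₁.size e₂.size)) (q := e₁.acts)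
    c₁ (q₁.trans (zero_add _))
  have i₁' := i₁.iniRound (k := e₂.size) (Or.inl (by omega))
  rw [← Function.iterate_add_apply, add_comm e₂.size] at i₁' i₂ q₂
  have hf := forUp_runs (v := .i) (b := .n) (iniBody_loopFree m) (iniBody_writesReg (by simp))
    (iniBody_writesReg (by simp)) (by simp) (s.set .states 0)
    (Q := fun s' => Started m τ code s' e₁ e₂) (by
      rw [show (s.set .states 0).reg .n = e₁.size + e₂.size by simp [h.n]]
      exact ⟨ht.congr (fun r hr => iniRound_tree m _ _ hr)
        (roundUp_iterate_reg (by simp) (iniBody_writesReg (by simp)) _ _)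
        (roundUp_iterate_reg (by simp) (iniBody_writesReg (by simp)) _ _)
        (roundUp_iterate_reg (by simp) (iniBody_writesReg (by simp)) _ _), q₂, i₁', i₂⟩)
  rw [show (s.set .states 0).reg .n = e₁.size + e₂.size by simp [h.n]] at hf
  exact hf

theorem Started.congr (h : Started m τ code s e₁ e₂)
    (hr : ∀ r : Arr, r.IsTree ∨ r.IsIni → s'.arr r = s.arr r)
    (hreg : ∀ x, x ≠ .i → s'.reg x = s.reg x) : Started m τ code s' e₁ e₂ :=
  ⟨h.trees.congr (fun r h' => hr r (Or.inl h')) (hreg _ (by simp)) (hreg _ (by simp))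
    (hreg _ (by simp)), (hreg _ (by simp)).trans h.states,
    h.left.congr fun r h' j _ _ => congrFun (hr r (Or.inr h')) j,
    h.right.congr fun r h' j _ _ => congrFun (hr r (Or.inr h')) j⟩

/-- The rows of the states that belong to occurrences of actions have been computed. -/
structure Connected (m : ℕ) (τ : T → ℕ) (code : P → ℕ) (s : Mem Var Arr) (e₁ e₂ : Exp T P) :
    Prop where
  started : Started m τ code s e₁ e₂
  left : ∀ x < e₁.acts, HoldsRow m τ code s .delta x (e₁.delta 0 (fun _ => .acc) x)
  right : ∀ x, e₁.acts ≤ x → x < e₁.acts + e₂.acts →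
    HoldsRow m τ code s .delta x (e₂.delta e₁.acts (fun _ => .acc) x)

/-- The first step of `transitions`: at the roots, acceptance stays acceptance. -/
def rootConts (m : ℕ) : Prog := forAtoms m fun a => block [
    .put (.res .cont a) (.reg .root1) (.lit 1),
    .put (.res .cont a) (.reg .root2) (.lit 1)]

theorem rootConts_run (m : ℕ) (s : Mem Var Arr) :
    ((rootConts m).run s).reg = s.reg ∧
    (∀ r, (∀ a, r ≠ .res .cont a) → ((rootConts m).run s).arr r = s.arr r) ∧
    HoldsRow m τ code ((rootConts m).run s) .cont (s.reg .root1)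
      (fun _ => .acc : Row T P) ∧
    HoldsRow m τ code ((rootConts m).run s) .cont (s.reg .root2)
      (fun _ => .acc : Row T P) := by
  have hloc : ∀ a, Local a (block [.put (.res .cont a) (.reg .root1) (.lit 1),
      .put (.res .cont a) (.reg .root2) (.lit 1)]) := fun a => by
    refine local_block fun c hc => ?_
    simp only [List.mem_cons, List.not_mem_nil, or_false] at hc
    rcases hc with rfl | rfl <;> exact local_put rfl trivial trivial
  refine ⟨(forAtoms_run_local hloc s).1, fun r hr => ?_, ?_, ?_⟩
  · refine Cmd.run_arr_of_not_writes (fun h => ?_) s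
    simp [rootConts, forAtoms_writesArr, block_writesArr, Cmd.WritesArr] at h
    obtain ⟨a, h⟩ := h
    exact hr a h.2
  · exact holdsRow_forAtoms hloc fun a _ => by simp [Holds, block, Cmd.run, Tm.eval]
  · exact holdsRow_forAtoms hloc fun a _ => by simp [Holds, block, Cmd.run, Tm.eval]

theorem rootConts_loopFree (m : ℕ) : (rootConts m).LoopFree := by
  simp [rootConts, forAtoms_loopFree, block, Cmd.LoopFree]

theorem transitions_runs (h : Started m τ code s e₁ e₂) :
    Runs (transitions m) s
      ((rootConts m).bound + (((transBody m).bound + 6) * (e₁.size + e₂.size) + 5))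
      fun s' => Connected m τ code s' e₁ e₂ := by
  refine Runs.seq (c := rootConts m) (R := (· = (rootConts m).run s))
    (Runs.of_loopFree (rootConts_loopFree m) le_rfl rfl) ?_
  rintro _ rfl
  obtain ⟨hreg, harr, k₁, k₂⟩ := rootConts_run (τ := τ) (code := code) m s
  set s₁ := (rootConts m).run s with hs₁
  set w := s₁.set .i (e₁.size + e₂.size) with hw
  have hst : Started m τ code w e₁ e₂ := by
    refine h.congr (fun r hr => ?_) fun x hx => by simp [hw, hreg, hx]
    rw [hw, Mem.set_arr]
    refine harr r fun a => ?_
    rcases hr with (rfl | rfl | rfl | rfl | rfl) | (rfl | ⟨a, rfl | rfl | rfl⟩) <;> simp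
  rw [h.trees.root1] at k₁
  rw [h.trees.root2] at k₂
  have hp₁ := e₁.size_pos
  have hp₂ := e₂.size_pos
  have t₂ := hst.trees.right.trans hst.right (by simp [hw]) (k := fun _ => .acc) k₂
  have c₂ := transRound_i m e₂.size w
  rw [show w.reg .i = e₁.size + e₂.size by simp [hw]] at c₂
  have t₁ := (hst.trees.left.after_transRounds (m := m) e₂.size).trans
    (hst.left.after_transRounds e₂.size) (by omega) (k := fun _ => .acc)
    (HoldsRow.of_sameRow (by rw [zero_add]; exact k₁) (t₂.cont _ (Or.inl (by omega))))
  rw [← Function.iterate_add_apply] at t₁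
  have hn : s₁.reg .n = e₁.size + e₂.size := by rw [hreg, h.trees.n]
  have hf := forDown_runs (v := .i) (b := .n) (transBody_loopFree m) transBody_writesReg s₁
    (Q := fun s' => Connected m τ code s' e₁ e₂) (by
      rw [hn, ← hw]
      refine ⟨hst.congr (fun r hr => ?_) fun x hx => roundDown_iterate_reg hx transBody_writesReg _ _,
        fun x hx => t₁.rows x (by omega) (by omega), fun x hx hx' => ?_⟩
      · rcases hr with hr | hr
        · exact transRound_tree m _ _ hr
        · exact transRound_ini m _ _ hr
      · exact (t₂.rows x hx hx').of_sameRow (t₁.delta x (by omega)))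
  rw [hn] at hf
  exact hf

theorem startState_run {v root : Var} (hv : v ≠ .states) (hr : root ≠ v) (hr' : root ≠ .states)
    (s : Mem Var Arr) {r : Row T P} (h : HoldsRow m τ code s .ini (s.reg root) r) :
    (∀ x, ((startState m v root).run s).reg x = if x = .states then s.reg .states + 1 else
      if x = v then s.reg .states else s.reg x) ∧
    (∀ j, SameRow m s ((startState m v root).run s) .ini j) ∧
    (∀ j, j ≠ s.reg .states → SameRow m s ((startState m v root).run s) .delta j) ∧
    HoldsRow m τ code ((startState m v root).run s) .delta (s.reg .states) r := by
  set s₁ := (s.set v (s.reg .states)).set .states (s.reg .states + 1) with hs₁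
  set f : ℕ → Prog := fun a => copy a .delta (.reg v) .ini (.reg root) with hf
  have hrun : (startState m v root).run s = (forAtoms m f).run s₁ := by
    simp [startState, block, Cmd.run, Tm.eval, hs₁, hv.symm, hf]
  have hloc : ∀ a, Local a (f a) := fun a => local_copy (shared_reg v) (shared_reg root)
  have hreg : ∀ x, s₁.reg x = if x = .states then s.reg .states + 1 else
      if x = v then s.reg .states else s.reg x := fun x => by simp [hs₁]
  rw [hrun]
  refine ⟨fun x => ?_, fun j => ?_, fun j hj => ?_, ?_⟩
  · rw [(forAtoms_run_local hloc s₁).1, hreg]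
  · exact sameRow_forAtoms (s := s₁) hloc fun a _ =>
      copy_arr_of_ne (shared_reg v) (shared_reg root) (Or.inl (by simp))
  · refine sameRow_forAtoms (s := s₁) hloc fun a _ =>
      copy_arr_of_ne (shared_reg v) (shared_reg root) (Or.inr ?_)
    simp [Tm.eval, hreg, hv, hj]
  · refine holdsRow_forAtoms hloc fun a ha => ?_
    have e₁ : (Tm.reg (A := Arr) root).eval s₁ = s.reg root := by simp [Tm.eval, hreg, hr, hr']
    have e₂ : (Tm.reg (A := Arr) v).eval s₁ = s.reg .states := by simp [Tm.eval, hreg, hv]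
    have := holds_copy (t := .delta) (shared_reg v) (shared_reg root) (s := s₁)
      (show Holds code s₁ .ini a ((Tm.reg root).eval s₁) (r (atomOf τ a)) by rw [e₁]; exact h a ha)
    rwa [e₂] at this

theorem startState_loopFree (m : ℕ) (v root : Var) : (startState m v root).LoopFree := by
  simp [startState, forAtoms_loopFree, block, Cmd.LoopFree, copy]

end Prog

/-- The disjoint union of the Thompson automata of two expressions; the last two states are the
start states. -/
def thompsonMap (e₁ e₂ : Exp T P) (x : ℕ) : Row T P :=
  if x < e₁.acts then e₁.delta 0 (fun _ => .acc) x
  else if x < e₁.acts + e₂.acts then e₂.delta e₁.acts (fun _ => .acc) x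
  -- All larger numbers share the row of the second start state. Thanks to this default value, the
  -- facts about actions and live targets hold for all numbers `x`, without a bound.
  else if x = e₁.acts + e₂.acts then e₁.ini 0 else e₂.ini e₁.acts

theorem thompsonMap_left : thompsonMap e₁ e₂ (e₁.acts + e₂.acts) = e₁.ini 0 := by
  simp [thompsonMap]

theorem thompsonMap_right : thompsonMap e₁ e₂ (e₁.acts + e₂.acts + 1) = e₂.ini e₁.acts := by
  rw [thompsonMap, if_neg (by omega), if_neg (by omega), if_neg (by omega)]

theorem thompsonMap_eq_step {x y : ℕ} {α : Atom T} {p : P}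
    (h : thompsonMap e₁ e₂ x α = .step p y) :
    p ∈ e₁.actions ∪ e₂.actions ∧ y < e₁.acts + e₂.acts + 2 := by
  have key : (p ∈ e₁.actions ∧ y < 0 + e₁.acts) ∨ (p ∈ e₂.actions ∧ y < e₁.acts + e₂.acts) := by
    rw [thompsonMap] at h
    split_ifs at h
    · rcases Exp.delta_eq_step h with h | h
      · exact Or.inl h
      · simp at h
    · rcases Exp.delta_eq_step h with h | h
      · exact Or.inr h
      · simp at h
    · exact Or.inl (Exp.ini_eq_step h)
    · exact Or.inr (Exp.ini_eq_step h)
  rcases key with ⟨h₁, h₂⟩ | ⟨h₁, h₂⟩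
  · exact ⟨Or.inl h₁, by omega⟩
  · exact ⟨Or.inr h₁, by omega⟩

/-- `Exp.accepts_ini` constrains the transition map only on the states of the expression, so it
applies to each half of the disjoint union separately. -/
theorem langEq_thompsonMap : LangEq (thompsonMap e₁ e₂) (thompsonMap e₁ e₂ (e₁.acts + e₂.acts))
    (thompsonMap e₁ e₂ (e₁.acts + e₂.acts + 1)) ↔ e₁.den = e₂.den := by
  have h₁ : ∀ α w, Accepts (thompsonMap e₁ e₂) (e₁.ini 0) α w ↔ (⟨α, w⟩ : GStr T P) ∈ e₁.den :=
    fun α w => Exp.accepts_ini fun x _ hx => by rw [thompsonMap, if_pos (by omega)]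
  have h₂ : ∀ α w, Accepts (thompsonMap e₁ e₂) (e₂.ini e₁.acts) α w ↔
      (⟨α, w⟩ : GStr T P) ∈ e₂.den :=
    fun α w => Exp.accepts_ini fun x hx hx' => by
      rw [thompsonMap, if_neg (by omega), if_pos (by omega)]
  rw [thompsonMap_left, thompsonMap_right]
  simp only [LangEq, h₁, h₂]
  constructor
  · rintro h
    ext ⟨α, w⟩
    exact h α w
  · intro h α w
    rw [h]

theorem inputMem_stored (l : List (ℕ × ℕ)) : Stored (inputMem l) l 0 := fun j hj => by
  simp [inputMem, List.getElem?_eq_getElem hj]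

/-- The table of transitions holds the given automaton. -/
structure HoldsMap (m : ℕ) (τ : T → ℕ) (code : P → ℕ) (s : Mem Var Arr) (N : ℕ)
    (D : ℕ → Row T P) : Prop where
  states : s.reg .states = N
  rows : ∀ x < N, HoldsRow m τ code s .delta x (D x)

namespace Prog

/-- A bound for the number of steps of `thompson` per symbol. -/
def thompsonCost (m : ℕ) : ℕ :=
  parseBody.bound + (iniBody m).bound + (transBody m).bound + (rootConts m).bound +
    (startState m .start1 .root1).bound + (startState m .start2 .root2).bound + 50

theorem thompson_runs (hτ : ∀ t, τ t < m) (e₁ e₂ : Exp T P) :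
    Runs (thompson m) (inputMem (e₁.symbols τ code ++ e₂.symbols τ code))
      (thompsonCost m * (e₁.size + e₂.size)) fun s =>
        HoldsMap m τ code s (e₁.acts + e₂.acts + 2) (thompsonMap e₁ e₂) ∧
        s.reg .start1 = e₁.acts + e₂.acts ∧ s.reg .start2 = e₁.acts + e₂.acts + 1 := by
  have hp₁ := e₁.size_pos
  have hp₂ := e₂.size_pos
  have h₁ := parse_runs (τ := τ) (code := code) (e₁ := e₁) (e₂ := e₂)
    (s := inputMem (e₁.symbols τ code ++ e₂.symbols τ code))
    (by simp [inputMem, Exp.length_symbols]) (inputMem_stored _)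
  refine (h₁.seq fun s₁ k₁ => (pseudostates_runs hτ k₁).seq fun s₂ k₂ =>
    (transitions_runs k₂).seq (t₂ := (startState m .start1 .root1).bound +
      (startState m .start2 .root2).bound) fun s₃ k₃ => ?_).mono ?_ fun _ h => h
  · refine Runs.of_loopFree (by simp [block, Cmd.LoopFree, startState_loopFree]) le_rfl ?_
    simp only [block, Cmd.run]
    have hi₁ := k₃.started.left.row
    have hi₂ := k₃.started.right.row
    rw [zero_add, ← k₃.started.trees.root1] at hi₁
    rw [← k₃.started.trees.root2] at hi₂
    obtain ⟨a₁, b₁, c₁, d₁⟩ := startState_run (v := .start1) (root := .root1) (by simp) (by simp)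
      (by simp) s₃ hi₁
    set s₄ := (startState m .start1 .root1).run s₃ with hs₄
    have hi₂' := hi₂.of_sameRow (b₁ _)
    rw [show s₃.reg .root2 = s₄.reg .root2 by simp [a₁]] at hi₂'
    obtain ⟨a₂, b₂, c₂, d₂⟩ := startState_run (v := .start2) (root := .root2) (by simp) (by simp)
      (by simp) s₄ hi₂'
    set s₅ := (startState m .start2 .root2).run s₄ with hs₅
    have hst := k₃.started.states
    refine ⟨⟨by simp [a₂, a₁, hst], fun x hx => ?_⟩, by simp [a₂, a₁, hst], by simp [a₂, a₁, hst]⟩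
    have e₄ : s₄.reg .states = e₁.acts + e₂.acts + 1 := by simp [a₁, hst]
    rw [e₄] at c₂ d₂
    rw [hst] at c₁ d₁
    by_cases h₁ : x < e₁.acts
    · rw [thompsonMap, if_pos h₁]
      exact ((k₃.left x h₁).of_sameRow (c₁ x (by omega))).of_sameRow (c₂ x (by omega))
    by_cases h₂ : x < e₁.acts + e₂.acts
    · rw [thompsonMap, if_neg h₁, if_pos h₂]
      exact ((k₃.right x (by omega) h₂).of_sameRow (c₁ x (by omega))).of_sameRow (c₂ x (by omega))
    by_cases h₃ : x = e₁.acts + e₂.acts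
    · rw [h₃, thompsonMap_left]
      exact d₁.of_sameRow (c₂ _ (by omega))
    · obtain rfl : x = e₁.acts + e₂.acts + 1 := by omega
      rw [thompsonMap_right]
      exact d₂
  -- As expressions have positive size, the costs that occur only once are absorbed into the linear
  -- term.
  · have hn : 1 ≤ e₁.size + e₂.size := by omega
    have := Nat.mul_le_mul_left ((rootConts m).bound +
      (startState m .start1 .root1).bound + (startState m .start2 .root2).bound + 32) hn
    simp only [thompsonCost]
    ring_nf at this ⊢
    omega

end Prog

end Thompson

end GKAT

namespace GKAT

/-! ## Normalization -/

section Normalize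

variable {T P : Type*} {m : ℕ} {τ : T → ℕ} {code : P → ℕ} {s s' s'' : Mem Var Arr}
  {D : ℕ → Row T P} {N : ℕ}

namespace Prog

/-- The usual invariant rule, indexed by the number of finished rounds. It replaces explicit
iterates where a pass runs over states and not over a syntax tree. -/
theorem forUp_runs_inv {v b : Var} {c : Prog} (hc : c.LoopFree) (hv : ¬ c.WritesReg v)
    (hb : ¬ c.WritesReg b) (hvb : b ≠ v) {s : Mem Var Arr} {n : ℕ} (hn : s.reg b = n)
    (I : ℕ → Mem Var Arr → Prop) (h₀ : I 0 (s.set v 0))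
    (hstep : ∀ k < n, ∀ s', s'.reg v = k → I k s' → I (k + 1) ((c.run s').set v (k + 1))) :
    Runs (forUp v b c) s ((c.bound + 6) * n + 5) (I n) := by
  subst hn
  refine forUp_runs hc hv hb hvb s ?_
  have key : ∀ k ≤ s.reg b, I k ((roundUp v c)^[k] (s.set v 0)) := by
    intro k
    induction k with
    | zero => intro _; exact h₀
    | succ k ih =>
      intro hk
      rw [Function.iterate_succ_apply']
      have e := roundUp_iterate_counter (v := v) (c := c) k (s.set v 0)
      simp only [Mem.set_reg, if_true, zero_add] at e
      have := hstep k (by omega) _ e (ih (by omega))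
      simpa only [roundUp, e] using this
  exact key _ le_rfl

end Prog

open Prog

/-! ### Linked lists -/

/-- The list `l` is stored from the pointer `h` on. -/
def IsChain (nxt : ℕ → ℕ) : ℕ → List ℕ → Prop
  | h, [] => h = 0
  | h, x :: l => h = x + 1 ∧ IsChain nxt (nxt x) l

theorem IsChain.congr {nxt nxt' : ℕ → ℕ} {h : ℕ} {l : List ℕ} (hl : IsChain nxt h l)
    (hn : ∀ x ∈ l, nxt' x = nxt x) : IsChain nxt' h l := by
  induction l generalizing h with
  | nil => exact hl
  | cons x l ih =>
    refine ⟨hl.1, ?_⟩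
    rw [hn x (by simp)]
    exact ih hl.2 fun y hy => hn y (by simp [hy])

/-- The lists `l y` hold the numbers below `k` that `S` relates to `y`. -/
structure Listed (N : ℕ) (nxt head : ℕ → ℕ) (S : ℕ → ℕ → Prop) (k : ℕ) (l : ℕ → List ℕ) :
    Prop where
  chain : ∀ y < N, IsChain nxt (head y) (l y)
  mem : ∀ y < N, ∀ x, x ∈ l y ↔ x < k ∧ S x y
  length : ∑ y ∈ Finset.range N, (l y).length ≤ k

theorem Listed.skip {nxt head : ℕ → ℕ} {S : ℕ → ℕ → Prop} {k : ℕ} {l : ℕ → List ℕ}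
    (h : Listed N nxt head S k l) (hS : ∀ y < N, ¬ S k y) : Listed N nxt head S (k + 1) l := by
  refine ⟨h.chain, fun y hy x => ?_, h.length.trans (by omega)⟩
  rw [h.mem y hy]
  constructor
  · rintro ⟨h₁, h₂⟩; exact ⟨by omega, h₂⟩
  · rintro ⟨h₁, h₂⟩
    refine ⟨?_, h₂⟩
    rcases Nat.lt_succ_iff_lt_or_eq.1 h₁ with h₁ | rfl
    · exact h₁
    · exact (hS y hy h₂).elim

/-- For a fixed atom a state has at most one successor, so it lies in at most one list of
predecessors. Hence a single array of links serves all lists, and their total length grows by at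
most one per state. Overwriting the link of `k` does no harm, since the lists so far contain only
numbers below `k`. -/
theorem Listed.cons {nxt head : ℕ → ℕ} {S : ℕ → ℕ → Prop} {k y : ℕ} {l : ℕ → List ℕ}
    (h : Listed N nxt head S k l) (hy : y < N) (hS : ∀ z, S k z ↔ z = y) :
    Listed N (Function.update nxt k (head y)) (Function.update head y (k + 1)) S (k + 1)
      (Function.update l y (k :: l y)) := by
  have hc : ∀ z < N, IsChain (Function.update nxt k (head y)) (head z) (l z) := fun z hz =>
    (h.chain z hz).congr fun x hx => by
      rw [Function.update_of_ne]
      have := ((h.mem z hz x).1 hx).1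
      omega
  refine ⟨fun z hz => ?_, fun z hz x => ?_, ?_⟩
  · by_cases e : z = y
    · subst e
      simp only [Function.update_self, IsChain, true_and]
      exact hc z hz
    · simp only [Function.update_of_ne e]
      exact hc z hz
  · by_cases e : z = y
    · subst e
      simp only [Function.update_self, List.mem_cons, h.mem z hz]
      constructor
      · rintro (rfl | ⟨h₁, h₂⟩)
        · exact ⟨by omega, (hS z).2 rfl⟩
        · exact ⟨by omega, h₂⟩
      · rintro ⟨h₁, h₂⟩
        by_cases e : x = k
        · exact Or.inl e
        · exact Or.inr ⟨by omega, h₂⟩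
    · simp only [Function.update_of_ne e, h.mem z hz]
      constructor
      · rintro ⟨h₁, h₂⟩; exact ⟨by omega, h₂⟩
      · rintro ⟨h₁, h₂⟩
        refine ⟨?_, h₂⟩
        rcases Nat.lt_succ_iff_lt_or_eq.1 h₁ with h₁ | rfl
        · exact h₁
        · exact (e ((hS z).1 h₂)).elim
  · have hm : y ∈ Finset.range N := Finset.mem_range.2 hy
    have h₁ := h.length
    rw [← Finset.add_sum_erase _ _ hm] at h₁ ⊢
    rw [Finset.sum_congr rfl (g := fun z => (l z).length) fun z hz => by
      rw [Function.update_of_ne (Finset.ne_of_mem_erase hz)]]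
    simp only [Function.update_self, List.length_cons]
    omega

/-! ### The search -/

/-- The queue of the search holds the marked states, all of which are live. -/
structure Marked (D : ℕ → Row T P) (N : ℕ) (s : Mem Var Arr) : Prop where
  lt : ∀ i < s.reg .tl, s.arr .bfs i < N
  inj : ∀ i < s.reg .tl, ∀ j < s.reg .tl, s.arr .bfs i = s.arr .bfs j → i = j
  queued : ∀ x < N, s.arr .live x = 0 ∨ (s.arr .live x = 1 ∧ ∃ i < s.reg .tl, s.arr .bfs i = x)
  marked : ∀ i < s.reg .tl, s.arr .live (s.arr .bfs i) = 1
  sound : ∀ x < N, s.arr .live x = 1 → Live D x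

theorem Marked.congr (h : Marked D N s) (h₁ : s'.reg .tl = s.reg .tl)
    (h₂ : s'.arr .live = s.arr .live) (h₃ : s'.arr .bfs = s.arr .bfs) : Marked D N s' := by
  obtain ⟨a, b, c, d, e⟩ := h
  constructor <;> simpa only [h₁, h₂, h₃]

/-- The search has gone on. -/
structure Grows (s s' : Mem Var Arr) : Prop where
  tl : s.reg .tl ≤ s'.reg .tl
  bfs : ∀ i < s.reg .tl, s'.arr .bfs i = s.arr .bfs i
  live : ∀ x, s.arr .live x = 1 → s'.arr .live x = 1

theorem Grows.of_eq (h₁ : s'.reg .tl = s.reg .tl)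
    (h₂ : s'.arr .live = s.arr .live) (h₃ : s'.arr .bfs = s.arr .bfs) : Grows s s' :=
  ⟨by omega, fun _ _ => by rw [h₃], fun _ h => by rwa [h₂]⟩

theorem Grows.trans (h : Grows s s') (h' : Grows s' s'') : Grows s s'' :=
  ⟨h.tl.trans h'.tl, fun i hi => (h'.bfs i (hi.trans_le h.tl)).trans (h.bfs i hi),
    fun x hx => h'.live x (h.live x hx)⟩

/-- A state is queued only when its mark changes from `0` to `1`. This keeps the queue free of
repetitions, on which the time bound of the search depends. -/
theorem Prog.mark_run (h : Marked D N s) {x : ℕ} (hx : s.reg .x = x) (hN : x < N)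
    (hl : Live D x) : Marked D N ((mark (.reg .x)).run s) ∧ Grows s ((mark (.reg .x)).run s) ∧
      ((mark (.reg .x)).run s).arr .live x = 1 := by
  by_cases h₀ : s.arr .live x = 0
  · have hrun : (mark (.reg .x)).run s =
        ((s.put .live x 1).put .bfs (s.reg .tl) x).set .tl (s.reg .tl + 1) := by
      simp [mark, when, block, Cmd.run, Cnd.eval_eq_iff, Tm.eval, hx, h₀]
    rw [hrun]
    have hne : ∀ i < s.reg .tl, s.arr .bfs i ≠ x := fun i hi e => by
      have := h.marked i hi
      rw [e, h₀] at this
      omega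
    refine ⟨⟨fun i hi => ?_, fun i hi j hj e => ?_, fun y hy => ?_, fun i hi => ?_,
      fun y hy e => ?_⟩, ⟨by simp, fun i hi => ?_, fun y hy => ?_⟩, by simp⟩
    · simp at hi ⊢
      split_ifs with e
      · exact hN
      · exact h.lt i (by omega)
    · simp at hi hj e
      split_ifs at e with e₁ e₂ e₂
      · omega
      · exact (hne j (by omega) e.symm).elim
      · exact (hne i (by omega) e).elim
      · exact h.inj i (by omega) j (by omega) e
    · by_cases e : y = x
      · exact Or.inr ⟨by simp [e], s.reg .tl, by simp, by simp [e]⟩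
      · rcases h.queued y hy with h | ⟨h, i, hi, hy⟩
        · exact Or.inl (by simp [e, h])
        · exact Or.inr ⟨by simp [e, h], i, by simp; omega,
            by simp [hy, show i ≠ s.reg .tl by omega]⟩
    · simp only [Mem.set_reg, if_true] at hi
      by_cases e : i = s.reg .tl
      · simp [e]
      · have := h.marked i (by omega)
        simp [e, this]
    · simp at e
      by_cases e' : y = x
      · exact e' ▸ hl
      · exact h.sound y hy (e e')
    · simp; omega
    · simp [hy]
  · have h₁ : s.arr .live x = 1 := (h.queued x hN).resolve_left h₀ |>.1
    have hrun : (mark (.reg .x)).run s = s := by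
      simp [mark, when, block, Cmd.run, Cnd.eval_eq_iff, Tm.eval, hx, h₁]
    rw [hrun]
    exact ⟨h, Grows.of_eq rfl rfl rfl, h₁⟩

theorem Prog.mark_reg {x : Var} (hx : x ≠ .tl) (t : Tm Var Arr) (s : Mem Var Arr) :
    ((mark t).run s).reg x = s.reg x :=
  Cmd.run_reg_of_not_writes (by simp [mark, when, block, Cmd.WritesReg, hx]) s

theorem Prog.mark_arr {r : Arr} (h₁ : r ≠ .live) (h₂ : r ≠ .bfs) (t : Tm Var Arr)
    (s : Mem Var Arr) : ((mark t).run s).arr r = s.arr r :=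
  Cmd.run_arr_of_not_writes (by simp [mark, when, block, Cmd.WritesArr, h₁, h₂]) s

theorem live_of_step {x y : ℕ} {α : Atom T} {p : P} (h : D x α = .step p y) (hy : Live D y) :
    Live D x := by
  obtain ⟨β, w, hw⟩ := hy
  exact ⟨α, (p, β) :: w, y, h, hw⟩

/-- The transitions for the atom with number `a`. -/
def StepRel (τ : T → ℕ) (D : ℕ → Row T P) (a x y : ℕ) : Prop :=
  ∃ p, D x (atomOf τ a) = .step p y

/-- The state of the preparation for the search when the states below `k`, and the first `c` atoms
for the state `k`, have been dealt with. -/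
structure Prepared (m : ℕ) (τ : T → ℕ) (code : P → ℕ) (D : ℕ → Row T P) (N k c : ℕ)
    (s : Mem Var Arr) : Prop where
  rows : ∀ x < N, HoldsRow m τ code s .delta x (D x)
  marked : Marked D N s
  acc : ∀ x < N, ∀ a < 2 ^ m, (x < k ∨ x = k ∧ a < c) → D x (atomOf τ a) = .acc →
    s.arr .live x = 1
  lists : ∀ a < 2 ^ m, ∃ l, Listed N (s.arr (.rnext a)) (s.arr (.rhead a)) (StepRel τ D a)
    (if a < c then k + 1 else k) l

namespace Prog

/-- What the preparation for the search does for the atom `a`. -/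
def prepareAtom (a : ℕ) : Prog := block [
    when (resIs a .delta (.reg .x) 1) (mark (.reg .x)),
    when (resIs a .delta (.reg .x) 2) (block [
      .set .y (.get (.tgt .delta a) (.reg .x)),
      .put (.rnext a) (.reg .x) (.get (.rhead a) (.reg .y)),
      .put (.rhead a) (.reg .y) (.succ (.reg .x))])]

theorem prepareAtom_loopFree (a : ℕ) : (prepareAtom a).LoopFree := by
  simp [prepareAtom, when, mark, block, Cmd.LoopFree]

theorem prepareAtom_writesReg {a : ℕ} {x : Var} (h₁ : x ≠ .tl) (h₂ : x ≠ .y) :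
    ¬ (prepareAtom a).WritesReg x := by
  simp [prepareAtom, when, mark, block, Cmd.WritesReg, h₁, h₂]

theorem prepareAtom_run (hD : ∀ x < N, ∀ α p y, D x α = .step p y → y < N) {k c : ℕ} (hk : k < N)
    (hc : c < 2 ^ m) (hx : s.reg .x = k) (h : Prepared m τ code D N k c s) :
    Prepared m τ code D N k (c + 1) ((prepareAtom c).run s) := by
  set s₁ := (when (resIs c .delta (.reg .x) 1) (mark (.reg .x))).run s with hs₁
  have hv : Holds code s .delta c ((Tm.reg Var.x).eval s) (D k (atomOf τ c)) := by
    simp only [Tm.eval, hx]; exact h.rows k hk c hc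
  have h₁ : Marked D N s₁ ∧ Grows s s₁ ∧ (D k (atomOf τ c) = .acc → s₁.arr .live k = 1) := by
    simp only [hs₁, when, Cmd.run]
    split_ifs with hb <;> rw [resIs_one_iff hv] at hb
    · obtain ⟨g₁, g₂, g₃⟩ := mark_run h.marked hx hk ⟨_, [], hb⟩
      exact ⟨g₁, g₂, fun _ => g₃⟩
    · exact ⟨h.marked, Grows.of_eq rfl rfl rfl, fun h => (hb h).elim⟩
  have harr : ∀ r : Arr, r ≠ .live → r ≠ .bfs → s₁.arr r = s.arr r := fun r hr hr' =>
    Cmd.run_arr_of_not_writes (by simp [mark, when, block, Cmd.WritesArr, hr, hr']) s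
  have hx₁ : s₁.reg .x = k := by
    rw [← hx]
    exact Cmd.run_reg_of_not_writes (by simp [mark, when, block, Cmd.WritesReg]) s
  have hacc : ∀ x < N, ∀ a < 2 ^ m, (x < k ∨ x = k ∧ a < c + 1) → D x (atomOf τ a) = .acc →
      s₁.arr .live x = 1 := fun x hx a ha hxa he => by
    by_cases hc' : x = k ∧ a = c
    · obtain ⟨rfl, rfl⟩ := hc'
      exact h₁.2.2 he
    · exact h₁.2.1.live x (h.acc x hx a ha (by omega) he)
  have hrows : ∀ x < N, HoldsRow m τ code s₁ .delta x (D x) := fun x hx a ha =>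
    (h.rows x hx a ha).congr (by rw [harr _ (by simp) (by simp)])
      (by rw [harr _ (by simp) (by simp)]) (by rw [harr _ (by simp) (by simp)])
  have hv₁ : Holds code s₁ .delta c ((Tm.reg Var.x).eval s₁) (D k (atomOf τ c)) := by
    simp only [Tm.eval, hx₁]; exact hrows k hk c hc
  have hlists : ∀ a < 2 ^ m, ∃ l, Listed N (s₁.arr (.rnext a)) (s₁.arr (.rhead a)) (StepRel τ D a)
      (if a < c then k + 1 else k) l := fun a ha => by
    rw [harr _ (by simp) (by simp), harr _ (by simp) (by simp)]
    exact h.lists a ha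
  have hrun : (prepareAtom c).run s = (when (resIs c .delta (.reg .x) 2) (block [
      .set .y (.get (.tgt .delta c) (.reg .x)),
      .put (.rnext c) (.reg .x) (.get (.rhead c) (.reg .y)),
      .put (.rhead c) (.reg .y) (.succ (.reg .x))])).run s₁ := rfl
  rw [hrun]
  simp only [when, Cmd.run]
  split_ifs with hb <;> rw [resIs_two_iff hv₁] at hb
  · obtain ⟨p, y, hy⟩ := hb
    have hyN : y < N := hD k hk _ p y hy
    rw [hy] at hv₁
    have htgt : s₁.arr (.tgt .delta c) k = y := by simpa [Tm.eval, hx₁] using hv₁.2.2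
    have e : (block [.set .y (.get (.tgt .delta c) (.reg .x)),
      .put (.rnext c) (.reg .x) (.get (.rhead c) (.reg .y)),
      .put (.rhead c) (.reg .y) (.succ (.reg .x))] : Prog).run s₁ =
        ((s₁.set .y y).put (.rnext c) k (s₁.arr (.rhead c) y)).put (.rhead c) y (k + 1) := by
      simp [block, Cmd.run, Tm.eval, hx₁, htgt]
    rw [e]
    refine ⟨fun x hx a ha => (hrows x hx a ha).congr (by simp) (by simp) (by simp),
      h₁.1.congr (by simp) ?_ ?_, fun x hx a ha hxa he => by simp [hacc x hx a ha hxa he],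
      fun a ha => ?_⟩
    · rw [Mem.put_arr_of_ne _ (by simp), Mem.put_arr_of_ne _ (by simp), Mem.set_arr]
    · rw [Mem.put_arr_of_ne _ (by simp), Mem.put_arr_of_ne _ (by simp), Mem.set_arr]
    · obtain ⟨l, hl⟩ := hlists a ha
      by_cases hac : a = c
      · subst hac
        rw [if_neg (by omega)] at hl
        rw [if_pos (by omega)]
        refine ⟨Function.update l y (k :: l y), ?_⟩
        convert hl.cons hyN (fun z => ?_) using 1
        · funext j
          by_cases hj : j = k <;> simp [hj]
        · funext j
          by_cases hj : j = y <;> simp [hj]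
        · simp only [StepRel, hy, Entry.step.injEq]
          constructor
          · rintro ⟨_, _, h⟩; exact h.symm
          · rintro rfl; exact ⟨p, rfl, rfl⟩
      · have e₁ : (if a < c + 1 then k + 1 else k) = if a < c then k + 1 else k := by
          split_ifs <;> omega
        rw [e₁, Mem.put_arr_of_ne _ (by simp), Mem.put_arr_of_ne _ (by simp [hac]),
          Mem.put_arr_of_ne _ (by simp [hac]), Mem.put_arr_of_ne _ (by simp), Mem.set_arr]
        exact ⟨l, hl⟩
  · refine ⟨hrows, h₁.1, hacc, fun a ha => ?_⟩
    obtain ⟨l, hl⟩ := hlists a ha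
    refine ⟨l, ?_⟩
    by_cases hac : a = c
    · subst hac
      rw [if_neg (by omega)] at hl
      rw [if_pos (by omega)]
      exact hl.skip fun y _ ⟨p, hp⟩ => hb ⟨p, y, hp⟩
    · have e₁ : (if a < c + 1 then k + 1 else k) = if a < c then k + 1 else k := by
        split_ifs <;> omega
      rw [e₁]
      exact hl

end Prog

end Normalize

end GKAT

namespace GKAT

/-! ### The reverse breadth-first search -/

section Search

variable {T P : Type*} {m : ℕ} {τ : T → ℕ} {code : P → ℕ} {s s' s'' : Mem Var Arr}
  {D : ℕ → Row T P} {N : ℕ}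

namespace Prog

/-- Marks the states in the linked list that starts at the pointer `z`. -/
def markList (a : ℕ) : Prog := .loop (.lt (.lit 0) (.reg .z)) (block [
        .set .x (.pred (.reg .z)),
        mark (.reg .x),
        .set .z (.get (.rnext a) (.reg .x))])

/-- The invariant splits `l` into the part `l'` still ahead of the pointer and states that are
marked. Each element costs three steps for the test and at most twenty for the body; the last test
costs three. -/
theorem markList_runs {a : ℕ} {l : List ℕ} (hc : IsChain (s.arr (.rnext a)) (s.reg .z) l)
    (hl : ∀ x ∈ l, x < N ∧ Live D x) (h : Marked D N s) :
    Runs (markList a) s (23 * l.length + 3) fun s' =>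
      Marked D N s' ∧ Grows s s' ∧ ∀ x ∈ l, s'.arr .live x = 1 := by
  refine Runs.loop (fun s' u => ∃ l', IsChain (s'.arr (.rnext a)) (s'.reg .z) l' ∧
    (∀ x ∈ l', x ∈ l) ∧ Marked D N s' ∧ Grows s s' ∧ (∀ x ∈ l, x ∈ l' ∨ s'.arr .live x = 1) ∧
    u = 23 * l'.length + 3) ⟨l, hc, fun _ h => h, h, Grows.of_eq rfl rfl rfl,
      fun _ h => Or.inl h, rfl⟩ ?_ ?_
  · rintro s' u ⟨l', hc', hsub, hM, hG, hdone, rfl⟩ hlt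
    rw [Cnd.eval_lt_iff] at hlt
    simp only [Tm.eval] at hlt
    cases l' with
    | nil => simp only [IsChain] at hc'; omega
    | cons x l' =>
      obtain ⟨hz, hc'⟩ := hc'
      obtain ⟨hxN, hxl⟩ := hl x (hsub x (by simp))
      refine ⟨20, Runs.of_loopFree (by simp [block, mark, when, Cmd.LoopFree])
        (by simp [block, mark, when, Cmd.bound, Tm.cost, Cnd.cost]) ?_⟩
      simp only [block, Cmd.run, Tm.eval, hz, Nat.add_sub_cancel]
      obtain ⟨g₁, g₂, g₃⟩ := mark_run (s := s'.set .x x) (hM.congr (by simp) rfl rfl)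
        (by simp) hxN hxl
      have hx₂ := mark_reg (x := .x) (by simp) (.reg .x) (s'.set .x x)
      have ha₂ := mark_arr (r := .rnext a) (by simp) (by simp) (.reg .x) (s'.set .x x)
      set s₂ := (mark (.reg .x)).run (s'.set .x x) with hs₂
      simp only [Mem.set_reg, if_true, Mem.set_arr] at hx₂ ha₂
      have hG' : Grows s s₂ := (hG.trans (Grows.of_eq (s' := s'.set .x x) (by simp) rfl rfl)).trans g₂
      refine ⟨_, ⟨l', ?_, fun y hy => hsub y (by simp [hy]), g₁.congr (by simp) rfl rfl,
        hG'.trans (Grows.of_eq (by simp) rfl rfl), fun y hy => ?_, rfl⟩, ?_⟩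
      · simp only [Mem.set_reg, if_true, Mem.set_arr, hx₂, ha₂]
        exact hc'
      · rcases hdone y hy with h | h
        · rcases List.mem_cons.1 h with rfl | h
          · exact Or.inr g₃
          · exact Or.inl h
        · exact Or.inr (g₂.live y h)
      · simp [Cnd.cost, Tm.cost]; omega
  · rintro s' u ⟨l', hc', hsub, hM, hG, hdone, rfl⟩ hlt
    refine ⟨by simp [Cnd.cost, Tm.cost], hM, hG, fun x hx => ?_⟩
    cases l' with
    | nil => simpa using hdone x hx
    | cons y l' =>
      exfalso
      have hz := hc'.1
      have : (Cnd.lt (.lit 0) (.reg .z)).eval s' = true := by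
        rw [Cnd.eval_lt_iff]; simp [Tm.eval, hz]
      simp [this] at hlt

/-- The search visits a state, whose predecessors it marks. -/
def visit (m : ℕ) : Prog := block [
    .set .y (.get .bfs (.reg .hd)),
    .set .hd (.succ (.reg .hd)),
    forAtoms m fun a => block [.set .z (.get (.rhead a) (.reg .y)), markList a]]

theorem visit_runs {l : ℕ → ℕ → List ℕ} {y : ℕ} (hbfs : s.arr .bfs (s.reg .hd) = y)
    (hM : Marked D N s)
    (hc : ∀ a < 2 ^ m, IsChain (s.arr (.rnext a)) (s.arr (.rhead a) y) (l a y))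
    (hl : ∀ a < 2 ^ m, ∀ x ∈ l a y, x < N ∧ Live D x) :
    Runs (visit m) s (∑ a ∈ Finset.range (2 ^ m), (23 * (l a y).length + 6) + 7) fun s' =>
      Marked D N s' ∧ Grows s s' ∧ (∀ a < 2 ^ m, ∀ x ∈ l a y, s'.arr .live x = 1) ∧
      s'.reg .hd = s.reg .hd + 1 ∧ (∀ r : Arr, r ≠ .live → r ≠ .bfs → s'.arr r = s.arr r) := by
  have h₁ : Runs (.set .y (.get .bfs (.reg .hd))) s 3 (· = s.set .y y) :=
    ⟨_, _, .set _ _ _, le_rfl, by simp [Tm.eval, hbfs]⟩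
  refine (h₁.seq (t₂ := ∑ a ∈ Finset.range (2 ^ m), (23 * (l a y).length + 6) + 4) ?_).mono
    (by omega) fun _ h => h
  rintro _ rfl
  have h₂ : Runs (.set .hd (.succ (.reg .hd))) (s.set .y y) 3
      (· = (s.set .y y).set .hd (s.reg .hd + 1)) :=
    ⟨_, _, .set _ _ _, le_rfl, by simp [Tm.eval]⟩
  refine (h₂.seq (t₂ := ∑ a ∈ Finset.range (2 ^ m), (23 * (l a y).length + 6) + 1) ?_).mono
    (by omega) fun _ h => h
  rintro _ rfl
  refine (forAtoms_runs (s := (s.set .y y).set .hd (s.reg .hd + 1)) (fun c s' => s'.reg .y = y ∧ Marked D N s' ∧ Grows s s' ∧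
    (∀ a < c, ∀ x ∈ l a y, s'.arr .live x = 1) ∧
    s'.reg .hd = s.reg .hd + 1 ∧ (∀ r : Arr, r ≠ .live → r ≠ .bfs → s'.arr r = s.arr r)) _
    ⟨by simp, hM.congr (by simp) rfl rfl, Grows.of_eq (by simp) rfl rfl, by simp, by simp,
      fun _ _ _ => rfl⟩ ?_).mono le_rfl fun s' h => h.2
  rintro a ha s' ⟨hy, hM', hG, hdone, hhd, harr⟩
  have h₃ : Runs (.set .z (.get (.rhead a) (.reg .y))) s' 3
      (· = s'.set .z (s.arr (.rhead a) y)) :=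
    ⟨_, _, .set _ _ _, le_rfl, by simp [Tm.eval, hy, harr]⟩
  refine (h₃.seq (t₂ := 23 * (l a y).length + 3) ?_).mono (by omega) fun _ h => h
  rintro _ rfl
  refine (markList_runs (a := a) (l := l a y) (N := N) (D := D)
    (s := s'.set .z (s.arr (.rhead a) y)) ?_ (hl a ha)
    (hM'.congr (by simp) rfl rfl)).and_reg_eq.mono le_rfl ?_
  · simp only [Mem.set_reg, if_true, Mem.set_arr]
    rw [harr _ (by simp) (by simp)]
    exact hc a ha
  · rintro s'' ⟨⟨k₁, k₂, k₃⟩, kr, ka⟩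
    have hG' : Grows s' s'' := Grows.trans (Grows.of_eq (s' := s'.set .z (s.arr (.rhead a) y)) (by simp) rfl rfl) k₂
    refine ⟨?_, k₁, hG.trans hG', fun b hb x hx => ?_, ?_, fun r h₁ h₂ => ?_⟩
    · rw [kr _ (by simp [markList, mark, when, block, Cmd.WritesReg])]; simpa using hy
    · by_cases hba : b = a
      · subst hba; exact k₃ x hx
      · exact hG'.live x (hdone b (by omega) x hx)
    · rw [kr _ (by simp [markList, mark, when, block, Cmd.WritesReg])]; simpa using hhd
    · rw [ka _ (by simp [markList, mark, when, block, Cmd.WritesArr, h₁, h₂])]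
      exact harr r h₁ h₂

/-- The reverse breadth-first search. -/
def search (m : ℕ) : Prog := .loop (.lt (.reg .hd) (.reg .tl)) (visit m)

/-- Visiting a state costs a constant plus a multiple of the number of its predecessors. As no state
is visited twice, the total is bounded by the sum over all states, and this is linear because the
lists for one atom have at most `N` elements together. At the end the marked states are closed under
predecessors, and they include all accepting states. -/
theorem search_runs (hD : ∀ x < N, ∀ α p y, D x α = .step p y → y < N)
    (hat : ∀ α : Atom T, ∃ a < 2 ^ m, atomOf τ a = α) (h : Prepared m τ code D N N 0 s)
    (hhd : s.reg .hd = 0) :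
    Runs (search m) s ((29 * 2 ^ m + 10) * N + 3) fun s' =>
      ∀ x < N, (s'.arr .live x = 0 ∨ s'.arr .live x = 1) ∧ (s'.arr .live x = 1 ↔ Live D x) := by
  classical
  have hl : ∃ l : ℕ → ℕ → List ℕ, ∀ a < 2 ^ m,
      Listed N (s.arr (.rnext a)) (s.arr (.rhead a)) (StepRel τ D a) N (l a) := by
    refine ⟨fun a => if ha : a < 2 ^ m then (h.lists a ha).choose else fun _ => [], fun a ha => ?_⟩
    have := (h.lists a ha).choose_spec
    simpa [ha] using this
  obtain ⟨l, hl⟩ := hl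
  -- The full cost of the round that visits `y`: the bound of `visit_runs`, and three steps for the
  -- test of the loop.
  let W : ℕ → ℕ := fun y => ∑ a ∈ Finset.range (2 ^ m), (23 * (l a y).length + 6) + 10
  have hW : ∑ y ∈ Finset.range N, W y ≤ (29 * 2 ^ m + 10) * N := by
    have h₁ : ∑ y ∈ Finset.range N, ∑ a ∈ Finset.range (2 ^ m), (23 * (l a y).length + 6) ≤
        29 * 2 ^ m * N := by
      rw [Finset.sum_comm]
      -- For one atom, 23 steps per list element with at most `N` elements, and 6 steps for each of
      -- the `N` states.
      have : ∀ a ∈ Finset.range (2 ^ m), ∑ y ∈ Finset.range N, (23 * (l a y).length + 6) ≤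
          29 * N := fun a ha => by
        rw [Finset.sum_add_distrib, ← Finset.mul_sum]
        have := (hl a (Finset.mem_range.1 ha)).length
        simp
        omega
      refine (Finset.sum_le_sum this).trans ?_
      simp only [Finset.sum_const, Finset.card_range, smul_eq_mul]
      exact le_of_eq (by ring)
    simp only [W]
    rw [Finset.sum_add_distrib]
    simp only [Finset.sum_const, Finset.card_range, smul_eq_mul]
    rw [add_mul]
    omega
  -- The queue has no repetitions, so the costs of its entries are a part of the sum over all
  -- states. This also makes the truncated subtraction in the budget `u - W y` harmless.
  have hsum : ∀ s' : Mem Var Arr, Marked D N s' → ∀ k ≤ s'.reg .tl,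
      ∑ i ∈ Finset.range k, W (s'.arr .bfs i) ≤ ∑ y ∈ Finset.range N, W y := fun s' hM k hk => by
    rw [← Finset.sum_image (s := Finset.range k) (g := s'.arr .bfs) (f := W)]
    · refine Finset.sum_le_sum_of_subset fun y hy => ?_
      obtain ⟨i, hi, rfl⟩ := Finset.mem_image.1 hy
      exact Finset.mem_range.2 (hM.lt i ((Finset.mem_range.1 hi).trans_le hk))
    · intro i hi j hj e
      simp only [Finset.coe_range, Set.mem_Iio] at hi hj
      exact hM.inj i (by omega) j (by omega) e
  refine Runs.mono (t₁ := ∑ y ∈ Finset.range N, W y + 3) ?_ (by omega) fun _ h => h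
  refine Runs.loop (fun s' u => Marked D N s' ∧ Grows s s' ∧ s'.reg .hd ≤ s'.reg .tl ∧
    (∀ r : Arr, r ≠ .live → r ≠ .bfs → s'.arr r = s.arr r) ∧
    (∀ i < s'.reg .hd, ∀ a < 2 ^ m, ∀ x ∈ l a (s'.arr .bfs i), s'.arr .live x = 1) ∧
    u + ∑ i ∈ Finset.range (s'.reg .hd), W (s'.arr .bfs i) = ∑ y ∈ Finset.range N, W y + 3)
    ⟨h.marked, Grows.of_eq rfl rfl rfl, by omega, fun _ _ _ => rfl, by simp [hhd],
      by simp [hhd]⟩ ?_ ?_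
  · rintro s' u ⟨hM, hG, hle, harr, hclosed, hu⟩ hlt
    rw [Cnd.eval_lt_iff] at hlt
    simp only [Tm.eval] at hlt
    have hyN := hM.lt _ hlt
    have hylive := hM.sound _ hyN (hM.marked _ hlt)
    set y := s'.arr .bfs (s'.reg .hd) with hy
    refine ⟨_, (visit_runs (m := m) (l := l) hy.symm hM (fun a ha => ?_) fun a ha x hx => ?_).mono
      le_rfl ?_⟩
    · rw [harr _ (by simp) (by simp), harr _ (by simp) (by simp)]
      exact (hl a ha).chain y hyN
    · obtain ⟨hxN, p, hp⟩ := ((hl a ha).mem y hyN x).1 hx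
      exact ⟨hxN, live_of_step hp hylive⟩
    · rintro s'' ⟨hM', hG', hnew, hhd', harr'⟩
      have hb : ∀ i, i < s'.reg .hd + 1 → s''.arr .bfs i = s'.arr .bfs i := fun i hi =>
        hG'.bfs i (by omega)
      have hs := hsum s' hM (s'.reg .hd + 1) hlt
      have hs' := hsum s'' hM' (s'.reg .hd + 1) (hlt.trans_le hG'.tl)
      rw [Finset.sum_range_succ, ← hy] at hs
      have e : ∑ i ∈ Finset.range (s''.reg .hd), W (s''.arr .bfs i) =
          ∑ i ∈ Finset.range (s'.reg .hd), W (s'.arr .bfs i) + W y := by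
        rw [hhd', Finset.sum_range_succ, hb _ (by omega), ← hy]
        congr 1
        exact Finset.sum_congr rfl fun i hi => by
          rw [hb i (by have := Finset.mem_range.1 hi; omega)]
      refine ⟨u - W y, ⟨hM', hG.trans hG', ?_, fun r h₁ h₂ => (harr' r h₁ h₂).trans (harr r h₁ h₂),
        fun i hi a ha x hx => ?_, ?_⟩, ?_⟩
      · have := hG'.tl; omega
      · rw [hhd'] at hi
        rw [hb i hi] at hx
        by_cases hi' : i = s'.reg .hd
        · rw [hi', ← hy] at hx
          exact hnew a ha x hx
        · exact hG'.live x (hclosed i (by omega) a ha x hx)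
      · rw [e]; omega
      · have : W y = ∑ a ∈ Finset.range (2 ^ m), (23 * (l a y).length + 6) + 10 := rfl
        simp only [Cnd.cost, Tm.cost]
        omega
  · rintro s' u ⟨hM, hG, hle, harr, hclosed, hu⟩ hlt
    have hge : s'.reg .tl ≤ s'.reg .hd := by
      by_contra hc
      have : (Cnd.lt (.reg .hd) (.reg .tl)).eval s' = true := by
        rw [Cnd.eval_lt_iff]; simp only [Tm.eval]; omega
      simp [this] at hlt
    have := hsum s' hM (s'.reg .hd) hle
    refine ⟨by simp only [Cnd.cost, Tm.cost]; omega, fun x hx => ⟨?_, hM.sound x hx, ?_⟩⟩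
    · exact (hM.queued x hx).imp id And.left
    · rintro ⟨α, w, hw⟩
      -- Backwards along the accepted word: its last state was marked in the preparation, and each
      -- earlier one is a predecessor of a marked state, which has been taken from the queue since
      -- the queue is exhausted.
      induction w generalizing x α with
      | nil =>
        obtain ⟨a, ha, rfl⟩ := hat α
        exact hG.live x (h.acc x hx a ha (Or.inl hx) hw)
      | cons z w ih =>
        obtain ⟨p, β⟩ := z
        obtain ⟨y, hy, hw⟩ := hw
        obtain ⟨a, ha, rfl⟩ := hat α
        have hyN := hD x hx _ _ _ hy
        obtain ⟨i, hi, rfl⟩ := ((hM.queued y hyN).resolve_left (by rw [ih y hyN β hw]; simp)).2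
        exact hclosed i (by omega) a ha x (((hl a ha).mem _ hyN x).2 ⟨hx, p, hy⟩)

end Prog

end Search

end GKAT

namespace GKAT

/-! ### The phases of normalization put together -/

section NormalizeRuns

variable {T P : Type*} {m : ℕ} {τ : T → ℕ} {code : P → ℕ} {s s' s'' : Mem Var Arr}
  {D : ℕ → Row T P} {N : ℕ}

namespace Prog

/-- Unmarks a state, and clears its lists of predecessors. -/
def clearState (m : ℕ) : Prog := block [
    .put .live (.reg .x) (.lit 0),
    forAtoms m fun a => .put (.rhead a) (.reg .x) (.lit 0)]

theorem clearState_run {k : ℕ} (hx : s.reg .x = k) (j : ℕ) :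
    ((clearState m).run s).arr .live j = (if j = k then 0 else s.arr .live j) ∧
    ∀ a < 2 ^ m, ((clearState m).run s).arr (.rhead a) j =
      if j = k then 0 else s.arr (.rhead a) j := by
  have hloc : ∀ a, Local a (.put (.rhead a) (.reg .x) (.lit 0)) := fun a =>
    local_put rfl trivial trivial
  have hrun : (clearState m).run s = (forAtoms m fun a => .put (.rhead a) (.reg .x) (.lit 0)).run
      (s.put .live k 0) := by
    simp [clearState, block, Cmd.run, Tm.eval, hx]
  rw [hrun]
  obtain ⟨-, h₂, h₃⟩ := forAtoms_run_local (m := m) hloc (s.put .live k 0)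
  refine ⟨?_, fun a ha => ?_⟩
  · rw [h₂ _ rfl]; simp
  · rw [h₃ _ a rfl ha]; simp [Cmd.run, Tm.eval, hx]

theorem clearState_writesReg (x : Var) : ¬ (clearState m).WritesReg x := by
  simp [clearState, block, forAtoms_writesReg, Cmd.WritesReg]

theorem clearState_writesArr {r : Arr} (h : (clearState m).WritesArr r) :
    r = .live ∨ ∃ a, r = .rhead a := by
  simp only [clearState, block, Cmd.WritesArr, forAtoms_writesArr] at h
  rcases h with h | ⟨a, -, h⟩
  · exact Or.inl h
  · exact Or.inr ⟨a, h⟩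

theorem clearState_loopFree (m : ℕ) : (clearState m).LoopFree := by
  simp [clearState, block, forAtoms_loopFree, Cmd.LoopFree]

theorem clear_runs (hN : s.reg .states = N) :
    Runs (forUp .x .states (clearState m)) s (((clearState m).bound + 6) * N + 5) fun s' =>
      ∀ x < N, s'.arr .live x = 0 ∧ ∀ a < 2 ^ m, s'.arr (.rhead a) x = 0 := by
  refine forUp_runs_inv (clearState_loopFree m) (clearState_writesReg _) (clearState_writesReg _)
    (by simp) hN (fun k s' => ∀ x < k, s'.arr .live x = 0 ∧ ∀ a < 2 ^ m, s'.arr (.rhead a) x = 0)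
    (by simp) fun k _ s' hx h x hxk => ?_
  obtain ⟨h₁, h₂⟩ := clearState_run (m := m) hx x
  rw [Mem.set_arr]
  by_cases e : x = k
  · rw [if_pos e] at h₁
    refine ⟨h₁, fun a ha => ?_⟩
    rw [h₂ a ha, if_pos e]
  · rw [if_neg e] at h₁
    refine ⟨h₁.trans (h x (by omega)).1, fun a ha => ?_⟩
    rw [h₂ a ha, if_neg e]
    exact (h x (by omega)).2 a ha

/-- The preparation for the search, for one state. -/
def prepareState (m : ℕ) : Prog := forAtoms m prepareAtom

theorem prepareState_loopFree (m : ℕ) : (prepareState m).LoopFree := by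
  simp [prepareState, forAtoms_loopFree, prepareAtom_loopFree]

theorem prepareState_writesReg {x : Var} (h₁ : x ≠ .tl) (h₂ : x ≠ .y) :
    ¬ (prepareState m).WritesReg x := by
  simp [prepareState, forAtoms_writesReg, prepareAtom_writesReg h₁ h₂]

theorem prepare_runs (hD : ∀ x < N, ∀ α p y, D x α = .step p y → y < N) (hN : s.reg .states = N)
    (h : Prepared m τ code D N 0 0 s) :
    Runs (forUp .x .states (prepareState m)) s (((prepareState m).bound + 6) * N + 5)
      (Prepared m τ code D N N 0) := by
  have hset : ∀ {k c s' v}, Prepared m τ code D N k c s' →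
      Prepared m τ code D N k c (s'.set .x v) := fun h =>
    ⟨fun x hx a ha => (h.rows x hx a ha).congr rfl rfl rfl, h.marked.congr (by simp) rfl rfl,
      h.acc, h.lists⟩
  refine forUp_runs_inv (prepareState_loopFree m) (prepareState_writesReg (by simp) (by simp))
    (prepareState_writesReg (by simp) (by simp)) (by simp) hN
    (fun k s' => Prepared m τ code D N k 0 s') (hset h) fun k hk s' hx h => hset ?_
  have := forAtoms_run_inv (m := m) (f := prepareAtom)
    (fun c s' => s'.reg .x = k ∧ Prepared m τ code D N k c s') ⟨hx, h⟩
    fun c hc s' h => ⟨by rw [Cmd.run_reg_of_not_writes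
      (prepareAtom_writesReg (by simp) (by simp)), h.1], prepareAtom_run hD hk hc h.1 h.2⟩
  obtain ⟨-, h₁⟩ := this
  -- The state `k` with all `2 ^ m` atoms dealt with is the same situation as the state `k + 1` with
  -- none.
  refine ⟨h₁.rows, h₁.marked, fun x hx a ha hxa he => h₁.acc x hx a ha (by omega) he,
    fun a ha => ?_⟩
  have := h₁.lists a ha
  rw [if_pos ha] at this
  simpa [prepareState] using this

/-- Redirects the transitions of a state to dead states to rejection. -/
def pruneState (m : ℕ) : Prog := forAtoms m fun a =>
    when (.and (resIs a .delta (.reg .x) 2)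
        (.eq (.get .live (.get (.tgt .delta a) (.reg .x))) (.lit 0)))
      (.put (.res .delta a) (.reg .x) (.lit 0))

theorem pruneState_local (a : ℕ) : Local a (when (.and (resIs a .delta (.reg .x) 2)
        (.eq (.get .live (.get (.tgt .delta a) (.reg .x))) (.lit 0)))
      (.put (.res .delta a) (.reg .x) (.lit 0))) :=
  local_ite ⟨usesIn_resIs (shared_reg .x) _, ⟨⟨Or.inl rfl, Or.inr rfl, trivial⟩, trivial⟩⟩
    (local_put rfl trivial trivial) ⟨trivial, fun _ h => h.elim, fun _ h => h⟩

/-- The marks were computed before any entry is redirected, and redirecting uses only row `k` and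
the marks. So the table can be changed in place without affecting the decisions for other states. -/
theorem pruneState_run {k : ℕ} (hx : s.reg .x = k) (hk : HoldsRow m τ code s .delta k (D k))
    (hlive : ∀ a < 2 ^ m, ∀ p y, D k (atomOf τ a) = .step p y →
      (s.arr .live y = 0 ∨ s.arr .live y = 1) ∧ (s.arr .live y = 1 ↔ Live D y)) :
    HoldsRow m τ code ((pruneState m).run s) .delta k (prune D k) ∧
    (∀ j, j ≠ k → SameRow m s ((pruneState m).run s) .delta j) := by
  refine ⟨holdsRow_forAtoms pruneState_local fun a ha => ?_, fun j hj =>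
    sameRow_forAtoms pruneState_local fun a _ => ?_⟩
  · have hv : Holds code s .delta a ((Tm.reg Var.x).eval s) (D k (atomOf τ a)) := by
      simp only [Tm.eval, hx]; exact hk a ha
    have hv' := hk a ha
    have hcond : (Cnd.and (resIs a .delta (.reg .x) 2)
        (.eq (.get .live (.get (.tgt .delta a) (.reg .x))) (.lit 0))).eval s = true ↔
        (∃ p y, D k (atomOf τ a) = .step p y) ∧ s.arr .live (s.arr (.tgt .delta a) k) = 0 := by
      rw [Cnd.eval_and_iff, resIs_two_iff hv, Cnd.eval_eq_iff]
      simp only [Tm.eval, hx]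
    simp only [when, Cmd.run, prune]
    split_ifs with hb <;> rw [hcond] at hb
    · obtain ⟨⟨p, y, hd⟩, h₀⟩ := hb
      obtain ⟨h₁, h₂⟩ := hlive a ha p y hd
      rw [hd] at hv'
      rw [hv'.2.2] at h₀
      have hl : ¬ Live D y := fun h => by rw [← h₂, h₀] at h; simp at h
      simp [hd, Entry.prune, hl, Holds, Tm.eval, hx]
    · cases hd : D k (atomOf τ a) with
      | rej => rwa [hd] at hv'
      | acc => rwa [hd] at hv'
      | step p y =>
        rw [hd] at hv'
        obtain ⟨h₁, h₂⟩ := hlive a ha p y hd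
        have hl : Live D y := h₂.1 (h₁.resolve_left fun h₀ => hb ⟨⟨p, y, hd⟩, by rw [hv'.2.2, h₀]⟩)
        rwa [Entry.prune, if_pos hl]
  · simp only [when, Cmd.run, Tm.eval, hx]
    split_ifs <;> simp [hj]

theorem pruneState_loopFree (m : ℕ) : (pruneState m).LoopFree := by
  simp [pruneState, forAtoms_loopFree, when, Cmd.LoopFree]

theorem pruneState_writesReg {x : Var} : ¬ (pruneState m).WritesReg x := by
  simp [pruneState, forAtoms_writesReg, when, Cmd.WritesReg]

theorem pruneState_writesArr_live : ¬ (pruneState m).WritesArr .live := by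
  simp [pruneState, forAtoms_writesArr, when, Cmd.WritesArr]

theorem prune_runs (hD : ∀ x < N, ∀ α p y, D x α = .step p y → y < N) (h : HoldsMap m τ code s N D)
    (hlive : ∀ x < N, (s.arr .live x = 0 ∨ s.arr .live x = 1) ∧ (s.arr .live x = 1 ↔ Live D x)) :
    Runs (forUp .x .states (pruneState m)) s (((pruneState m).bound + 6) * N + 5)
      fun s' => ∀ x < N, HoldsRow m τ code s' .delta x (prune D x) := by
  refine (forUp_runs_inv (pruneState_loopFree m) pruneState_writesReg pruneState_writesReg
    (by simp) h.states (fun k s' => s'.arr .live = s.arr .live ∧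
      (∀ x < N, HoldsRow m τ code s' .delta x (if x < k then prune D x else D x)))
    ⟨rfl, fun x hx => ?_⟩ fun k hk s' hx h' => ?_).mono le_rfl fun s' h x hx => ?_
  · rw [if_neg (by omega)]
    exact (h.rows x hx).of_sameRow (SameRow.of_arr_eq fun _ => rfl)
  · obtain ⟨hl, hr⟩ := h'
    have hk' := hr k hk
    rw [if_neg (by omega)] at hk'
    obtain ⟨h₁, h₂⟩ := pruneState_run hx hk' fun a _ p y hy => by
      rw [hl]; exact hlive y (hD k hk _ p y hy)
    refine ⟨?_, fun x hx => HoldsRow.of_sameRow ?_ (SameRow.of_arr_eq fun _ => rfl)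
      (s := (pruneState m).run s')⟩
    · rw [Mem.set_arr, Cmd.run_arr_of_not_writes pruneState_writesArr_live, hl]
    · by_cases e : x = k
      · subst e
        rw [if_pos (by omega)]
        exact h₁
      · have := (hr x hx).of_sameRow (h₂ x e)
        rwa [show (if x < k + 1 then prune D x else D x) = if x < k then prune D x else D x by
          split_ifs <;> first | rfl | omega]
  · have := h.2 x hx
    rwa [if_pos hx] at this

/-- A bound for the number of steps of `normalize` per state. -/
def normalizeCost (m : ℕ) : ℕ := (clearState m).bound + (prepareState m).bound +
  (pruneState m).bound + 29 * 2 ^ m + 60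

theorem normalize_runs (hD : ∀ x < N, ∀ α p y, D x α = .step p y → y < N)
    (hat : ∀ α : Atom T, ∃ a < 2 ^ m, atomOf τ a = α) (hN : 0 < N) (h : HoldsMap m τ code s N D) :
    Runs (normalize m) s (normalizeCost m * N) fun s' =>
      HoldsMap m τ code s' N (prune D) ∧ s'.reg .start1 = s.reg .start1 ∧
        s'.reg .start2 = s.reg .start2 := by
  have main : Runs (normalize m) s (normalizeCost m * N) fun s' =>
      ∀ x < N, HoldsRow m τ code s' .delta x (prune D x) := by
    refine Runs.mono (t₁ := (((clearState m).bound + 6) * N + 5) + (4 +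
      ((((prepareState m).bound + 6) * N + 5) + (((29 * 2 ^ m + 10) * N + 3) +
        (((pruneState m).bound + 6) * N + 5))))) ?_ ?_ fun _ h => h
    · refine ((clear_runs (m := m) h.states).and_reg_eq).seq fun s₁ ⟨k₁, r₁, a₁⟩ => ?_
      have hst₁ : s₁.reg .states = N := by
        rw [r₁ _ (by simp [forUp, block, Cmd.WritesReg, clearState_writesReg]), h.states]
      have harr₁ : ∀ r : Arr, r ≠ .live → (∀ a, r ≠ .rhead a) → s₁.arr r = s.arr r :=
        fun r h₁ h₂ => a₁ r fun hw => by
          simp only [forUp, block, Cmd.WritesArr, or_false, false_or] at hw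
          rcases clearState_writesArr hw with h | ⟨a, h⟩
          · exact h₁ h
          · exact h₂ a h
      set s₂ := (s₁.set .hd 0).set .tl 0 with hs₂
      have hp : Prepared m τ code D N 0 0 s₂ := by
        refine ⟨fun x hx a ha => (h.rows x hx a ha).congr
          (congrFun (harr₁ _ (by simp) (by simp)) x) (congrFun (harr₁ _ (by simp) (by simp)) x)
          (congrFun (harr₁ _ (by simp) (by simp)) x), ⟨?_, ?_, ?_, ?_, ?_⟩, fun x hx a ha hc => ?_,
          fun a ha => ⟨fun _ => [], ⟨fun y hy => (k₁ y hy).2 a ha, ?_, ?_⟩⟩⟩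
        · simp [hs₂]
        · simp [hs₂]
        · exact fun x hx => Or.inl (k₁ x hx).1
        · simp [hs₂]
        · intro x hx hl
          have := (k₁ x hx).1
          simp [hs₂, this] at hl
        · omega
        · simp
        · simp
      have e : Runs (.seq (.set .hd (.lit 0)) (.seq (.set .tl (.lit 0))
          (block [forUp .x .states (prepareState m), search m,
            forUp .x .states (pruneState m)]))) s₁ (2 + (2 +
            ((((prepareState m).bound + 6) * N + 5) + (((29 * 2 ^ m + 10) * N + 3) +
              (((pruneState m).bound + 6) * N + 5))))) (fun s' =>
              ∀ x < N, HoldsRow m τ code s' .delta x (prune D x)) := by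
        refine Runs.seq (R := (· = s₁.set .hd 0)) ⟨_, _, .set _ _ _, le_rfl, rfl⟩ ?_
        rintro _ rfl
        refine Runs.seq (R := (· = s₂)) ⟨_, _, .set _ _ _, le_rfl, rfl⟩ ?_
        rintro _ rfl
        refine (prepare_runs hD (by simp [hs₂, hst₁]) hp).and_reg_eq.seq
          (t₂ := ((29 * 2 ^ m + 10) * N + 3) + (((pruneState m).bound + 6) * N + 5))
          fun s₃ ⟨k₃, r₃, a₃⟩ => ?_
        have hhd : s₃.reg .hd = 0 := by
          rw [r₃ _ (by simp [forUp, block, Cmd.WritesReg, prepareState, forAtoms_writesReg,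
            prepareAtom_writesReg])]
          simp [hs₂]
        have hst₃ : s₃.reg .states = N := by
          rw [r₃ _ (by simp [forUp, block, Cmd.WritesReg, prepareState, forAtoms_writesReg,
            prepareAtom_writesReg])]
          simp [hs₂, hst₁]
        refine (search_runs hD hat k₃ hhd).and_reg_eq.seq fun s₄ ⟨k₄, r₄, a₄⟩ => ?_
        have harr₄ : ∀ r : Arr, r ≠ .live → r ≠ .bfs → s₄.arr r = s₃.arr r := fun r h₁ h₂ =>
          a₄ r (by simp [search, visit, markList, mark, when, block, Cmd.WritesArr,
            forAtoms_writesArr, h₁, h₂])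
        refine prune_runs hD ⟨?_, fun x hx a ha => (k₃.rows x hx a ha).congr
          (congrFun (harr₄ _ (by simp) (by simp)) x) (congrFun (harr₄ _ (by simp) (by simp)) x)
          (congrFun (harr₄ _ (by simp) (by simp)) x)⟩ k₄
        rw [r₄ _ (by simp [search, visit, markList, mark, when, block, Cmd.WritesReg,
          forAtoms_writesReg]), hst₃]
      exact Runs.mono e (by omega) fun _ h => h
    · simp only [normalizeCost]
      have : 22 ≤ 22 * N := by omega
      ring_nf at this ⊢
      omega
  refine main.and_reg_eq.mono le_rfl fun s' ⟨h₁, h₂, _⟩ => ?_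
  have hw : ∀ x, x ≠ .x → x ≠ .hd → x ≠ .tl → x ≠ .y → x ≠ .z → ¬ (normalize m).WritesReg x := by
    intro x g₁ g₂ g₃ g₄ g₅
    simp [normalize, mark, when, forUp, block, Cmd.WritesReg, forAtoms_writesReg, g₁, g₂, g₃, g₄,
      g₅]
  refine ⟨⟨?_, h₁⟩, h₂ _ (hw _ ?_ ?_ ?_ ?_ ?_), h₂ _ (hw _ ?_ ?_ ?_ ?_ ?_)⟩
  · rw [h₂ _ (hw _ (by simp) (by simp) (by simp) (by simp) (by simp)), h.states]
  all_goals simp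

end Prog

end NormalizeRuns

end GKAT

namespace GKAT

/-! ## Union-find on the machine -/

section Find

variable {s : Mem Var Arr} {N K : ℕ} {rt : ℕ → ℕ}

theorem compress_zero (p : ℕ → ℕ) (x r : ℕ) : compress p x 0 r = p := by
  funext z; simp [compress, path]

/-- The second loop of `find` compresses one node per round; this identifies a round with prolonging
the compressed path by one. -/
theorem compress_succ (p : ℕ → ℕ) (x i r : ℕ) :
    compress p x (i + 1) r = Function.update (compress p x i r) (p^[i] x) r := by
  funext z
  by_cases h : z = p^[i] x
  · subst h
    simp only [compress, Function.update_self]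
    exact if_pos (Finset.mem_image.2 ⟨i, by simp, rfl⟩)
  · rw [Function.update_of_ne h]
    have : z ∈ path p x (i + 1) ↔ z ∈ path p x i := by
      simp only [path, Finset.mem_image, Finset.mem_range]
      constructor
      · rintro ⟨j, hj, rfl⟩
        exact ⟨j, by rcases Nat.lt_succ_iff_lt_or_eq.1 hj with h' | rfl; exacts [h', (h rfl).elim],
          rfl⟩
      · rintro ⟨j, hj, rfl⟩
        exact ⟨j, by omega, rfl⟩
    simp only [compress, this]

namespace Prog

/-- The length `l` of the path appears both in the running time and in the inequality for the
potential, so that the drop in potential can pay for it. Each node of the path costs 8 steps on the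
way up and 12 in the compression, whence the factor 20 in `credit`. -/
theorem find_runs {v r : Var} (hvr : v ≠ r) (hrz : r ≠ .z) (hrw : r ≠ .w)
    (h : Forest N (s.arr .parent) (s.arr .rank) rt) {x : ℕ} (hx : s.reg v = x) (hN : x < N)
    (hK : N ≤ ack K 1) :
    ∃ l, Runs (find v r) s (20 * l + 13) fun s' => s'.reg r = rt x ∧
      Forest N (s'.arr .parent) (s'.arr .rank) rt ∧
      roots N (s'.arr .parent) = roots N (s.arr .parent) ∧
      potential N K (s'.arr .parent) (s'.arr .rank) + l ≤
        potential N K (s.arr .parent) (s.arr .rank) + (K + 1) := by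
  obtain ⟨l, hl, hl'⟩ := h.exists_path hN
  set p := s.arr .parent with hp
  have hroot : p (rt x) = rt x := h.p_rt x hN
  refine ⟨l, ?_⟩
  have h₁ : Runs (.set r (.reg v)) s 2 (· = s.set r x) :=
    ⟨_, _, .set _ _ _, le_rfl, by simp [Tm.eval, hx]⟩
  refine (h₁.seq (t₂ := 20 * l + 11) ?_).mono (by omega) fun _ h => h
  rintro _ rfl
  have h₂ : Runs (.loop (.not (.eq (.get .parent (.reg r)) (.reg r)))
      (.set r (.get .parent (.reg r)))) (s.set r x) (8 * l + 5) (· = s.set r (rt x)) := by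
    refine Runs.loop (fun s' u => ∃ i ≤ l, s' = s.set r (p^[i] x) ∧ u = 8 * (l - i) + 5)
      ⟨0, by omega, rfl, rfl⟩ ?_ ?_
    · rintro s' u ⟨i, hi, rfl, rfl⟩ hb
      rw [Cnd.eval_not_iff, Cnd.eval_eq_iff] at hb
      simp only [Tm.eval, Mem.set_reg, if_true, Mem.set_arr, ← hp] at hb
      have hil : i < l := by
        rcases Nat.lt_or_eq_of_le hi with h | rfl
        · exact h
        · rw [hl] at hb; exact (hb hroot).elim
      refine ⟨3, _, _, .set _ _ _, le_rfl, 8 * (l - (i + 1)) + 5, ⟨i + 1, hil, ?_, rfl⟩, ?_⟩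
      · refine Mem.ext' (fun y => ?_) fun _ => rfl
        simp only [Tm.eval, Mem.set_reg, if_true, Mem.set_arr, ← hp, Function.iterate_succ_apply']
        split_ifs <;> rfl
      · simp only [Cnd.cost, Tm.cost]; omega
    · rintro s' u ⟨i, hi, rfl, rfl⟩ hb
      have hb' : ¬ (Cnd.not (.eq (.get .parent (.reg r)) (.reg r))).eval (s.set r (p^[i] x)) = true := by
        simp [hb]
      rw [Cnd.eval_not_iff, Cnd.eval_eq_iff, not_not] at hb'
      simp only [Tm.eval, Mem.set_reg, if_true, Mem.set_arr, ← hp] at hb'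
      have hil : i = l := by
        by_contra hc
        exact hl' i (by omega) hb'
      subst hil
      rw [hl]
      exact ⟨by simp [Cnd.cost, Tm.cost], rfl⟩
  refine (h₂.seq (t₂ := 12 * l + 6) ?_).mono (by omega) fun _ h => h
  rintro _ rfl
  have h₃ : Runs (.set .z (.reg v)) (s.set r (rt x)) 2 (· = (s.set r (rt x)).set .z x) :=
    ⟨_, _, .set _ _ _, le_rfl, by simp [Tm.eval, hx, hvr]⟩
  refine (h₃.seq (t₂ := 12 * l + 4) ?_).mono (by omega) fun _ h => h
  rintro _ rfl
  refine Runs.loop (fun s' u => ∃ i ≤ l, s'.reg .z = p^[i] x ∧ s'.reg r = rt x ∧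
    s'.arr .parent = compress p x i (rt x) ∧ s'.arr .rank = s.arr .rank ∧ u = 12 * (l - i) + 4)
    ⟨0, by omega, by simp, by simp [hrz], by rw [compress_zero]; rfl, rfl, rfl⟩ ?_ ?_
  · rintro s' u ⟨i, hi, hz, hr, hpar, hrank, rfl⟩ hb
    rw [Cnd.eval_not_iff, Cnd.eval_eq_iff] at hb
    simp only [Tm.eval, hz, hr] at hb
    have hil : i < l := by
      rcases Nat.lt_or_eq_of_le hi with h | rfl
      · exact h
      · exact (hb hl).elim
    -- By the ranks, the path does not repeat a node. The cell read next is therefore not yet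
    -- compressed, and the second loop follows the original path.
    have hnot : p^[i] x ∉ path p x i := by
      simp only [path, Finset.mem_image, Finset.mem_range, not_exists, not_and]
      intro j hj e
      have := h.rank_iterate_lt hN hl' hj hi
      rw [e] at this
      omega
    have hrun : (block [.set .w (.get .parent (.reg .z)), .put .parent (.reg .z) (.reg r),
        .set .z (.reg .w)] : Prog).run s' =
        ((s'.set .w (p^[i + 1] x)).put .parent (p^[i] x) (rt x)).set .z (p^[i + 1] x) := by
      have e : s'.arr .parent (p^[i] x) = p^[i + 1] x := by
        rw [hpar, compress, if_neg hnot, Function.iterate_succ_apply']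
      simp [block, Cmd.run, Tm.eval, hz, e, hrw, hr]
    refine ⟨8, Runs.of_loopFree (by simp [block, Cmd.LoopFree])
      (by simp [block, Cmd.bound, Tm.cost]) ?_⟩
    rw [hrun]
    refine ⟨12 * (l - (i + 1)) + 4, ⟨i + 1, hil, by simp, by simp [hrz, hrw, hr], ?_, ?_, rfl⟩, ?_⟩
    · funext j
      rw [compress_succ, ← hpar]
      by_cases hj : j = p^[i] x
      · subst hj; simp
      · simp [hj]
    · rw [Mem.set_arr, Mem.put_arr_of_ne _ (by simp), Mem.set_arr, hrank]
    · simp only [Cnd.cost, Tm.cost]; omega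
  · rintro s' u ⟨i, hi, hz, hr, hpar, hrank, rfl⟩ hb
    have hb' : ¬ (Cnd.not (.eq (.reg .z) (.reg r))).eval s' = true := by simp [hb]
    rw [Cnd.eval_not_iff, Cnd.eval_eq_iff, not_not] at hb'
    simp only [Tm.eval, hz, hr] at hb'
    have hil : i = l := by
      by_contra hc
      refine hl' i (by omega) ?_
      rw [hb', hroot]
    subst hil
    refine ⟨by simp [Cnd.cost, Tm.cost], hr, ?_, ?_, ?_⟩
    · rw [hpar, hrank]; exact h.compress hN hl'
    · rw [hpar]; exact h.roots_compress hN hl'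
    · rw [hpar, hrank]; exact h.potential_compress hK hN hl'

theorem find_writesReg {v r x : Var} (hx : x ≠ r) (hz : x ≠ .z) (hw : x ≠ .w) :
    ¬ (find v r).WritesReg x := by
  simp [find, block, Cmd.WritesReg, hx, hz, hw]

theorem find_writesArr {v r : Var} {a : Arr} (ha : a ≠ .parent) : ¬ (find v r).WritesArr a := by
  simp [find, block, Cmd.WritesArr, ha]

theorem union_loopFree : union.LoopFree := by
  simp [union, block, when, Cmd.LoopFree]

/-- The last clause is symmetric in `a` and `b`: which root wins is decided by rank, but the
resulting partition does not depend on it. -/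
theorem union_run (h : Forest N (s.arr .parent) (s.arr .rank) rt) {a b : ℕ} (ha : a < N)
    (hb : b < N) (hab : a ≠ b) (hpa : s.arr .parent a = a) (hpb : s.arr .parent b = b)
    (hrx : s.reg .rx = a) (hry : s.reg .ry = b) :
    ∃ rt', Forest N ((union.run s).arr .parent) ((union.run s).arr .rank) rt' ∧
      roots N ((union.run s).arr .parent) + 1 = roots N (s.arr .parent) ∧
      potential N K ((union.run s).arr .parent) ((union.run s).arr .rank) ≤
        potential N K (s.arr .parent) (s.arr .rank) + K ∧
      ∀ x y, rt' x = rt' y ↔ rt x = rt y ∨ (rt x = a ∧ rt y = b) ∨ (rt x = b ∧ rt y = a) := by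
  have key : ∀ a b : ℕ, a ≠ b → ∀ x y : ℕ, ((if rt x = a then b else rt x) =
      if rt y = a then b else rt y) ↔
      rt x = rt y ∨ (rt x = a ∧ rt y = b) ∨ (rt x = b ∧ rt y = a) := by
    intro a b hab x y
    split_ifs <;> omega
  by_cases hlt : s.arr .rank a < s.arr .rank b
  · have hrun : union.run s = s.put .parent a b := by
      simp [union, Cmd.run, Cnd.eval_lt_iff, Tm.eval, hrx, hry, hlt]
    rw [hrun]
    obtain ⟨h₁, h₂, h₃⟩ := h.link (K := K) ha hb hab hpa hpb hlt.le
      (p' := (s.put .parent a b).arr .parent) (rk' := (s.put .parent a b).arr .rank)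
      (fun z => by simp) (fun z => by simp; omega)
    exact ⟨_, h₁, h₂, h₃, key a b hab⟩
  · by_cases heq : s.arr .rank a = s.arr .rank b
    · have hrun : union.run s = (s.put .parent b a).put .rank a (s.arr .rank a + 1) := by
        simp [union, when, block, Cmd.run, Cnd.eval_lt_iff, Cnd.eval_eq_iff, Tm.eval, hrx, hry, heq]
      rw [hrun]
      obtain ⟨h₁, h₂, h₃⟩ := h.link (K := K) hb ha hab.symm hpb hpa (by omega)
        (p' := ((s.put .parent b a).put .rank a (s.arr .rank a + 1)).arr .parent)
        (rk' := ((s.put .parent b a).put .rank a (s.arr .rank a + 1)).arr .rank)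
        (fun z => by simp) (fun z => by simp [heq])
      refine ⟨_, h₁, h₂, h₃, fun x y => ?_⟩
      rw [key b a hab.symm]; tauto
    · have hrun : union.run s = s.put .parent b a := by
        simp [union, when, block, Cmd.run, Cnd.eval_lt_iff, Cnd.eval_eq_iff, Tm.eval, hrx, hry, heq,
          hlt]
      rw [hrun]
      obtain ⟨h₁, h₂, h₃⟩ := h.link (K := K) hb ha hab.symm hpb hpa (by omega)
        (p' := (s.put .parent b a).arr .parent) (rk' := (s.put .parent b a).arr .rank)
        (fun z => by simp) (fun z => by simp; omega)
      refine ⟨_, h₁, h₂, h₃, fun x y => ?_⟩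
      rw [key b a hab.symm]; tauto

theorem disjointForest_runs (hN : s.reg .states = N) :
    Runs disjointForest s (14 * N + 5) fun s' =>
      Forest N (s'.arr .parent) (s'.arr .rank) id ∧ roots N (s'.arr .parent) ≤ N ∧
        potential N K (s'.arr .parent) (s'.arr .rank) = N * K := by
  have := forUp_runs_inv (v := .x) (b := .states)
    (c := block [.put .parent (.reg .x) (.reg .x), .put .rank (.reg .x) (.lit 0)])
    (by simp [block, Cmd.LoopFree]) (by simp [block, Cmd.WritesReg])
    (by simp [block, Cmd.WritesReg]) (by simp) hN
    (fun k s' => ∀ x < k, s'.arr .parent x = x ∧ s'.arr .rank x = 0) (by simp)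
    fun k _ s' hx h x hxk => by
      by_cases e : x = k
      · simp [block, Cmd.run, Tm.eval, hx, e]
      · simp [block, Cmd.run, Tm.eval, hx, e, h x (by omega)]
  refine this.mono ?_ fun s' h => forest_id N (fun x hx => (h x hx).1) fun x hx => (h x hx).2
  simp only [block, Cmd.bound, Tm.cost]
  omega

end Prog

end Find

end GKAT

namespace GKAT

/-! ## The algorithm of Hopcroft and Karp -/

section HopcroftKarp

variable {T P : Type*} {m : ℕ} {τ : T → ℕ} {code : P → ℕ} {s s' : Mem Var Arr}
  {D : ℕ → Row T P} {N K : ℕ} {rt : ℕ → ℕ}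

namespace Prog

/-- In the first and the last outcome no targets have to be compared, so matching, or failing to
match, holds for every relation at once. Only in the middle one does the answer depend on a pair
that is still to be checked. -/
theorem compare_run {a x y : ℕ} {u v : Entry P} (hx : s.reg .x = x) (hy : s.reg .y = y)
    (hu : Holds code s .delta a x u) (hv : Holds code s .delta a y v)
    (hcode : ∀ p p' x' y', u = .step p x' → v = .step p' y' → code p = code p' → p = p') :
    ((compare a).run s = s ∧ ∀ E, u.Match E v) ∨
    (∃ p x' y', u = .step p x' ∧ v = .step p y' ∧ (compare a).run s =
      ((s.put .todoX (s.reg .tl) x').put .todoY (s.reg .tl) y').set .tl (s.reg .tl + 1)) ∨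
    ((compare a).run s = s.set .out 0 ∧ ∀ E, ¬ u.Match E v) := by
  cases u <;> cases v <;> simp only [Holds] at hu hv
  case step.step p x' p' y' =>
    obtain ⟨hu₁, hu₂, hu₃⟩ := hu
    obtain ⟨hv₁, hv₂, hv₃⟩ := hv
    by_cases hp : code p = code p'
    · obtain rfl := hcode _ _ _ _ rfl rfl hp
      refine Or.inr (Or.inl ⟨p, x', y', rfl, rfl, ?_⟩)
      simp [compare, resIs, push, block, Cmd.run, Cnd.eval_and_iff, Cnd.eval_not_iff,
        Cnd.eval_eq_iff, Tm.eval, hx, hy, hu₁, hu₂, hu₃, hv₁, hv₂, hv₃]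
    · refine Or.inr (Or.inr ⟨?_, fun E h => hp (by rw [h.1])⟩)
      simp [compare, resIs, Cmd.run, Cnd.eval_and_iff, Cnd.eval_not_iff,
        Cnd.eval_eq_iff, Tm.eval, hx, hy, hu₁, hu₂, hv₁, hv₂, hp]
  case rej.rej =>
    refine Or.inl ⟨?_, fun E => trivial⟩
    simp [compare, resIs, Cmd.run, Cnd.eval_and_iff, Cnd.eval_not_iff,
      Cnd.eval_eq_iff, Tm.eval, hx, hy, hu, hv]
  case acc.acc =>
    refine Or.inl ⟨?_, fun E => trivial⟩
    simp [compare, resIs, Cmd.run, Cnd.eval_and_iff, Cnd.eval_not_iff,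
      Cnd.eval_eq_iff, Tm.eval, hx, hy, hu, hv]
  all_goals
    refine Or.inr (Or.inr ⟨?_, fun E h => h⟩)
    simp [compare, resIs, Cmd.run, Cnd.eval_and_iff, Cnd.eval_not_iff,
      Cnd.eval_eq_iff, Tm.eval, hx, hy, hu, hv]

/-- The comparison of the rows of `x` and `y`. -/
def compareRows (m : ℕ) : Prog := forAtoms m fun a => when (.eq (.reg .out) (.lit 1)) (compare a)

theorem compareRows_loopFree (m : ℕ) : (compareRows m).LoopFree := by
  simp [compareRows, forAtoms_loopFree, when, compare, push, block, Cmd.LoopFree]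

theorem compareRows_writesReg {x : Var} (h₁ : x ≠ .tl) (h₂ : x ≠ .out) :
    ¬ (compareRows m).WritesReg x := by
  simp [compareRows, forAtoms_writesReg, when, compare, push, block, Cmd.WritesReg, h₁, h₂]

theorem compareRows_writesArr {r : Arr} (h₁ : r ≠ .todoX) (h₂ : r ≠ .todoY) :
    ¬ (compareRows m).WritesArr r := by
  simp [compareRows, forAtoms_writesArr, when, compare, push, block, Cmd.WritesArr, h₁, h₂]

/-- The entries of the rows of `x` and `y` for the first `c` atoms have been compared, with the
queue of the memory `s` at the start. -/
structure Compared (τ : T → ℕ) (D : ℕ → Row T P) (N : ℕ) (s : Mem Var Arr) (x y c : ℕ)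
    (s' : Mem Var Arr) : Prop where
  tl : s.reg .tl ≤ s'.reg .tl
  tl_le : s'.reg .tl ≤ s.reg .tl + c
  old : ∀ i < s.reg .tl, s'.arr .todoX i = s.arr .todoX i ∧ s'.arr .todoY i = s.arr .todoY i
  lt : ∀ i, s.reg .tl ≤ i → i < s'.reg .tl → s'.arr .todoX i < N ∧ s'.arr .todoY i < N
  out : s'.reg .out = 0 ∨ s'.reg .out = 1
  sound : LangEq D (D x) (D y) → s'.reg .out = 1 ∧ ∀ i, s.reg .tl ≤ i → i < s'.reg .tl →
    LangEq D (D (s'.arr .todoX i)) (D (s'.arr .todoY i))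
  -- The targets have only been queued, so nothing is known about them yet: the rows match up to any
  -- relation that contains the new pairs.
  complete : s'.reg .out = 1 → ∀ E : ℕ → ℕ → Prop, (∀ i, s.reg .tl ≤ i → i < s'.reg .tl →
    E (s'.arr .todoX i) (s'.arr .todoY i)) →
    ∀ a < c, (D x (atomOf τ a)).Match E (D y (atomOf τ a))

theorem compareRows_run (hD : ∀ x < N, ∀ α p y, D x α = .step p y → y < N)
    (hlive : ∀ x α p y, D x α = .step p y → Live D y) {S : Set P} (hS : Set.InjOn code S)
    (hact : ∀ x α p y, D x α = .step p y → p ∈ S)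
    (h : ∀ x < N, HoldsRow m τ code s .delta x (D x)) {x y : ℕ} (hx : s.reg .x = x)
    (hy : s.reg .y = y) (hxN : x < N) (hyN : y < N) (hout : s.reg .out = 1) :
    Compared τ D N s x y (2 ^ m) ((compareRows m).run s) := by
  suffices hI : ∃ s', s' = (compareRows m).run s ∧ s'.reg .x = x ∧ s'.reg .y = y ∧
      (∀ z < N, HoldsRow m τ code s' .delta z (D z)) ∧ Compared τ D N s x y (2 ^ m) s' by
    obtain ⟨s', rfl, -, -, -, h⟩ := hI
    exact h
  refine ⟨_, rfl, ?_⟩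
  refine forAtoms_run_inv (fun c s' => s'.reg .x = x ∧ s'.reg .y = y ∧
      (∀ z < N, HoldsRow m τ code s' .delta z (D z)) ∧ Compared τ D N s x y c s')
    ⟨hx, hy, h, by omega, by omega, fun _ _ => ⟨rfl, rfl⟩, fun i _ _ => by omega, Or.inr hout,
      fun _ => ⟨hout, fun i _ _ => by omega⟩, fun _ _ _ a ha => by omega⟩ ?_
  rintro c hc s' ⟨hx', hy', hrows, hC⟩
  by_cases ho : s'.reg .out = 1
  swap
  · have hrun : (when (.eq (.reg .out) (.lit 1)) (compare c)).run s' = s' := by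
      simp [when, Cmd.run, Cnd.eval_eq_iff, Tm.eval, ho]
    rw [hrun]
    exact ⟨hx', hy', hrows, hC.tl, hC.tl_le.trans (by omega), hC.old, hC.lt, hC.out, hC.sound,
      fun h => (ho h).elim⟩
  have hrun : (when (.eq (.reg .out) (.lit 1)) (compare c)).run s' = (compare c).run s' := by
    simp [when, Cmd.run, Cnd.eval_eq_iff, Tm.eval, ho]
  rw [hrun]
  rcases compare_run hx' hy' (hrows x hxN c hc) (hrows y hyN c hc)
    (fun p p' x' y' h₁ h₂ h₃ => hS (hact _ _ _ _ h₁) (hact _ _ _ _ h₂) h₃) with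
    ⟨e, hm⟩ | ⟨p, x', y', h₁, h₂, e⟩ | ⟨e, hm⟩
  · rw [e]
    refine ⟨hx', hy', hrows, hC.tl, hC.tl_le.trans (by omega), hC.old, hC.lt, hC.out, hC.sound,
      fun h E hE a ha => ?_⟩
    by_cases hac : a = c
    · exact hac ▸ hm E
    · exact hC.complete h E hE a (by omega)
  · rw [e]
    have htl := hC.tl
    have htl' := hC.tl_le
    have hgX : ∀ i, (((s'.put .todoX (s'.reg .tl) x').put .todoY (s'.reg .tl) y').set .tl
        (s'.reg .tl + 1)).arr .todoX i = if i = s'.reg .tl then x' else s'.arr .todoX i :=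
      fun i => by simp
    have hgY : ∀ i, (((s'.put .todoX (s'.reg .tl) x').put .todoY (s'.reg .tl) y').set .tl
        (s'.reg .tl + 1)).arr .todoY i = if i = s'.reg .tl then y' else s'.arr .todoY i :=
      fun i => by simp
    have hgt : (((s'.put .todoX (s'.reg .tl) x').put .todoY (s'.reg .tl) y').set .tl
        (s'.reg .tl + 1)).reg .tl = s'.reg .tl + 1 := by simp
    have hgo : (((s'.put .todoX (s'.reg .tl) x').put .todoY (s'.reg .tl) y').set .tl
        (s'.reg .tl + 1)).reg .out = s'.reg .out := by simp
    refine ⟨by simp [hx'], by simp [hy'], fun z hz a ha => (hrows z hz a ha).congr (by simp)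
      (by simp) (by simp), ?_, ?_, fun i hi => ?_, fun i hi hi' => ?_, ?_, fun hL => ?_,
      fun _ E hE a ha => ?_⟩
    · rw [hgt]; omega
    · rw [hgt]; omega
    · rw [hgX, hgY, if_neg (by omega), if_neg (by omega)]
      exact hC.old i hi
    · rw [hgt] at hi'
      rw [hgX, hgY]
      split_ifs with hi''
      · exact ⟨hD x hxN _ _ _ h₁, hD y hyN _ _ _ h₂⟩
      · exact hC.lt i hi (by omega)
    · rw [hgo]; exact hC.out
    · refine ⟨by rw [hgo, ho], fun i hi hi' => ?_⟩
      rw [hgt] at hi'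
      rw [hgX, hgY]
      split_ifs with hi''
      · have := match_of_langEq (fun α p y h => hlive x α p y h)
          (fun α p y' h => hlive y α p y' h) hL (atomOf τ c)
        rw [h₁, h₂] at this
        exact this.2
      · exact (hC.sound hL).2 i hi (by omega)
    · rw [hgt] at hE
      by_cases hac : a = c
      · subst hac
        rw [h₁, h₂]
        have := hE (s'.reg .tl) (by omega) (by omega)
        rw [hgX, hgY, if_pos rfl, if_pos rfl] at this
        exact ⟨rfl, this⟩
      · refine hC.complete ho E (fun i hi hi' => ?_) a (by omega)
        have := hE i hi (by omega)
        rwa [hgX, hgY, if_neg (by omega), if_neg (by omega)] at this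
  · rw [e]
    refine ⟨by simp [hx'], by simp [hy'], fun z hz a ha => (hrows z hz a ha).congr rfl rfl rfl,
      by simpa using hC.tl, by simpa using hC.tl_le.trans (by omega), hC.old, fun i hi hi' => ?_,
      Or.inl (by simp), fun hL => ?_, fun h => by simp at h⟩
    · exact hC.lt i hi (by simpa using hi')
    · exact (hm _ (match_of_langEq (fun α p y h => hlive x α p y h)
          (fun α p y' h => hlive y α p y' h) hL (atomOf τ c))).elim

end Prog

/-- The invariant of the algorithm of Hopcroft and Karp. -/
structure Joined (m : ℕ) (τ : T → ℕ) (code : P → ℕ) (D : ℕ → Row T P) (N x₁ x₂ : ℕ) (rt : ℕ → ℕ)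
    (s : Mem Var Arr) : Prop where
  rows : ∀ x < N, HoldsRow m τ code s .delta x (D x)
  forest : Forest N (s.arr .parent) (s.arr .rank) rt
  lt : ∀ i < s.reg .tl, s.arr .todoX i < N ∧ s.arr .todoY i < N
  out : s.reg .out = 0 ∨ s.reg .out = 1
  sound : LangEq D (D x₁) (D x₂) → s.reg .out = 1 ∧ ∀ i, s.reg .hd ≤ i → i < s.reg .tl →
    LangEq D (D (s.arr .todoX i)) (D (s.arr .todoY i))
  -- While pairs are waiting, the classes are not yet a bisimulation. Quantifying over all
  -- equivalences that contain classes and queue anticipates the final partition; with an empty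
  -- queue the partition itself is a possible choice.
  complete : s.reg .out = 1 → ∀ E : ℕ → ℕ → Prop, Equivalence E →
    (∀ x < N, ∀ y < N, rt x = rt y → E x y) →
    (∀ i, s.reg .hd ≤ i → i < s.reg .tl → E (s.arr .todoX i) (s.arr .todoY i)) →
    E x₁ x₂ ∧ ∀ x < N, ∀ y < N, rt x = rt y →
      ∀ a < 2 ^ m, (D x (atomOf τ a)).Match E (D y (atomOf τ a))

/-- At the end, the output is right. -/
theorem Joined.out_eq_one_iff {x₁ x₂ : ℕ} (hD : ∀ x < N, ∀ α p y, D x α = .step p y → y < N)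
    (hat : ∀ α : Atom T, ∃ a < 2 ^ m, atomOf τ a = α) (h₁ : x₁ < N) (h₂ : x₂ < N)
    (h : Joined m τ code D N x₁ x₂ rt s) (he : s.reg .out = 1 → s.reg .tl ≤ s.reg .hd) :
    s.reg .out = 1 ↔ LangEq D (D x₁) (D x₂) := by
  refine ⟨fun ho => ?_, fun hL => (h.sound hL).1⟩
  have hle := he ho
  obtain ⟨h₃, h₄⟩ := h.complete ho (fun x y => rt x = rt y)
    ⟨fun _ => rfl, fun h => h.symm, fun h h' => h.trans h'⟩ (fun _ _ _ _ h => h)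
    fun i _ _ => by omega
  refine langEq_of_bisimulation hD (E := fun x y => rt x = rt y) (fun x hx y hy hxy α => ?_) h₁ h₂ h₃
  obtain ⟨a, ha, rfl⟩ := hat α
  exact h₄ x hx y hy hxy a ha

namespace Prog

/-- One round of the algorithm. -/
def joinBody (m : ℕ) : Prog := block [
    .set .x (.get .todoX (.reg .hd)),
    .set .y (.get .todoY (.reg .hd)),
    .set .hd (.succ (.reg .hd)),
    find .x .rx,
    find .y .ry,
    when (.not (.eq (.reg .rx) (.reg .ry))) (block [
      compareRows m,
      when (.eq (.reg .out) (.lit 1)) union])]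

/-- A bound for the number of steps of a round without those for finding roots. -/
def joinCost (m : ℕ) : ℕ := (compareRows m).bound + union.bound + 60

/-- The steps that the memory pays for. -/
def credit (m N K : ℕ) (s : Mem Var Arr) : ℕ :=
  -- A queued pair has paid for its own round, with `20 * (K + 1)` for each of two searches. A root
  -- has paid for the union that uses it up: for up to `2 ^ m` new pairs, and for the rise of the
  -- potential by `K`. A unit of potential is worth the 20 steps that a node of a path costs.
  (40 * (K + 1) + joinCost m) * (s.reg .tl - s.reg .hd) +
    (2 ^ m * (40 * (K + 1) + joinCost m) + 20 * K) * roots N (s.arr .parent) +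
    20 * potential N K (s.arr .parent) (s.arr .rank)

/-- If the roots agree, the round is paid by the pair it removes. If they differ and no conflict is
found, a root disappears and pays for the new pairs. After a conflict the loop ends, so only the
cost of this round matters. The number 7 is the cost of the test of the loop. -/
theorem joinBody_exec (hD : ∀ x < N, ∀ α p y, D x α = .step p y → y < N)
    (hlive : ∀ x α p y, D x α = .step p y → Live D y) {S : Set P} (hS : Set.InjOn code S)
    (hact : ∀ x α p y, D x α = .step p y → p ∈ S) (hK : N ≤ ack K 1) {x₁ x₂ : ℕ}
    (h : Joined m τ code D N x₁ x₂ rt s) (hlt : s.reg .hd < s.reg .tl) (hout : s.reg .out = 1) :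
    ∃ s' k rt', Exec (joinBody m) s s' k ∧ Joined m τ code D N x₁ x₂ rt' s' ∧
      k + 7 ≤ credit m N K s ∧ (s'.reg .out = 1 → 7 + k + credit m N K s' ≤ credit m N K s) := by
  set x := s.arr .todoX (s.reg .hd) with hx
  set y := s.arr .todoY (s.reg .hd) with hy
  obtain ⟨hxN, hyN⟩ := h.lt _ hlt
  rw [← hx] at hxN
  rw [← hy] at hyN
  set s₁ := ((s.set .x x).set .y y).set .hd (s.reg .hd + 1) with hs₁
  obtain ⟨l₁, s₂, k₁, e₁, hk₁, r₁, f₁, n₁, p₁⟩ := find_runs (v := .x) (r := .rx) (by simp) (by simp)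
    (by simp) (s := s₁) h.forest (x := x) (by simp [hs₁]) hxN hK
  have hreg₁ : ∀ v, v ≠ .rx → v ≠ .z → v ≠ .w → s₂.reg v = s₁.reg v := fun v g₁ g₂ g₃ =>
    e₁.reg_eq (find_writesReg g₁ g₂ g₃)
  obtain ⟨l₂, s₃, k₂, e₂, hk₂, r₂, f₂, n₂, p₂⟩ := find_runs (v := .y) (r := .ry) (by simp) (by simp)
    (by simp) (s := s₂) f₁ (x := y) (by rw [hreg₁ _ (by simp) (by simp) (by simp)]; simp [hs₁])
    hyN hK
  have hreg₂ : ∀ v, v ≠ .ry → v ≠ .z → v ≠ .w → s₃.reg v = s₂.reg v := fun v g₁ g₂ g₃ =>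
    e₂.reg_eq (find_writesReg g₁ g₂ g₃)
  have harr : ∀ r, r ≠ .parent → s₃.arr r = s.arr r := fun r hr =>
    (e₂.arr_eq (find_writesArr hr)).trans (e₁.arr_eq (find_writesArr hr))
  have hreg : ∀ v, v ≠ .rx → v ≠ .ry → v ≠ .z → v ≠ .w → s₃.reg v = s₁.reg v :=
    fun v g₁ g₂ g₃ g₄ => (hreg₂ v g₂ g₃ g₄).trans (hreg₁ v g₁ g₃ g₄)
  have hrx : s₃.reg .rx = rt x := by rw [hreg₂ _ (by simp) (by simp) (by simp), r₁]
  have hx₃ : s₃.reg .x = x := by rw [hreg _ (by simp) (by simp) (by simp) (by simp)]; simp [hs₁]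
  have hy₃ : s₃.reg .y = y := by rw [hreg _ (by simp) (by simp) (by simp) (by simp)]; simp [hs₁]
  have hhd₃ : s₃.reg .hd = s.reg .hd + 1 := by
    rw [hreg _ (by simp) (by simp) (by simp) (by simp)]; simp [hs₁]
  have htl₃ : s₃.reg .tl = s.reg .tl := by
    rw [hreg _ (by simp) (by simp) (by simp) (by simp)]; simp [hs₁]
  have hout₃ : s₃.reg .out = 1 := by
    rw [hreg _ (by simp) (by simp) (by simp) (by simp)]; simp [hs₁, hout]
  have hrows₃ : ∀ z < N, HoldsRow m τ code s₃ .delta z (D z) := fun z hz a ha =>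
    (h.rows z hz a ha).congr (by rw [harr _ (by simp)]) (by rw [harr _ (by simp)])
      (by rw [harr _ (by simp)])
  -- the beginning of the round
  have hexec : ∀ {s' k}, Exec (when (.not (.eq (.reg .rx) (.reg .ry))) (block [compareRows m,
      when (.eq (.reg .out) (.lit 1)) union])) s₃ s' k →
      Exec (joinBody m) s s' (3 + (3 + (3 + (k₁ + (k₂ + k))))) := fun {s' k} he => by
    have a₁ : Exec (V := Var) (A := Arr) (.set .x (.get .todoX (.reg .hd))) s (s.set .x x) 3 :=
      .set _ _ _
    have a₂ : Exec (V := Var) (A := Arr) (.set .y (.get .todoY (.reg .hd))) (s.set .x x)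
        ((s.set .x x).set .y y) 3 := by
      have := Exec.set (V := Var) (A := Arr) .y (.get .todoY (.reg .hd)) (s.set .x x)
      simpa [Tm.eval, Tm.cost, ← hy] using this
    have a₃ : Exec (V := Var) (A := Arr) (.set .hd (.succ (.reg .hd))) ((s.set .x x).set .y y)
        s₁ 3 := by
      have := Exec.set (V := Var) (A := Arr) .hd (.succ (.reg .hd)) ((s.set .x x).set .y y)
      simpa [Tm.eval, Tm.cost, ← hs₁] using this
    exact .seq a₁ (.seq a₂ (.seq a₃ (.seq e₁ (.seq e₂ he))))
  have hw : (s.reg .tl - s.reg .hd) = (s.reg .tl - (s.reg .hd + 1)) + 1 := by omega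
  have hpot : 20 * potential N K (s₃.arr .parent) (s₃.arr .rank) + 20 * (l₁ + l₂) ≤
      20 * potential N K (s.arr .parent) (s.arr .rank) + 40 * (K + 1) := by
    have : s₁.arr = s.arr := rfl
    rw [this] at p₁
    omega
  have hroots : roots N (s₃.arr .parent) = roots N (s.arr .parent) := n₂.trans n₁
  have hsplit : credit m N K s = (40 * (K + 1) + joinCost m) +
      (40 * (K + 1) + joinCost m) * (s.reg .tl - (s.reg .hd + 1)) +
      (2 ^ m * (40 * (K + 1) + joinCost m) + 20 * K) * roots N (s.arr .parent) +
      20 * potential N K (s.arr .parent) (s.arr .rank) := by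
    rw [credit, hw]; ring
  by_cases hrt : rt x = rt y
  · refine ⟨s₃, _, rt, hexec (.ite_false ?_ (.skip _)), ?_, ?_, fun _ => ?_⟩
    · rw [← Bool.not_eq_true, Cnd.eval_not_iff, Cnd.eval_eq_iff, not_not]
      simp [Tm.eval, hrx, r₂, hrt]
    · refine ⟨hrows₃, f₂, fun i hi => ?_, Or.inr hout₃, fun hL => ⟨hout₃, fun i hi hi' => ?_⟩,
        fun _ E hE h₁ h₂ => ?_⟩
      · rw [harr _ (by simp), harr _ (by simp)]
        exact h.lt i (by omega)
      · rw [harr _ (by simp), harr _ (by simp)]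
        exact (h.sound hL).2 i (by omega) (by omega)
      · refine h.complete hout E hE h₁ fun i hi hi' => ?_
        by_cases hi'' : i = s.reg .hd
        · subst hi''
          -- The pair may be dropped from the queue, because its states are already in one class.
          exact h₁ x hxN y hyN hrt
        · have := h₂ i (by omega) (by omega)
          rwa [harr _ (by simp), harr _ (by simp)] at this
    · rw [hsplit]
      simp only [joinCost, Cnd.cost, Tm.cost] at *
      omega
    · rw [hsplit, credit, hroots, htl₃, hhd₃]
      simp only [joinCost, Cnd.cost, Tm.cost] at *
      omega
  · have hcmp := compareRows_run hD hlive hS hact hrows₃ hx₃ hy₃ hxN hyN hout₃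
    obtain ⟨k₃, hk₃, e₃⟩ := (compareRows_loopFree m).exec s₃
    have hreg₄ : ∀ v, v ≠ .tl → v ≠ .out → ((compareRows m).run s₃).reg v = s₃.reg v :=
      fun v g₁ g₂ => Cmd.run_reg_of_not_writes (compareRows_writesReg g₁ g₂) s₃
    have harr₄ : ∀ r, r ≠ .todoX → r ≠ .todoY → ((compareRows m).run s₃).arr r = s₃.arr r :=
      fun v g₁ g₂ => Cmd.run_arr_of_not_writes (compareRows_writesArr g₁ g₂) s₃
    set s₄ := (compareRows m).run s₃ with hs₄
    have hrows₄ : ∀ z < N, HoldsRow m τ code s₄ .delta z (D z) := fun z hz a ha =>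
      (hrows₃ z hz a ha).congr (by rw [harr₄ _ (by simp) (by simp)])
        (by rw [harr₄ _ (by simp) (by simp)]) (by rw [harr₄ _ (by simp) (by simp)])
    have hcond : (Cnd.not (.eq (.reg .rx) (.reg .ry)) : Cnd Var Arr).eval s₃ = true := by
      rw [Cnd.eval_not_iff, Cnd.eval_eq_iff]
      simp [Tm.eval, hrx, r₂, hrt]
    have hhd₄ : s₄.reg .hd = s.reg .hd + 1 := by rw [hreg₄ _ (by simp) (by simp), hhd₃]
    have htl₄ := hcmp.tl
    have htl₄' := hcmp.tl_le
    rw [htl₃] at htl₄ htl₄'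
    have hpar₄ : s₄.arr .parent = s₃.arr .parent := harr₄ _ (by simp) (by simp)
    have hrank₄ : s₄.arr .rank = s₃.arr .rank := harr₄ _ (by simp) (by simp)
    have hlt₄ : ∀ i < s₄.reg .tl, s₄.arr .todoX i < N ∧ s₄.arr .todoY i < N := fun i hi => by
      by_cases hi' : i < s₃.reg .tl
      · rw [(hcmp.old i hi').1, (hcmp.old i hi').2, harr _ (by simp), harr _ (by simp)]
        exact h.lt i (by omega)
      · exact hcmp.lt i (by omega) hi
    have hsound₄ : LangEq D (D x₁) (D x₂) → s₄.reg .out = 1 ∧ ∀ i, s₄.reg .hd ≤ i →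
        i < s₄.reg .tl → LangEq D (D (s₄.arr .todoX i)) (D (s₄.arr .todoY i)) := fun hL => by
      have hq := (h.sound hL).2
      obtain ⟨g₁, g₂⟩ := hcmp.sound (hq _ le_rfl hlt)
      refine ⟨g₁, fun i hi hi' => ?_⟩
      by_cases hi'' : i < s₃.reg .tl
      · rw [(hcmp.old i hi'').1, (hcmp.old i hi'').2, harr _ (by simp), harr _ (by simp)]
        exact hq i (by omega) (by omega)
      · exact g₂ i (by omega) hi'
    -- The pair `(x, y)` has left the queue but is not united yet, so `E x y` is an extra hypothesis
    -- for the moment; the union provides it.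
    have hcompl₄ : s₄.reg .out = 1 → ∀ E : ℕ → ℕ → Prop, Equivalence E → E x y →
        (∀ x < N, ∀ y < N, rt x = rt y → E x y) →
        (∀ i, s₄.reg .hd ≤ i → i < s₄.reg .tl → E (s₄.arr .todoX i) (s₄.arr .todoY i)) →
        E x₁ x₂ ∧ (∀ x < N, ∀ y < N, rt x = rt y →
          ∀ a < 2 ^ m, (D x (atomOf τ a)).Match E (D y (atomOf τ a))) ∧
          ∀ a < 2 ^ m, (D x (atomOf τ a)).Match E (D y (atomOf τ a)) := by
      intro ho E hE hxy hcl hq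
      have g := h.complete hout E hE hcl fun i hi hi' => by
        by_cases hi'' : i = s.reg .hd
        · subst hi''
          exact hxy
        · have := hq i (by omega) (by omega)
          rwa [(hcmp.old i (by omega)).1, (hcmp.old i (by omega)).2, harr _ (by simp),
            harr _ (by simp)] at this
      exact ⟨g.1, g.2, hcmp.complete ho E fun i hi hi' => hq i (by omega) hi'⟩
    have hrootpos : 1 ≤ roots N (s.arr .parent) := h.forest.roots_pos hxN
    by_cases ho : s₄.reg .out = 1
    · obtain ⟨k₄, hk₄, e₄⟩ := union_loopFree.exec s₄
      have hrtx := h.forest.rt_lt x hxN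
      have hrty := h.forest.rt_lt y hyN
      obtain ⟨rt', g₁, g₂, g₃, g₄⟩ := union_run (K := K) (s := s₄) (rt := rt) (a := rt x)
        (b := rt y) (by rw [hpar₄, hrank₄]; exact f₂) hrtx hrty hrt
        (by rw [hpar₄]; exact f₂.p_rt x hxN) (by rw [hpar₄]; exact f₂.p_rt y hyN)
        (by rw [hreg₄ _ (by simp) (by simp), hrx]) (by rw [hreg₄ _ (by simp) (by simp), r₂])
      have hreg₅ : (union.run s₄).reg = s₄.reg := by
        funext v
        exact Cmd.run_reg_of_not_writes (by simp [union, when, block, Cmd.WritesReg]) s₄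
      have harr₅ : ∀ r, r ≠ .parent → r ≠ .rank → (union.run s₄).arr r = s₄.arr r :=
        fun r h₁ h₂ => Cmd.run_arr_of_not_writes
          (by simp [union, when, block, Cmd.WritesArr, h₁, h₂]) s₄
      set s₅ := union.run s₄ with hs₅
      rw [hpar₄, hroots] at g₂
      rw [hpar₄, hrank₄] at g₃
      have hB : (40 * (K + 1) + joinCost m) * (s₄.reg .tl - (s.reg .hd + 1)) ≤
          (40 * (K + 1) + joinCost m) * (s.reg .tl - (s.reg .hd + 1)) +
            2 ^ m * (40 * (K + 1) + joinCost m) := by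
        rw [mul_comm (2 ^ m), ← mul_add]
        exact Nat.mul_le_mul_left _ (by omega)
      -- The share of the root that is used up. It covers the new pairs, counted in `hB`, and the
      -- rise of the potential in `g₃`.
      have hR : (2 ^ m * (40 * (K + 1) + joinCost m) + 20 * K) * roots N (s.arr .parent) =
          (2 ^ m * (40 * (K + 1) + joinCost m) + 20 * K) * roots N (s₅.arr .parent) +
          (2 ^ m * (40 * (K + 1) + joinCost m) + 20 * K) := by
        rw [← g₂]; ring
      refine ⟨s₅, _, rt', hexec (.ite_true hcond (.seq e₃ (.ite_true ?_ e₄))), ?_, ?_, fun _ => ?_⟩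
      · rw [Cnd.eval_eq_iff]
        simp [Tm.eval, ho]
      · refine ⟨fun z hz a ha => (hrows₄ z hz a ha).congr (by rw [harr₅ _ (by simp) (by simp)])
          (by rw [harr₅ _ (by simp) (by simp)]) (by rw [harr₅ _ (by simp) (by simp)]), g₁, ?_,
          Or.inr (by rw [hreg₅, ho]), ?_, fun _ E hE hcl hq => ?_⟩
        · rw [hreg₅, harr₅ _ (by simp) (by simp), harr₅ _ (by simp) (by simp)]
          exact hlt₄
        · rw [hreg₅, harr₅ _ (by simp) (by simp), harr₅ _ (by simp) (by simp)]
          exact hsound₄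
        · rw [hreg₅, harr₅ _ (by simp) (by simp), harr₅ _ (by simp) (by simp)] at hq
          obtain ⟨c₁, c₂, c₃⟩ := hcompl₄ ho E hE (hcl x hxN y hyN ((g₄ x y).2 (by simp)))
            (fun z hz z' hz' e => hcl z hz z' hz' ((g₄ z z').2 (Or.inl e))) hq
          refine ⟨c₁, fun z hz z' hz' e a ha => ?_⟩
          have hT : ∀ x y z, E x y → E y z → E x z := fun _ _ _ => hE.trans
          -- Two states of a new class were in one class before, or they come from the two united
          -- classes. In the latter case their rows are linked through those of `x` and `y`, which
          -- have just been compared; here transitivity and symmetry of `E` are needed.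
          rcases (g₄ z z').1 e with e | ⟨h₁, h₂⟩ | ⟨h₁, h₂⟩
          · exact c₂ z hz z' hz' e a ha
          · exact ((c₂ z hz x hxN h₁ a ha).trans hT (c₃ a ha)).trans hT
              (c₂ y hyN z' hz' h₂.symm a ha)
          · exact ((c₂ z hz y hyN h₁ a ha).trans hT
              ((c₃ a ha).symm fun _ _ => hE.symm)).trans hT (c₂ x hxN z' hz' h₂.symm a ha)
      · rw [hsplit]
        simp only [joinCost, Cnd.cost, Tm.cost] at *
        omega
      · rw [hsplit, hR, credit, hreg₅, hhd₄]
        -- The products become variables, so that the inequality is linear.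
        generalize (2 ^ m * (40 * (K + 1) + joinCost m) + 20 * K) * roots N (s₅.arr .parent) = r₀ at *
        generalize (40 * (K + 1) + joinCost m) * (s₄.reg .tl - (s.reg .hd + 1)) = r₁ at *
        generalize (40 * (K + 1) + joinCost m) * (s.reg .tl - (s.reg .hd + 1)) = r₂ at *
        generalize 2 ^ m * (40 * (K + 1) + joinCost m) = r₃ at *
        simp only [joinCost, Cnd.cost, Tm.cost] at *
        omega
    · refine ⟨s₄, _, rt, hexec (.ite_true hcond (.seq e₃ (.ite_false ?_ (.skip _)))), ?_, ?_,
        fun h => (ho h).elim⟩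
      · rw [← Bool.not_eq_true, Cnd.eval_eq_iff]
        simp [Tm.eval, ho]
      · exact ⟨hrows₄, by rw [hpar₄, hrank₄]; exact f₂, hlt₄, hcmp.out, hsound₄,
          fun h => (ho h).elim⟩
      · rw [hsplit]
        simp only [joinCost, Cnd.cost, Tm.cost] at *
        omega

end Prog

end HopcroftKarp

end GKAT

namespace GKAT

/-! ### The decision procedure -/

section Decide

variable {T P : Type*} {m : ℕ} {τ : T → ℕ} {code : P → ℕ} {s : Mem Var Arr}
  {D : ℕ → Row T P} {N K : ℕ}

theorem langEq_prune {x y : ℕ} :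
    LangEq (prune D) (prune D x) (prune D y) ↔ LangEq D (D x) (D y) :=
  forall₂_congr fun _ _ => iff_congr accepts_prune accepts_prune

/-- The number is the one whose binary digits are the truth values of the tests. This is where the
numbering has to be a bijection: the unrolled loops must reach every atom. -/
theorem exists_atomOf_eq (τ : T ≃ Fin m) (α : Atom T) :
    ∃ a < 2 ^ m, atomOf (fun t => (τ t : ℕ)) a = α := by
  refine ⟨Nat.ofBits fun i => α (τ.symm i), Nat.ofBits_lt_two_pow _, ?_⟩
  funext t
  simp [atomOf, Nat.testBit_ofBits_lt]

namespace Prog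

/-- The bound is the credit at the start, with one queued pair, at most `N` roots and potential `N *
K`, and the cost of the initialization and of the last test. -/
theorem hopcroftKarp_runs (hD : ∀ x < N, ∀ α p y, D x α = .step p y → y < N)
    (hlive : ∀ x α p y, D x α = .step p y → Live D y) {S : Set P} (hS : Set.InjOn code S)
    (hact : ∀ x α p y, D x α = .step p y → p ∈ S) (hK : N ≤ ack K 1)
    (hat : ∀ α : Atom T, ∃ a < 2 ^ m, atomOf τ a = α) {x₁ x₂ : ℕ} (h₁ : x₁ < N) (h₂ : x₂ < N)
    (h : HoldsMap m τ code s N D) (hs₁ : s.reg .start1 = x₁) (hs₂ : s.reg .start2 = x₂) :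
    Runs (hopcroftKarp m) s (14 * N + 27 + ((40 * (K + 1) + joinCost m) +
      (2 ^ m * (40 * (K + 1) + joinCost m) + 20 * K) * N + 20 * (N * K))) fun s' =>
      (s'.reg .out = 0 ∨ s'.reg .out = 1) ∧ (s'.reg .out = 1 ↔ LangEq D (D x₁) (D x₂)) := by
  set s₁ := (((((s.set .hd 0).set .tl 0).put .todoX 0 x₁).put .todoY 0 x₂).set .tl 1) with hs
  set c := (40 * (K + 1) + joinCost m) + (2 ^ m * (40 * (K + 1) + joinCost m) + 20 * K) * N +
    20 * (N * K) with hc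
  have a₁ : Runs (block [.set .hd (.lit 0), .set .tl (.lit 0), push (.reg .start1) (.reg .start2)])
      s 13 (· = s₁) := by
    refine Runs.of_loopFree (by simp [block, push, Cmd.LoopFree])
      (by simp [block, push, Cmd.bound, Tm.cost]) ?_
    simp [block, push, Cmd.run, Tm.eval, hs₁, hs₂, hs]
  have a₂ := (disjointForest_runs (K := K) (s := s₁) (N := N) (by simp [hs, h.states])).and_reg_eq
  have a₄ : ∀ s₃, Joined m τ code D N x₁ x₂ id s₃ → credit m N K s₃ ≤ c →
      Runs (.loop (.and (.lt (.reg .hd) (.reg .tl)) (.eq (.reg .out) (.lit 1))) (joinBody m)) s₃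
        (c + 7) fun s' => (s'.reg .out = 0 ∨ s'.reg .out = 1) ∧
          (s'.reg .out = 1 ↔ LangEq D (D x₁) (D x₂)) := by
    intro s₃ hJ hcr
    -- Seven steps are always kept for the last test. After a conflict the credit is of no interest,
    -- since no further round follows.
    refine Runs.loop (fun s' u => ∃ rt, Joined m τ code D N x₁ x₂ rt s' ∧ 7 ≤ u ∧
      (s'.reg .out = 1 → credit m N K s' + 7 ≤ u)) ⟨id, hJ, by omega, fun _ => by omega⟩ ?_ ?_
    · rintro s' u ⟨rt, hJ, hu, hu'⟩ hb
      rw [Cnd.eval_and_iff, Cnd.eval_lt_iff, Cnd.eval_eq_iff] at hb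
      simp only [Tm.eval] at hb
      obtain ⟨s'', k, rt', he, hJ', hk, hk'⟩ := joinBody_exec hD hlive hS hact hK hJ hb.1 hb.2
      have := hu' hb.2
      refine ⟨k, s'', k, he, le_rfl, u - 7 - k, ⟨rt', hJ', by omega, fun ho => ?_⟩, ?_⟩
      · have := hk' ho
        omega
      · simp only [Cnd.cost, Tm.cost]
        omega
    · rintro s' u ⟨rt, hJ, hu, hu'⟩ hb
      refine ⟨by simpa [Cnd.cost, Tm.cost] using hu, hJ.out,
        hJ.out_eq_one_iff hD hat h₁ h₂ fun ho => ?_⟩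
      by_contra hlt
      have : (Cnd.and (.lt (.reg .hd) (.reg .tl)) (.eq (.reg .out) (.lit 1))).eval s' = true := by
        rw [Cnd.eval_and_iff, Cnd.eval_lt_iff, Cnd.eval_eq_iff]
        exact ⟨not_le.1 hlt, ho⟩
      simp [this] at hb
  have a₃ : ∀ s₂, (Forest N (s₂.arr .parent) (s₂.arr .rank) id ∧ roots N (s₂.arr .parent) ≤ N ∧
      potential N K (s₂.arr .parent) (s₂.arr .rank) = N * K) ∧
      (∀ x, ¬ disjointForest.WritesReg x → s₂.reg x = s₁.reg x) ∧
      (∀ a, ¬ disjointForest.WritesArr a → s₂.arr a = s₁.arr a) →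
      Runs (.seq (.set .out (.lit 1)) (.loop (.and (.lt (.reg .hd) (.reg .tl))
        (.eq (.reg .out) (.lit 1))) (joinBody m))) s₂ (2 + (c + 7)) fun s' =>
          (s'.reg .out = 0 ∨ s'.reg .out = 1) ∧
          (s'.reg .out = 1 ↔ LangEq D (D x₁) (D x₂)) := by
    rintro s₂ ⟨⟨k₁, k₂, k₃⟩, hreg, harr⟩
    have hhd : s₂.reg .hd = 0 := by
      rw [hreg _ (by simp [disjointForest, forUp, block, Cmd.WritesReg])]; simp [hs]
    have htl : s₂.reg .tl = 1 := by
      rw [hreg _ (by simp [disjointForest, forUp, block, Cmd.WritesReg])]; simp [hs]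
    have harr' : ∀ a, a ≠ .parent → a ≠ .rank → s₂.arr a = s₁.arr a := fun a g₁ g₂ =>
      harr a (by simp [disjointForest, forUp, block, Cmd.WritesArr, g₁, g₂])
    have hX : s₂.arr .todoX 0 = x₁ := by rw [harr' _ (by simp) (by simp)]; simp [hs]
    have hY : s₂.arr .todoY 0 = x₂ := by rw [harr' _ (by simp) (by simp)]; simp [hs]
    refine Runs.seq (R := (· = s₂.set .out 1)) ⟨_, _, .set _ _ _, le_rfl, rfl⟩ ?_
    rintro _ rfl
    refine a₄ _ ⟨fun x hx a ha => (h.rows x hx a ha).congr ?_ ?_ ?_, k₁,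
      fun i hi => ?_, Or.inr (by simp), fun hL => ⟨by simp, fun i _ hi => ?_⟩,
      fun _ E hE _ hq => ⟨?_, ?_⟩⟩ ?_
    · rw [Mem.set_arr, harr' _ (by simp) (by simp)]; simp [hs]
    · rw [Mem.set_arr, harr' _ (by simp) (by simp)]; simp [hs]
    · rw [Mem.set_arr, harr' _ (by simp) (by simp)]; simp [hs]
    · obtain rfl : i = 0 := by simpa [htl] using hi
      rw [Mem.set_arr, hX, hY]
      exact ⟨h₁, h₂⟩
    · obtain rfl : i = 0 := by simpa [htl] using hi
      rw [Mem.set_arr, hX, hY]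
      exact hL
    · have := hq 0 (by simp [hhd]) (by simp [htl])
      rwa [Mem.set_arr, hX, hY] at this
    -- At the start every class is a single state, so reflexivity of `E` suffices.
    · rintro x _ y _ rfl a _
      exact Entry.Match.refl hE.refl _
    · have := Nat.mul_le_mul_left (2 ^ m * (40 * (K + 1) + joinCost m) + 20 * K) k₂
      simp only [credit, Mem.set_reg, Mem.set_arr, reduceCtorEq, if_false, hhd, htl, k₃, hc]
      omega
  have a₅ : Runs (.seq disjointForest (.seq (.set .out (.lit 1)) (.loop
      (.and (.lt (.reg .hd) (.reg .tl)) (.eq (.reg .out) (.lit 1))) (joinBody m)))) s₁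
      (14 * N + 5 + (2 + (c + 7))) _ := a₂.seq a₃
  obtain ⟨t₁, k₁, e₁, hk₁, rfl⟩ := a₁
  obtain ⟨t₂, k₂, e₂, hk₂, hQ⟩ := a₅
  -- The program is composed to the right, while its first three commands were treated as one block;
  -- the execution has to be reassociated.
  cases e₁ with
  | seq b₁ b₂ =>
    cases b₂ with
    | seq b₂ b₃ => exact ⟨t₂, _, .seq b₁ (.seq b₂ (.seq b₃ e₂)), by omega, hQ⟩

end Prog

end Decide

end GKAT

open GKAT GKAT.Prog in
theorem mainTheorem2 (m : ℕ) :
    ∃ C : ℕ, ∀ (T : Type*) (P : Type*) (τ : T ≃ Fin m) (code : P → ℕ) (e₁ e₂ : GKAT.Exp T P),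
      Set.InjOn code (e₁.actions ∪ e₂.actions) →
      ∃ (s : GKAT.Mem GKAT.Var GKAT.Arr) (k : ℕ),
        GKAT.Exec (GKAT.Prog.decideEquiv m)
          (GKAT.inputMem
            (e₁.symbols (fun t => (τ t : ℕ)) code ++ e₂.symbols (fun t => (τ t : ℕ)) code)) s k ∧
        (e₁.den = e₂.den → s.reg .out = 1) ∧
        (e₁.den ≠ e₂.den → s.reg .out = 0) ∧
        k ≤ C * ((e₁.size + e₂.size) * GKAT.invAck (e₁.size + e₂.size)) := by
  -- The constant collects the estimates `b₁` to `b₆` below. It is fixed before the types and the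
  -- expressions, so it depends on `m` only.
  refine ⟨thompsonCost m + 2 * normalizeCost m + (55 + (120 + joinCost m) +
    2 * (2 ^ m * (120 + joinCost m) + 40) + 80), fun T P τ code e₁ e₂ hcode => ?_⟩
  set n := e₁.size + e₂.size with hn
  set N := e₁.acts + e₂.acts + 2 with hN
  have hn₂ : 2 ≤ n := by
    have := e₁.size_pos
    have := e₂.size_pos
    omega
  have hNn : N ≤ n + 2 := by
    have := e₁.acts_le_size
    have := e₂.acts_le_size
    omega
  have hα := invAck_pos hn₂
  set D := thompsonMap e₁ e₂ with hDdef
  have hat := exists_atomOf_eq τ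
  have hD : ∀ x < N, ∀ α p y, D x α = .step p y → y < N := fun x _ α p y h =>
    (thompsonMap_eq_step h).2
  have hstart : e₁.acts + e₂.acts < N := by omega
  have hstart' : e₁.acts + e₂.acts + 1 < N := by omega
  -- This fixes the parameter `K` of the amortized analysis as `invAck n + 1`. The automaton has at
  -- most one state per symbol, and two start states.
  have hK : N ≤ ack (invAck n + 1) 1 := hNn.trans (add_two_le_ack_invAck n)
  obtain ⟨s, k, he, hk, hout, hL⟩ := (thompson_runs (m := m) (code := code)
    (fun t => (τ t).isLt) e₁ e₂).seq fun s₁ ⟨m₁, p₁, q₁⟩ =>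
    (normalize_runs hD hat (by omega) m₁).seq fun s₂ ⟨m₂, p₂, q₂⟩ =>
      hopcroftKarp_runs (fun x hx α p y h => hD x hx α p y (live_of_prune_eq_step h).1)
        (fun x α p y h => (live_of_prune_eq_step h).2) hcode
        (fun x α p y h => (thompsonMap_eq_step (live_of_prune_eq_step h).1).1) hK hat hstart hstart'
        m₂ (p₂.trans p₁) (q₂.trans q₁)
  rw [langEq_prune, langEq_thompsonMap] at hL
  refine ⟨s, k, he, hL.2, fun hne => hout.resolve_right fun h => hne (hL.1 h), hk.trans ?_⟩
  generalize invAck n = a at *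
  generalize joinCost m = J
  have hN₂ : N ≤ 2 * n := by omega
  -- Here `1 ≤ a` is used: `80 ≤ 80 * a` and `J ≤ J * a`.
  have hA : 40 * (a + 1 + 1) + J ≤ (120 + J) * a := by
    have := Nat.mul_le_mul_left J hα
    linarith
  have hna : n ≤ n * a := Nat.le_mul_of_pos_right n hα
  have han : a ≤ n * a := Nat.le_mul_of_pos_left a (by omega)
  have b₁ : thompsonCost m * n ≤ thompsonCost m * (n * a) := Nat.mul_le_mul_left _ hna
  have b₂ : normalizeCost m * N ≤ normalizeCost m * (2 * (n * a)) :=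
    Nat.mul_le_mul_left _ (by omega)
  have b₃ : (40 * (a + 1 + 1) + J) ≤ (120 + J) * (n * a) :=
    hA.trans (Nat.mul_le_mul_left _ han)
  have b₄ : (2 ^ m * (40 * (a + 1 + 1) + J) + 20 * (a + 1)) * N ≤
      (2 ^ m * ((120 + J) * a) + 40 * a) * (2 * n) :=
    Nat.mul_le_mul (Nat.add_le_add (Nat.mul_le_mul_left _ hA) (by omega)) hN₂
  have b₅ : N * (a + 1) ≤ (2 * n) * (2 * a) := Nat.mul_le_mul hN₂ (by omega)
  have b₆ : 14 * N + 27 ≤ 55 * (n * a) := by omega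
  calc _ ≤ thompsonCost m * (n * a) + (normalizeCost m * (2 * (n * a)) + (55 * (n * a) +
        ((120 + J) * (n * a) + (2 ^ m * ((120 + J) * a) + 40 * a) * (2 * n) +
          20 * ((2 * n) * (2 * a))))) := by
        gcongr
    _ = _ := by ring
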